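/- Let $R$ be a finite dimensional unital associative algebra over $\mathbb C$ and let $e_1,\dots,e_m\in R$ be a complete set of primitive orthogonal idempotents. Let $R(x)=R\otimes_{\mathbb C}\mathbb C(x)$, let $\mathcal{QP}(R)=\bigoplus_{\alpha\in\mathbb C}R[x]\exp(\alpha x)$, regarded as a right $R$-module, and define the pairing $R[z]\times\mathcal{QP}(R)\to R$ by $\langle p(z),x^n\exp(\alpha x)r\rangle=p^{(n)}(\alpha)\,r$. For $f\in\mathcal{QP}(R)$ let $\mathcal W_f=\langle -,f\rangle:R[z]\to R$, a homomorphism of left $R$-modules, and for a right submodule $V\subseteq\mathcal{QP}(R)$ let $V^\perp=\bigcap_{f\in V}\ker\mathcal W_f$. The rational Grassmannian $\mathrm{Gr}^{\mathrm{Rat}}(R)$ is the set of free left $R$-submodules $M\subset R(z)$ for which there are nonzero $h,g\in\mathbb C[z]$ such that $hR[z]\subseteq M\subseteq g^{-1}R[z]$, $M/hR[z]$ is a direct summand of $g^{-1}R[z]/hR[z]$ as a left $R$-module, and $g^{-1}R[z]/M$ is free of rank $\deg g$. The decorated adelic Grassmannian $\widetilde{\mathrm{Gr}}^{\mathrm{Ad}}(R)$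 is the set of functions $\Phi(x,z)=P(x,\partial_x)\exp(xz)$, where $P$ is a monic differential operator with coefficients in $R(x)$ that right-divides (among such operators) a monic differential operator with constant coefficients in $R$. Let $l=\operatorname{ord}P$ and let $V\subset\mathcal{QP}(R)$ be the kernel of $P$. By an adapted basis of $\Phi$ we mean an $R$-basis $f_1,\dots,f_l$ of $V$ of the form $$f_j(x)=\sum_{k=1}^m p_{kj}(x)\exp(\alpha_{kj}x)\,e_k,\qquad p_{kj}\in R[x],\ \alpha_{kj}\in\mathbb C .$$ For exponents $\underline\alpha=(\alpha_{kj})$ put $g_{\underline\alpha}(z)=\sum_{k=1}^m\prod_{j=1}^l(z-\alpha_{kj})\,e_k$. For a point $\Phi$ with an adapted basis with exponents $\underline\alpha$ put $$\pi(\Phi)=\Phi_{\mathrm{norm}}(x,z)=\Phi(x,z)\,g_{\underline\alpha}(z)^{-1},\qquad \widetilde\iota(\Phi)=V^\perp\, g_{\underline\alpha}(z)^{-1};$$ both may depend on the adapted basis through $\underline\alpha$. The adelic Grassmannian $\mathrm{Gr}^{\mathrm{Ad}}(R)$ is the set of all normalized functions $\Phi_{\mathrm{norm}}$, for all $\Phi\in\widetilde{\mathrm{Gr}}^{\mathrm{Ad}}(R)$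 and all adapted bases of $\Phi$. Theorem C. Every $\Phi\in\widetilde{\mathrm{Gr}}^{\mathrm{Ad}}(R)$ has an adapted basis, and $\widetilde\iota(\Phi)\in\mathrm{Gr}^{\mathrm{Rat}}(R)$ for every $\Phi$ and every adapted basis of it. The map $\widetilde\iota$ descends under $\pi$: there is a map $\iota:\mathrm{Gr}^{\mathrm{Ad}}(R)\to\mathrm{Gr}^{\mathrm{Rat}}(R)$ with $\iota(\pi(\Phi))=\widetilde\iota(\Phi)$ for every $\Phi$ and every adapted basis of $\Phi$ (the same one on both sides). The map $\iota$ is injective. Its image consists of all points of $\mathrm{Gr}^{\mathrm{Rat}}(R)$ of the form $$\Big(\ker\mathcal W_{f_1}\cap\dots\cap\ker\mathcal W_{f_l}\Big)\cdot\Big[\sum_{k=1}^m\prod_{j=1}^l(z-\alpha_{kj})\,e_k\Big]^{-1}$$ with $l\ge 0$ and $f_j(x)=\sum_k p_{kj}(x)\exp(\alpha_{kj}x)e_k$ for some $p_{kj}\in R[x]$, $\alpha_{kj}\in\mathbb C$, such that $f_1,\dots,f_l$ is nondegenerate, i.e. the Wronski matrix $\big(f_j^{(i-1)}\big)_{i,j=1}^l$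 is invertible over the ring of $R$-valued meromorphic functions on $\mathbb C$. -/

import Mathlib

open Polynomial TensorProduct

namespace AdelicGr

noncomputable section

/-! ### Rational functions and their derivative -/

/-- The quotient rule, applied to the reduced fraction of `q`. -/
def ratDerivFun (q : RatFunc ℂ) : RatFunc ℂ :=
  algebraMap ℂ[X] (RatFunc ℂ) (derivative q.num * q.denom - q.num * derivative q.denom) /
    algebraMap ℂ[X] (RatFunc ℂ) q.denom ^ 2

/-- The quotient rule holds for every representation of a rational function as a fraction. -/
theorem ratDerivFun_div (n d : ℂ[X]) (hd : d ≠ 0) :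
    ratDerivFun (algebraMap ℂ[X] (RatFunc ℂ) n / algebraMap ℂ[X] (RatFunc ℂ) d) =
      algebraMap ℂ[X] (RatFunc ℂ) (derivative n * d - n * derivative d) /
        algebraMap ℂ[X] (RatFunc ℂ) d ^ 2 := by
  have hd' : algebraMap ℂ[X] (RatFunc ℂ) d ≠ 0 := RatFunc.algebraMap_ne_zero hd
  generalize hq : algebraMap ℂ[X] (RatFunc ℂ) n / algebraMap ℂ[X] (RatFunc ℂ) d = q
  have hD' : algebraMap ℂ[X] (RatFunc ℂ) q.denom ≠ 0 :=
    RatFunc.algebraMap_ne_zero (RatFunc.denom_ne_zero q)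
  have h1 : q.num * d = n * q.denom := by
    have h2 := hq.trans (RatFunc.num_div_denom q).symm
    rw [div_eq_div_iff hd' hD', ← map_mul, ← map_mul] at h2
    exact (RatFunc.algebraMap_injective ℂ h2).symm
  have h3 : derivative q.num * d + q.num * derivative d =
      derivative n * q.denom + n * derivative q.denom := by
    rw [← derivative_mul, ← derivative_mul, h1]
  have h4 : (derivative q.num * q.denom - q.num * derivative q.denom) * d ^ 2 =
      (derivative n * d - n * derivative d) * q.denom ^ 2 := by
    linear_combination (d * q.denom) * h3 -
      (q.denom * derivative d + d * derivative q.denom) * h1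
  rw [ratDerivFun, div_eq_div_iff (pow_ne_zero 2 hD') (pow_ne_zero 2 hd')]
  have h5 := congrArg (algebraMap ℂ[X] (RatFunc ℂ)) h4
  simpa only [map_mul, map_pow] using h5

/-- The derivative `d/dx` on `ℂ(x)`. -/
def ratDeriv : RatFunc ℂ →ₗ[ℂ] RatFunc ℂ where
  toFun := ratDerivFun
  map_add' p q := by
    have hp := RatFunc.algebraMap_ne_zero (RatFunc.denom_ne_zero p)
    have hq := RatFunc.algebraMap_ne_zero (RatFunc.denom_ne_zero q)
    have h : p + q = algebraMap ℂ[X] (RatFunc ℂ) (p.num * q.denom + p.denom * q.num) /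
        algebraMap ℂ[X] (RatFunc ℂ) (p.denom * q.denom) := by
      conv_lhs => rw [← RatFunc.num_div_denom p, ← RatFunc.num_div_denom q]
      rw [div_add_div _ _ hp hq]
      simp only [map_add, map_mul]
    rw [h, ratDerivFun_div _ _ (mul_ne_zero (RatFunc.denom_ne_zero p) (RatFunc.denom_ne_zero q)),
      ratDerivFun, ratDerivFun]
    simp only [derivative_mul, map_add, map_sub, map_mul]
    field_simp
    ring
  map_smul' c p := by
    have hs : ∀ q : ℂ[X], algebraMap ℂ[X] (RatFunc ℂ) (c • q) =
        c • algebraMap ℂ[X] (RatFunc ℂ) q := fun q => by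
      rw [Algebra.algebraMap_eq_smul_one, Algebra.algebraMap_eq_smul_one, smul_assoc]
    have h : c • p = algebraMap ℂ[X] (RatFunc ℂ) (c • p.num) /
        algebraMap ℂ[X] (RatFunc ℂ) p.denom := by
      conv_lhs => rw [← RatFunc.num_div_denom p]
      rw [hs, smul_div_assoc]
    rw [h, ratDerivFun_div _ _ (RatFunc.denom_ne_zero p), RingHom.id_apply, ratDerivFun,
      derivative_smul, smul_mul_assoc, smul_mul_assoc, ← smul_sub, hs, smul_div_assoc]

section Algebra

variable (R : Type*) [Ring R] [Algebra ℂ R]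

/-- `R(x) = R ⊗ ℂ(x)`: the localization of `R[x]` at the nonzero scalar polynomials. It is a left
`R`-module through the left factor. -/
abbrev RatR : Type _ := R ⊗[ℂ] RatFunc ℂ

/-- The embedding `R[x] → R(x)`, `∑ aₙ xⁿ ↦ ∑ aₙ ⊗ xⁿ`, as a map of left `R`-modules. -/
def polyToRat : R[X] →ₗ[R] RatR R :=
  Polynomial.lsum fun n => LinearMap.toSpanSingleton R (RatR R) ((1 : R) ⊗ₜ[ℂ] (RatFunc.X ^ n))

/-- The derivative on `R(x)`. -/
def ratRDeriv : RatR R →ₗ[ℂ] RatR R := LinearMap.lTensor R ratDeriv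

/-! ### Quasipolynomials and differential operators -/

/-- The space `QP(R) = ⨁_α R[x] exp(αx)`; `Finsupp.single α p` is the function `p(x) exp(αx)`.
It is a right `R`-module, that is, a module over the opposite ring. -/
abbrev QP : Type _ := ℂ →₀ R[X]

/-- The space `⨁_α R(x) exp(αx)`, on which the differential operators with coefficients in
`R(x)` act; it contains `R(x)` and `QP(R)`. -/
abbrev QR : Type _ := ℂ →₀ RatR R

variable {R}

/-- The inclusion of `QP(R)` into `⨁_α R(x) exp(αx)`. -/
def QP.toQR (f : QP R) : QR R := f.mapRange (polyToRat R) (map_zero _)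

/-- The derivative of a quasipolynomial: `(p exp(αx))' = (p' + αp) exp(αx)`. -/
def QP.deriv (f : QP R) : QP R :=
  f.sum fun α p => Finsupp.single α (derivative p + α • p)

/-- The function `ℂ → R` defined by a quasipolynomial. -/
def QP.eval (x : ℂ) (f : QP R) : R :=
  f.sum fun α p => Complex.exp (α * x) • p.eval (algebraMap ℂ R x)

variable (R)

/-- `∂ₓ` on `⨁_α R(x) exp(αx)`: `(u exp(αx))' = (u' + αu) exp(αx)`. -/
def dQR : Module.End ℂ (QR R) :=
  Finsupp.lsum ℂ fun α => (Finsupp.lsingle α).comp (ratRDeriv R + α • LinearMap.id)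

variable {R}

/-- Left multiplication by an element of `R(x)` on `⨁_α R(x) exp(αx)`. -/
def leftMulQR (a : RatR R) : Module.End ℂ (QR R) :=
  Finsupp.mapRange.linearMap (LinearMap.mulLeft ℂ a)

variable (R)

/-- A differential operator `∑ₖ aₖ(x) ∂ₓᵏ` with coefficients `aₖ ∈ R(x)`, given by its
coefficients. -/
abbrev DiffOp : Type _ := ℕ →₀ RatR R

variable {R}

/-- The action of a differential operator on `⨁_α R(x) exp(αx)`. -/
def DiffOp.act (P : DiffOp R) : Module.End ℂ (QR R) :=
  P.sum fun k a => leftMulQR a * dQR R ^ k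

/-- `P` is monic of order `l`. -/
def DiffOp.IsMonic (P : DiffOp R) (l : ℕ) : Prop :=
  P l = 1 ∧ ∀ k, l < k → P k = 0

/-- `P` has constant coefficients. -/
def DiffOp.IsConst (P : DiffOp R) : Prop :=
  ∀ k, ∃ c : R, P k = c ⊗ₜ[ℂ] (1 : RatFunc ℂ)

/-- `P` right-divides `L`, i.e. `L = QP` for some differential operator `Q`; the product of
differential operators is their composition. -/
def DiffOp.RightDivides (P L : DiffOp R) : Prop :=
  ∃ Q : DiffOp R, L.act = Q.act * P.act

/-- `P` is monic of order `l` and right-divides a monic operator with constant coefficients. -/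
def DiffOp.IsDarboux (P : DiffOp R) (l : ℕ) : Prop :=
  P.IsMonic l ∧ ∃ (L : DiffOp R) (n : ℕ), L.IsMonic n ∧ L.IsConst ∧ P.RightDivides L

/-- Right multiplication by `r ∈ R` on `⨁_α R(x) exp(αx)`. -/
def rightMulQR (r : R) : Module.End ℂ (QR R) :=
  Finsupp.mapRange.linearMap (LinearMap.mulRight ℂ (r ⊗ₜ[ℂ] (1 : RatFunc ℂ)))

theorem leftMulQR_comm (a : RatR R) (r : R) :
    Commute (leftMulQR a) (rightMulQR r) := by
  refine LinearMap.ext fun f => Finsupp.ext fun α => ?_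
  simp [leftMulQR, rightMulQR, mul_assoc]

theorem dQR_comm (r : R) : Commute (dQR R) (rightMulQR r) := by
  refine Finsupp.lhom_ext' fun α => LinearMap.ext fun u => ?_
  have h : ratRDeriv R (u * r ⊗ₜ[ℂ] (1 : RatFunc ℂ)) =
      ratRDeriv R u * r ⊗ₜ[ℂ] (1 : RatFunc ℂ) := by
    induction u using TensorProduct.induction_on with
    | zero => simp
    | tmul a q => simp [ratRDeriv]
    | add a b ha hb => simp only [add_mul, map_add, ha, hb]
  simp only [Module.End.mul_apply, LinearMap.comp_apply, dQR, rightMulQR, Finsupp.lsum_apply,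
    Finsupp.lsingle_apply, Finsupp.mapRange.linearMap_apply, Finsupp.mapRange_single,
    Finsupp.sum_single_index, map_zero, LinearMap.mulRight_apply, LinearMap.add_apply,
    LinearMap.smul_apply, LinearMap.id_apply, h, add_mul, smul_mul_assoc]

theorem act_comm (P : DiffOp R) (r : R) : Commute P.act (rightMulQR r) := by
  rw [DiffOp.act, Finsupp.sum]
  exact Commute.sum_left _ _ _ fun k _ =>
    (leftMulQR_comm _ r).mul_left ((dQR_comm r).pow_left k)

theorem toQR_op_smul (r : R) (f : QP R) :
    (MulOpposite.op r • f).toQR = rightMulQR r f.toQR := by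
  refine Finsupp.ext fun α => ?_
  have h : ∀ p : R[X], polyToRat R (MulOpposite.op r • p) =
      polyToRat R p * r ⊗ₜ[ℂ] (1 : RatFunc ℂ) := by
    intro p
    induction p using Polynomial.induction_on' with
    | add p q hp hq => simp only [smul_add, map_add, add_mul, hp, hq]
    | monomial n a =>
      rw [Polynomial.smul_monomial]
      simp [polyToRat, TensorProduct.smul_tmul']
  simp [QP.toQR, rightMulQR, h]

/-- The kernel of a differential operator in `QP(R)`, a right `R`-submodule. -/
def DiffOp.ker (P : DiffOp R) : Submodule Rᵐᵒᵖ (QP R) where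
  carrier := {f | P.act f.toQR = 0}
  zero_mem' := by simp [QP.toQR]
  add_mem' {f g} hf hg := by
    have h : (f + g).toQR = f.toQR + g.toQR := by
      simp [QP.toQR, Finsupp.mapRange_add]
    simp only [Set.mem_ofPred_eq] at hf hg ⊢
    rw [h, map_add, hf, hg, add_zero]
  smul_mem' r f hf := by
    simp only [Set.mem_ofPred_eq] at hf ⊢
    have h := LinearMap.congr_fun (act_comm P r.unop) f.toQR
    rw [← MulOpposite.op_unop r, toQR_op_smul]
    simpa [hf] using h

/-! ### Nondegeneracy -/

/-- The value at `x` of the Wronski matrix of `F₁, …, F_l`. -/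
def wronskian {l : ℕ} (F : Fin l → QP R) (x : ℂ) : Matrix (Fin l) (Fin l) R :=
  Matrix.of fun i j => (QP.deriv^[(i : ℕ)] (F j)).eval x

/-- An `R`-valued function on `ℂ` is meromorphic if its coordinates are. -/
def IsMeromorphic (f : ℂ → R) : Prop :=
  ∀ φ : Module.Dual ℂ R, MeromorphicOn (fun x => φ (f x)) Set.univ

/-- The Wronski matrix of `F₁, …, F_l` is invertible as a matrix over the ring of `R`-valued
meromorphic functions on `ℂ` (identified when they agree off a discrete closed set). -/
def IsNondegenerate {l : ℕ} (F : Fin l → QP R) : Prop :=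
  ∃ N : ℂ → Matrix (Fin l) (Fin l) R,
    (∀ i j, IsMeromorphic fun x => N x i j) ∧
    ∀ᶠ x in Filter.codiscrete ℂ, wronskian F x * N x = 1 ∧ N x * wronskian F x = 1

/-! ### The pairing and Wilson's conditions -/

/-- `W_f = ⟨-, f⟩`, where `⟨p(z), xⁿ exp(αx) r⟩ = p⁽ⁿ⁾(α) r`, as a map of left `R`-modules. -/
def wilson (f : QP R) : R[X] →ₗ[R] R where
  toFun p := f.sum fun α q => q.sum fun n r => (derivative^[n] p).eval (algebraMap ℂ R α) * r
  map_add' p q := by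
    simp only [iterate_map_add, eval_add, add_mul, Polynomial.sum_def, Finsupp.sum,
      Finset.sum_add_distrib]
  map_smul' s p := by
    simp only [Polynomial.iterate_derivative_smul, eval_smul, smul_eq_mul, mul_assoc, Polynomial.sum_def,
      Finsupp.sum, Finset.mul_sum, RingHom.id_apply]

/-- The orthogonal complement `V^⊥ ⊆ R[z]` with respect to the pairing. -/
def perp (V : Submodule Rᵐᵒᵖ (QP R)) : Submodule R R[X] :=
  ⨅ f ∈ V, LinearMap.ker (wilson f)

/-! ### The rational Grassmannian -/

/-- `N · c ⊆ R(z)` for a left `R`-submodule `N` of `R[z]` and `c ∈ R(z)`. -/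
def mulRat (N : Submodule R R[X]) (c : RatR R) : Submodule R (RatR R) :=
  (N.map (polyToRat R)).map (LinearMap.mulRight R c)

variable (R)

/-- The scalar multiple `c R[z]` for `c ∈ ℂ(z)`. -/
def scalarMul (c : RatFunc ℂ) : Submodule R (RatR R) :=
  mulRat (⊤ : Submodule R R[X]) ((1 : R) ⊗ₜ[ℂ] c)

/-- The rational Grassmannian: free left `R`-submodules `M` of `R(z)` with
`h R[z] ⊆ M ⊆ g⁻¹ R[z]` such that `M / h R[z]` is a direct summand of `g⁻¹ R[z] / h R[z]` and
`g⁻¹ R[z] / M` is free of rank `deg g`. -/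
def GrRat : Set (Submodule R (RatR R)) :=
  {M | Module.Free R M ∧ ∃ h g : ℂ[X], h ≠ 0 ∧ g ≠ 0 ∧
    let H := scalarMul R (algebraMap ℂ[X] (RatFunc ℂ) h)
    let G := scalarMul R (algebraMap ℂ[X] (RatFunc ℂ) g)⁻¹
    H ≤ M ∧ M ≤ G ∧
    IsComplemented ((M.submoduleOf G).map (H.submoduleOf G).mkQ) ∧
    Nonempty (Module.Basis (Fin g.natDegree) R (G ⧸ M.submoduleOf G))}

/-! ### The adelic Grassmannians -/

/-- Functions `ℂ × ℂ → R` defined for all `x`, `z` off finite sets, identified when they agree for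
all `x`, `z` off finite sets. The meromorphic functions that occur below have their poles on
finitely many lines `x = a`, `z = b`, and two of them are equal as meromorphic functions if and
only if they are equal here. -/
abbrev Mer : Type _ :=
  Filter.Germ ((Filter.cofinite : Filter ℂ) ×ˢ (Filter.cofinite : Filter ℂ)) R

variable {R}

/-- The value at `x` of an `R`-valued rational function, computed in coordinates with respect to a
basis of `R` over `ℂ` (the choice matters at poles at most). -/
def evalRat [Module.Finite ℂ R] (x : ℂ) (a : RatR R) : R :=
  ∑ i, (RatFunc.eval (RingHom.id ℂ) x
    (TensorProduct.lid ℂ (RatFunc ℂ) (LinearMap.rTensor (RatFunc ℂ)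
      ((Module.finBasis ℂ R).coord i) a))) • Module.finBasis ℂ R i

/-- The function `P(x, ∂ₓ) exp(xz)`, evaluated at `w = (x, z)`. -/
def waveFun [Module.Finite ℂ R] (P : DiffOp R) (w : ℂ × ℂ) : R :=
  P.sum fun k a => iteratedDeriv k (fun t : ℂ => Complex.exp (t * w.2)) w.1 • evalRat w.1 a

variable (R)

/-- The decorated adelic Grassmannian: the functions `P(x, ∂ₓ) exp(xz)` for the monic differential
operators `P` with rational coefficients that right-divide a monic differential operator with
constant coefficients. -/
def DecGrAd [Module.Finite ℂ R] : Set (Mer R) :=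
  {Φ | ∃ (P : DiffOp R) (l : ℕ), P.IsDarboux l ∧ Φ = ((waveFun P : ℂ × ℂ → R) : Mer R)}

variable {R}

/-- A primitive idempotent: a nonzero idempotent that is not the sum of two nonzero orthogonal
idempotents. -/
def IsPrimitiveIdempotent (e : R) : Prop :=
  IsIdempotentElem e ∧ e ≠ 0 ∧
    ∀ a b : R, IsIdempotentElem a → IsIdempotentElem b → a * b = 0 → b * a = 0 → e = a + b →
      a = 0 ∨ b = 0

variable {m l : ℕ}

/-- `f_j = ∑ₖ p_{kj}(x) exp(α_{kj} x) e_k`. -/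
def adapted (e : Fin m → R) (p : Fin m → Fin l → R[X]) (α : Fin m → Fin l → ℂ) (j : Fin l) :
    QP R :=
  ∑ k, Finsupp.single (α k j) (p k j * C (e k))

/-- `g_α(z) = ∑ₖ ∏ⱼ (z - α_{kj}) e_k ∈ R[z]`. -/
def gPoly (e : Fin m → R) (α : Fin m → Fin l → ℂ) : R[X] :=
  ∑ k, (∏ j, (X - C (α k j)) : ℂ[X]).map (algebraMap ℂ R) * C (e k)

/-- `g_α(z)⁻¹ ∈ R(z)`. -/
def gInv (e : Fin m → R) (α : Fin m → Fin l → ℂ) : RatR R :=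
  Ring.inverse (polyToRat R (gPoly e α))

theorem polyToRat_map_mul_C (q : ℂ[X]) (r : R) :
    polyToRat R (q.map (algebraMap ℂ R) * C r) = r ⊗ₜ[ℂ] algebraMap ℂ[X] (RatFunc ℂ) q := by
  induction q using Polynomial.induction_on' with
  | add p q hp hq => simp only [Polynomial.map_add, map_add, add_mul, hp, hq, TensorProduct.tmul_add]
  | monomial n a =>
    rw [Polynomial.map_monomial, Polynomial.monomial_mul_C, polyToRat, Polynomial.lsum_apply,
      Polynomial.sum_monomial_index _ _ (by simp), LinearMap.toSpanSingleton_apply,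
      TensorProduct.smul_tmul', smul_eq_mul, mul_one, ← Algebra.smul_def, TensorProduct.smul_tmul,
      ← Polynomial.smul_X_eq_monomial, Algebra.algebraMap_eq_smul_one (a • X ^ n : ℂ[X]), smul_assoc,
      ← Algebra.algebraMap_eq_smul_one, map_pow, RatFunc.algebraMap_X]

/-- The inverse in the definition of `gInv` exists. -/
theorem isUnit_gPoly {e : Fin m → R} (he : CompleteOrthogonalIdempotents e)
    (α : Fin m → Fin l → ℂ) : IsUnit (polyToRat R (gPoly e α)) := by
  set q : Fin m → RatFunc ℂ := fun k => algebraMap ℂ[X] (RatFunc ℂ) (∏ j, (X - C (α k j)))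
  have hq : ∀ k, q k ≠ 0 := fun k => RatFunc.algebraMap_ne_zero
    (Finset.prod_ne_zero_iff.mpr fun j _ => Polynomial.X_sub_C_ne_zero _)
  have h : polyToRat R (gPoly e α) = ∑ k, e k ⊗ₜ[ℂ] q k := by
    simp only [gPoly, map_sum, polyToRat_map_mul_C, q]
  have key : ∀ a b : Fin m → RatFunc ℂ, (∀ k, a k * b k = 1) →
      (∑ k, e k ⊗ₜ[ℂ] a k) * (∑ k, e k ⊗ₜ[ℂ] b k) = 1 := by
    intro a b hab
    rw [Finset.sum_mul_sum]
    have : ∀ i j, (e i ⊗ₜ[ℂ] a i) * (e j ⊗ₜ[ℂ] b j) =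
        if i = j then e i ⊗ₜ[ℂ] (1 : RatFunc ℂ) else 0 := by
      intro i j
      rw [Algebra.TensorProduct.tmul_mul_tmul]
      split_ifs with hij
      · subst hij
        rw [hab, (he.idem i).eq]
      · rw [he.ortho hij, TensorProduct.zero_tmul]
    simp only [this, Finset.sum_ite_eq, Finset.mem_univ, if_true]
    rw [← TensorProduct.sum_tmul, he.complete, Algebra.TensorProduct.one_def]
  rw [h]
  exact ⟨⟨_, ∑ k, e k ⊗ₜ[ℂ] (q k)⁻¹, key _ _ fun k => mul_inv_cancel₀ (hq k),
    key _ _ fun k => inv_mul_cancel₀ (hq k)⟩, rfl⟩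

/-- A point `Φ = P(x, ∂ₓ) exp(xz)` of the decorated adelic Grassmannian together with an `R`-basis
of the right `R`-module `V = ker P` of the form `f_j = ∑ₖ p_{kj}(x) exp(α_{kj} x) e_k`,
`1 ≤ j ≤ l = ord P`. -/
structure BasedPoint (e : Fin m → R) where
  /-- the order of `P`, which is the rank of `V` -/
  l : ℕ
  /-- the differential operator `P` -/
  P : DiffOp R
  /-- the polynomials `p_{kj}` -/
  p : Fin m → Fin l → R[X]
  /-- the exponents `α_{kj}` -/
  α : Fin m → Fin l → ℂ
  isDarboux : P.IsDarboux l
  linearIndependent : LinearIndependent Rᵐᵒᵖ (adapted e p α)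
  span_eq : Submodule.span Rᵐᵒᵖ (Set.range (adapted e p α)) = P.ker

variable {e : Fin m → R}

/-- The underlying point `Φ` of the decorated adelic Grassmannian. -/
def BasedPoint.point [Module.Finite ℂ R] (b : BasedPoint e) : DecGrAd R :=
  ⟨((waveFun b.P : ℂ × ℂ → R) : Mer R), b.P, b.l, b.isDarboux, rfl⟩

/-- The normalized function `Φ_norm(x, z) = Φ(x, z) · [∑ₖ ∏ⱼ (z - α_{kj}) e_k]⁻¹`. -/
def BasedPoint.normFun [Module.Finite ℂ R] (b : BasedPoint e) : Mer R :=
  ((fun w : ℂ × ℂ => waveFun b.P w * Ring.inverse (∑ k, (∏ j, (w.2 - b.α k j)) • e k) :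
    ℂ × ℂ → R) : Mer R)

variable (e)

/-- The adelic Grassmannian: the set of all normalized functions. -/
def GrAd [Module.Finite ℂ R] : Set (Mer R) := Set.range fun b : BasedPoint e => b.normFun

variable {e}

/-- The projection `π`: the normalized function as a point of the adelic Grassmannian. -/
def BasedPoint.norm [Module.Finite ℂ R] (b : BasedPoint e) : GrAd e := ⟨b.normFun, b, rfl⟩

/-- `V^⊥ · [∑ₖ ∏ⱼ (z - α_{kj}) e_k]⁻¹`. -/
def BasedPoint.iotaTilde (b : BasedPoint e) : Submodule R (RatR R) :=
  mulRat (perp b.P.ker) (gInv e b.α)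

end Algebra

end

end AdelicGr

set_option linter.unusedSectionVars false

namespace AdelicGr

noncomputable section

/-! The normalizing factor `g_α` depends on the adapted basis and has noncommuting coefficients, so
everything is moved to scalar normalizations. If γ ∈ ℂ[z] is a monic common multiple of the
polynomials ∏ⱼ (z - α_{kj}), then `g_α` has a complementary factor c with c g_α = g_α c = γ, so
g_α⁻¹ = c γ⁻¹. When l ≤ deg γ, the operator P ∘ c(∂) is again of Darboux type. It has order deg γ,
its wave function is Φ c, and the orthogonal complement of its kernel is V^⊥ c. Hence Φ_norm and V^⊥
g_α⁻¹ are the wave function and the orthogonal complement of P ∘ c(∂), both divided by γ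
(`BasedPoint.exists_scalar_form`). Two based points can be given the same γ, and then both kinds of
data determine the operator. The wave function determines it (`eq_of_waveFun`), the complement
determines the kernel (`DiffOp.IsDarboux.ker_eq_of_perp_eq`), and the kernel determines the monic
operator (`DiffOp.IsDarboux.eq_of_ker_eq`). The resulting equivalence `BasedPoint.normFun_eq_iff`
shows at once that ι is well defined and injective.

The facts about V rest on the identity ⟨p, f⟩ = (p(∂) f)(0) (`wilson_eq`) and on jets. P
right-divides some h(∂) with h scalar, whose solutions have freely prescribable jets. Away from
finitely many points x, the jets of order < l at x identify V with Rˡ (`DiffOp.IsDarboux.jets`). So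
V is free of rank l and its basis functionals have dual polynomials
(`DiffOp.IsDarboux.exists_dual`): R[z] → Rˡ is onto with kernel V^⊥. This surjection splits, which
gives the summand and quotient conditions of the rational Grassmannian. V^⊥ itself is free because
R[z] absorbs finite free summands (`free_ker`).

Adapted bases exist because V is graded by exponents and the corner ring of a primitive idempotent
is local: some exponent component of f_j e_k has a unit coefficient and can replace f_j e_k
(`exists_basis_of_components`).

For the image, the Wronski matrix of an adapted family is a matrix over R[x] times an invertible
diagonal matrix of exponentials. A regular matrix over R[x] divides a nonzero scalar polynomial
(`exists_mul_eq_algebraMap`), so nondegeneracy becomes a polynomial identity WN = NW = d. From it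
Cramer's rule produces a monic annihilator of order l, and division with remainder shows that this
annihilator is a Darboux operator with kernel spanned by the family. -/

/-! ### Scalar multiples of regular elements -/

/-- In an algebra that is finite over a commutative ring, a left regular element divides a nonzero
scalar on both sides. -/
theorem exists_mul_eq_algebraMap {K B : Type*} [CommRing K] [Ring B] [Algebra K B]
    [Module.Finite K B] (N : B) (hN : ∀ y, N * y = 0 → y = 0) [Nontrivial K] :
    ∃ (d : K) (y : B), d ≠ 0 ∧ N * y = algebraMap K B d ∧ y * N = algebraMap K B d := by
  obtain ⟨χ, hχ, hχN⟩ := Algebra.IsIntegral.isIntegral (R := K) N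
  -- Factors X of an annihilating polynomial can be cancelled because N is left regular, until the
  -- constant term is nonzero.
  have key : ∀ (n : ℕ) (q : K[X]), q.natDegree ≤ n → q ≠ 0 → aeval N q = 0 →
      ∃ q' : K[X], q'.coeff 0 ≠ 0 ∧ aeval N q' = 0 := by
    intro n
    induction n with
    | zero =>
      intro q hq hq0 hqN
      refine ⟨q, fun h => hq0 ?_, hqN⟩
      rw [eq_C_of_natDegree_le_zero hq, h, C_0]
    | succ n ih =>
      intro q hq hq0 hqN
      by_cases h : q.coeff 0 = 0
      · have hX : X * q.divX = q := by
          have := X_mul_divX_add q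
          rwa [h, C_0, add_zero] at this
        refine ih q.divX ?_ ?_ ?_
        · rw [natDegree_divX_eq_natDegree_tsub_one]; omega
        · rintro h0
          rw [h0, mul_zero] at hX
          exact hq0 hX.symm
        · apply hN
          rw [← hX, map_mul, aeval_X] at hqN
          exact hqN
      · exact ⟨q, h, hqN⟩
  obtain ⟨q, hq0, hqN⟩ := key _ χ le_rfl hχ.ne_zero hχN
  have h1 := congrArg (aeval N) (X_mul_divX_add q)
  have h2 := congrArg (aeval N) (divX_mul_X_add q)
  simp only [map_add, map_mul, aeval_X, aeval_C, hqN] at h1 h2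
  -- Solving N · q₁(N) + q(0) = 0, with q₁ = `q.divX`, for the constant term. The cofactor is a
  -- polynomial in N, so it works on both sides.
  refine ⟨q.coeff 0, -aeval N q.divX, hq0, ?_, ?_⟩
  · rw [mul_neg]; exact neg_eq_of_add_eq_zero_right h1
  · rw [neg_mul]; exact neg_eq_of_add_eq_zero_right h2

section Algebra

variable {R : Type*} [Ring R] [Algebra ℂ R]

theorem map_mul_comm (c : ℂ[X]) (p : R[X]) :
    c.map (algebraMap ℂ R) * p = p * c.map (algebraMap ℂ R) :=
  (Polynomial.algebra ℂ R).commutes' c p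

/-- Generators of `R` over ℂ, viewed as constants, generate `R[x]` over ℂ[x]. -/
theorem finite_polynomial_algebra [Module.Finite ℂ R] : let := Polynomial.algebra ℂ R; Module.Finite ℂ[X] R[X] := by
  let := Polynomial.algebra ℂ R
  obtain ⟨s, hs⟩ := Module.Finite.fg_top (R := ℂ) (M := R)
  classical
  refine ⟨⟨s.image C, ?_⟩⟩
  rw [eq_top_iff]
  rintro p -
  induction p using Polynomial.induction_on' with
  | add p q hp hq => exact add_mem hp hq
  | monomial n a =>
    have ha : a ∈ Submodule.span ℂ (s : Set R) := hs ▸ Submodule.mem_top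
    induction ha using Submodule.span_induction with
    | mem x hx =>
      have : (monomial n x : R[X]) = (X ^ n : ℂ[X]) • (C x : R[X]) := by
        rw [Algebra.smul_def]
        change _ = (X ^ n : ℂ[X]).map (algebraMap ℂ R) * C x
        rw [Polynomial.map_pow, map_X, X_pow_mul_C, C_mul_X_pow_eq_monomial]
      rw [this]
      exact Submodule.smul_mem _ _ (Submodule.subset_span (by
        rw [Finset.coe_image]; exact Set.mem_image_of_mem _ hx))
    | zero => simp
    | add x y _ _ hx hy => rw [map_add]; exact add_mem hx hy
    | smul c x _ hx =>
      have : (monomial n (c • x) : R[X]) = (C c : ℂ[X]) • (monomial n x : R[X]) := by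
        rw [Algebra.smul_def, Algebra.smul_def]
        change _ = (C c : ℂ[X]).map (algebraMap ℂ R) * _
        rw [map_C, C_mul_monomial]
      rw [this]
      exact Submodule.smul_mem _ _ hx

theorem exists_mul_eq_scalar [Module.Finite ℂ R] (N : R[X]) (hN : ∀ y, N * y = 0 → y = 0) :
    ∃ (d : ℂ[X]) (y : R[X]), d ≠ 0 ∧ N * y = d.map (algebraMap ℂ R) ∧
      y * N = d.map (algebraMap ℂ R) := by
  let := Polynomial.algebra ℂ R
  have := finite_polynomial_algebra (R := R)
  exact exists_mul_eq_algebraMap (K := ℂ[X]) N hN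

theorem exists_matrix_mul_eq_scalar [Module.Finite ℂ R] {l : ℕ} (N : Matrix (Fin l) (Fin l) R[X])
    (hN : ∀ y, N * y = 0 → y = 0) :
    ∃ (d : ℂ[X]) (y : Matrix (Fin l) (Fin l) R[X]), d ≠ 0 ∧
      N * y = Matrix.scalar _ (d.map (algebraMap ℂ R)) ∧
      y * N = Matrix.scalar _ (d.map (algebraMap ℂ R)) := by
  let := Polynomial.algebra ℂ R
  have := finite_polynomial_algebra (R := R)
  have : Module.Finite ℂ[X] (Matrix (Fin l) (Fin l) R[X]) := 
    inferInstanceAs (Module.Finite ℂ[X] (Fin l → Fin l → R[X]))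
  exact exists_mul_eq_algebraMap (K := ℂ[X]) N hN

/-! ### Evaluation at scalars -/

/-- Evaluation of polynomials at a scalar, a ring homomorphism. -/
def evalS (x : ℂ) : R[X] →+* R :=
  eval₂RingHom' (RingHom.id R) (algebraMap ℂ R x) fun a => (Algebra.commutes x a).symm

theorem evalS_apply (x : ℂ) (p : R[X]) : evalS x p = p.eval (algebraMap ℂ R x) := rfl

@[simp] theorem evalS_C (x : ℂ) (r : R) : evalS x (C r) = r := by simp [evalS_apply]

@[simp] theorem evalS_X (x : ℂ) : evalS x (X : R[X]) = algebraMap ℂ R x := by simp [evalS_apply]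

theorem evalS_map (x : ℂ) (d : ℂ[X]) :
    evalS x (d.map (algebraMap ℂ R)) = algebraMap ℂ R (d.eval x) := by
  rw [evalS_apply, eval_map, eval₂_hom]

/-- A polynomial with coefficients in a complex vector space that vanishes at infinitely many
scalars is zero. -/
theorem eq_zero_of_infinite_sum_pow_smul {E : Type*} [AddCommGroup E] [Module ℂ E] (a : ℕ →₀ E)
    {s : Set ℂ} (hs : s.Infinite) (h : ∀ z ∈ s, (a.sum fun k v => z ^ k • v) = 0) : a = 0 := by
  ext k
  rw [Finsupp.zero_apply, ← Module.forall_dual_apply_eq_zero_iff ℂ]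
  intro φ
  have h0 : (∑ k ∈ a.support, monomial k (φ (a k)) : ℂ[X]) = 0 := by
    refine eq_zero_of_infinite_isRoot _ (hs.mono fun z hz => ?_)
    have := congrArg φ (h z hz)
    rw [map_zero, Finsupp.sum, map_sum] at this
    change eval z _ = 0
    rw [eval_finsetSum, ← this]
    exact Finset.sum_congr rfl fun i _ => by rw [eval_monomial, map_smul, smul_eq_mul, mul_comm]
  have h1 := congrArg (fun p => coeff p k) h0
  simp only [finsetSum_coeff, coeff_monomial, Finset.sum_ite_eq', coeff_zero] at h1
  by_cases hk : k ∈ a.support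
  · rwa [if_pos hk] at h1
  · rw [Finsupp.notMem_support_iff.mp hk, map_zero]

theorem eq_zero_of_infinite_evalS (p : R[X]) {s : Set ℂ} (hs : s.Infinite)
    (h : ∀ z ∈ s, evalS z p = 0) : p = 0 := by
  have h0 := eq_zero_of_infinite_sum_pow_smul p.toFinsupp.coeff hs fun z hz => by
    rw [← h z hz, evalS_apply, eval_eq_sum, Polynomial.sum_def]
    refine Finset.sum_congr rfl fun k _ => ?_
    rw [← map_pow, ← Algebra.commutes, ← Algebra.smul_def]
    rfl
  ext k
  exact DFunLike.congr_fun h0 k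

/-! ### The embedding of `R[x]` into `R(x)` -/

theorem polyToRat_monomial (n : ℕ) (a : R) :
    polyToRat R (monomial n a) = a ⊗ₜ[ℂ] (RatFunc.X ^ n) := by
  rw [polyToRat, lsum_apply, sum_monomial_index _ _ (by simp), LinearMap.toSpanSingleton_apply,
    smul_tmul', smul_eq_mul, mul_one]

theorem polyToRat_mul (p q : R[X]) : polyToRat R (p * q) = polyToRat R p * polyToRat R q := by
  induction p using Polynomial.induction_on' with
  | add p p' hp hp' => simp only [add_mul, map_add, hp, hp']
  | monomial n a =>
    induction q using Polynomial.induction_on' with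
    | add q q' hq hq' => simp only [mul_add, map_add, hq, hq']
    | monomial k b =>
      rw [monomial_mul_monomial, polyToRat_monomial, polyToRat_monomial, polyToRat_monomial,
        Algebra.TensorProduct.tmul_mul_tmul, pow_add]

theorem polyToRat_C (r : R) : polyToRat R (C r) = r ⊗ₜ[ℂ] (1 : RatFunc ℂ) := by
  rw [← monomial_zero_left, polyToRat_monomial, pow_zero]

theorem polyToRat_one : polyToRat R 1 = 1 := by
  rw [← C_1, polyToRat_C]; rfl

theorem polyToRat_scalar (d : ℂ[X]) : polyToRat R (d.map (algebraMap ℂ R)) =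
    (1 : R) ⊗ₜ[ℂ] algebraMap ℂ[X] (RatFunc ℂ) d := by
  have := polyToRat_map_mul_C (R := R) d 1
  rwa [C_1, mul_one] at this

/-- A scalar rational function as an element of `R(x)`. -/
def ratS (q : RatFunc ℂ) : RatR R := (1 : R) ⊗ₜ[ℂ] q

theorem ratS_mul (p q : RatFunc ℂ) : (ratS (p * q) : RatR R) = ratS p * ratS q := by
  simp [ratS]

theorem ratS_one : (ratS 1 : RatR R) = 1 := rfl

theorem ratS_comm (q : RatFunc ℂ) (a : RatR R) : ratS q * a = a * ratS q := by
  induction a using TensorProduct.induction_on with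
  | zero => simp
  | tmul r p => simp [ratS, mul_comm]
  | add a b ha hb => rw [mul_add, add_mul, ha, hb]

theorem ratS_mul_cancel {q : RatFunc ℂ} (hq : q ≠ 0) {a b : RatR R} (h : ratS q * a = ratS q * b) :
    a = b := by
  have := congrArg (fun t => ratS q⁻¹ * t) h
  simpa only [← mul_assoc, ← ratS_mul, inv_mul_cancel₀ hq, ratS_one, one_mul] using this

/-- Elements of `R(x)` have a scalar denominator. -/
theorem exists_denom (a : RatR R) : ∃ (d : ℂ[X]) (b : R[X]), d ≠ 0 ∧
    ratS (algebraMap ℂ[X] (RatFunc ℂ) d) * a = polyToRat R b := by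
  induction a using TensorProduct.induction_on with
  | zero => exact ⟨1, 0, one_ne_zero, by simp⟩
  | tmul r p =>
    refine ⟨p.denom, p.num.map (algebraMap ℂ R) * C r, RatFunc.denom_ne_zero p, ?_⟩
    rw [polyToRat_map_mul_C, ratS, Algebra.TensorProduct.tmul_mul_tmul, one_mul]
    congr 1
    conv_lhs => rw [← RatFunc.num_div_denom p]
    rw [RatFunc.num_div_denom p]
    have h := RatFunc.num_div_denom p
    rw [div_eq_iff (RatFunc.algebraMap_ne_zero (RatFunc.denom_ne_zero p))] at h
    rw [mul_comm]; exact h.symm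
  | add a a' ha ha' =>
    obtain ⟨d, b, hd, h⟩ := ha
    obtain ⟨d', b', hd', h'⟩ := ha'
    refine ⟨d * d', d'.map (algebraMap ℂ R) * b + d.map (algebraMap ℂ R) * b',
      mul_ne_zero hd hd', ?_⟩
    rw [map_add, polyToRat_mul, polyToRat_mul, ← h, ← h', polyToRat_scalar, polyToRat_scalar,
      map_mul, ratS_mul, mul_add, ← ratS, ← ratS, ← mul_assoc, ← mul_assoc, ← ratS_mul,
      ← ratS_mul, mul_comm (algebraMap ℂ[X] (RatFunc ℂ) d')]

theorem exists_common_denom (n : ℕ) (a : ℕ → RatR R) : ∃ (d : ℂ[X]) (b : ℕ → R[X]), d ≠ 0 ∧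
    ∀ i < n, ratS (algebraMap ℂ[X] (RatFunc ℂ) d) * a i = polyToRat R (b i) := by
  induction n with
  | zero => exact ⟨1, 0, one_ne_zero, by simp⟩
  | succ n ih =>
    obtain ⟨d, b, hd, h⟩ := ih
    obtain ⟨d', b', hd', h'⟩ := exists_denom (a n)
    refine ⟨d' * d, fun i => if i < n then d'.map (algebraMap ℂ R) * b i else
      d.map (algebraMap ℂ R) * b', mul_ne_zero hd' hd, fun i hi => ?_⟩
    by_cases hin : i < n
    all_goals simp only [hin, if_true, if_false]
    · rw [polyToRat_mul, ← h i hin, polyToRat_scalar, ← ratS, map_mul, ratS_mul, mul_assoc]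
    · obtain rfl : i = n := by omega
      rw [polyToRat_mul, ← h', polyToRat_scalar, ← ratS, mul_comm, map_mul, ratS_mul, mul_assoc]

/-- Linear functionals on `R` separate coefficients and reduce the claim to ℂ[x] ⊆ ℂ(x). -/
theorem polyToRat_injective : Function.Injective (polyToRat R) := by
  rw [← LinearMap.ker_eq_bot, LinearMap.ker_eq_bot']
  intro p hp
  ext n
  rw [coeff_zero, ← Module.forall_dual_apply_eq_zero_iff ℂ]
  intro φ
  have key : ∀ q : R[X], TensorProduct.lid ℂ (RatFunc ℂ)
      (LinearMap.rTensor (RatFunc ℂ) φ (polyToRat R q)) =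
      algebraMap ℂ[X] (RatFunc ℂ) (q.sum fun k a => monomial k (φ a)) := by
    intro q
    induction q using Polynomial.induction_on' with
    | add p q hp hq =>
      rw [map_add, map_add, map_add, hp, hq, ← map_add, Polynomial.sum_add_index]
      · simp
      · simp
    | monomial k a =>
      rw [polyToRat_monomial, sum_monomial_index _ _ (by simp), LinearMap.rTensor_tmul,
        TensorProduct.lid_tmul, ← smul_X_eq_monomial, Algebra.algebraMap_eq_smul_one, smul_assoc,
        ← Algebra.algebraMap_eq_smul_one, map_pow, RatFunc.algebraMap_X]
  have h := key p
  rw [hp, map_zero, map_zero] at h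
  have h0 := RatFunc.algebraMap_injective ℂ ((map_zero _).trans h)
  have h1 := congrArg (fun q => coeff q n) h0
  simp only [coeff_zero, Polynomial.sum_def, finsetSum_coeff, coeff_monomial,
    Finset.sum_ite_eq'] at h1
  by_cases hn : n ∈ p.support
  · rw [if_pos hn] at h1; exact h1.symm
  · rw [notMem_support_iff.mp hn, map_zero]

/-! ### The derivation on `R(x)` -/

theorem ratDeriv_algebraMap (p : ℂ[X]) : ratDeriv (algebraMap ℂ[X] (RatFunc ℂ) p) =
    algebraMap ℂ[X] (RatFunc ℂ) (derivative p) := by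
  have := ratDerivFun_div p 1 one_ne_zero
  simp only [map_one, div_one, derivative_one, mul_zero, sub_zero, mul_one, one_pow] at this
  exact this

theorem ratDeriv_mul (p q : RatFunc ℂ) : ratDeriv (p * q) = ratDeriv p * q + p * ratDeriv q := by
  have hp := RatFunc.algebraMap_ne_zero (RatFunc.denom_ne_zero p)
  have hq := RatFunc.algebraMap_ne_zero (RatFunc.denom_ne_zero q)
  have h : p * q = algebraMap ℂ[X] (RatFunc ℂ) (p.num * q.num) /
      algebraMap ℂ[X] (RatFunc ℂ) (p.denom * q.denom) := by
    rw [map_mul, map_mul, ← div_mul_div_comm, RatFunc.num_div_denom, RatFunc.num_div_denom]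
  have hp' := RatFunc.num_div_denom p
  have hq' := RatFunc.num_div_denom q
  change ratDerivFun (p * q) = ratDerivFun p * q + p * ratDerivFun q
  rw [h, ratDerivFun_div _ _ (mul_ne_zero (RatFunc.denom_ne_zero p) (RatFunc.denom_ne_zero q)),
    ratDerivFun, ratDerivFun]
  generalize p.num = a at *
  generalize p.denom = b at *
  generalize q.num = c at *
  generalize q.denom = d at *
  rw [← hp', ← hq']
  simp only [derivative_mul, map_add, map_sub, map_mul]
  field_simp
  ring

theorem ratRDeriv_mul (a b : RatR R) : ratRDeriv R (a * b) = ratRDeriv R a * b + a * ratRDeriv R b := by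
  induction a using TensorProduct.induction_on with
  | zero => simp
  | add a a' ha ha' => simp only [add_mul, map_add, ha, ha']; abel
  | tmul r p =>
    induction b using TensorProduct.induction_on with
    | zero => simp
    | add b b' hb hb' => simp only [mul_add, map_add, hb, hb']; abel
    | tmul s q => simp [ratRDeriv, ratDeriv_mul, tmul_add]

theorem ratRDeriv_const (r : R) : ratRDeriv R (r ⊗ₜ[ℂ] (1 : RatFunc ℂ)) = 0 := by
  have := ratDeriv_algebraMap 1
  simp only [map_one, derivative_one, map_zero] at this
  simp [ratRDeriv, this]

theorem ratRDeriv_polyToRat (p : R[X]) :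
    ratRDeriv R (polyToRat R p) = polyToRat R (derivative p) := by
  induction p using Polynomial.induction_on' with
  | add p q hp hq => simp only [map_add, hp, hq]
  | monomial n a =>
    have h : ratDeriv (RatFunc.X ^ n) = (n : ℂ) • RatFunc.X ^ (n - 1) := by
      rw [← RatFunc.algebraMap_X, ← map_pow, ratDeriv_algebraMap, derivative_X_pow, map_mul,
        map_pow, map_natCast, map_natCast, Nat.cast_smul_eq_nsmul, nsmul_eq_mul]
    rw [polyToRat_monomial, derivative_monomial, polyToRat_monomial]
    simp only [ratRDeriv, LinearMap.lTensor_tmul, h, tmul_smul, smul_tmul']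
    rw [Nat.cast_smul_eq_nsmul, nsmul_eq_mul, Nat.cast_comm]

end Algebra

section Algebra

variable {R : Type*} [Ring R] [Algebra ℂ R]

/-! ### Calculus of quasipolynomials -/

theorem QP.deriv_apply (f : QP R) (α : ℂ) :
    QP.deriv f α = derivative (f α) + α • f α := by
  classical
  rw [QP.deriv, Finsupp.sum_apply, Finsupp.sum]
  simp only [Finsupp.single_apply]
  rw [Finset.sum_ite_eq']
  split_ifs with h
  · rfl
  · rw [Finsupp.notMem_support_iff.mp h]; simp

theorem op_smul_poly (r : R) (p : R[X]) : MulOpposite.op r • p = p * C r := by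
  ext n
  rw [coeff_smul, op_smul_eq_mul, coeff_mul_C]

/-- The derivative of quasipolynomials, a map of right `R`-modules. -/
def D : Module.End Rᵐᵒᵖ (QP R) where
  toFun := QP.deriv
  map_add' f g := by
    ext1 α
    simp only [QP.deriv_apply, Finsupp.add_apply, map_add, smul_add]
    abel
  map_smul' r f := by
    ext1 α
    rw [RingHom.id_apply, ← MulOpposite.op_unop r]
    simp only [QP.deriv_apply, Finsupp.smul_apply, op_smul_poly, derivative_mul, derivative_C,
      mul_zero, add_zero, add_mul, smul_mul_assoc]

theorem D_apply (f : QP R) (α : ℂ) : D f α = derivative (f α) + α • f α := QP.deriv_apply f α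

theorem D_single (α : ℂ) (p : R[X]) :
    D (Finsupp.single α p) = Finsupp.single α (derivative p + α • p) := by
  classical
  ext1 β
  rw [D_apply, Finsupp.single_apply, Finsupp.single_apply]
  split_ifs with h
  · rw [h]
  · simp

theorem D_poly_smul (b : R[X]) (f : QP R) : D (b • f) = derivative b • f + b • D f := by
  ext1 α
  simp only [D_apply, Finsupp.add_apply, Finsupp.smul_apply, smul_eq_mul, derivative_mul, mul_add,
    mul_smul_comm]
  abel

theorem D_smul (r : R) (f : QP R) : D (r • f) = r • D f := by
  ext1 α
  simp only [D_apply, Finsupp.smul_apply, derivative_smul, smul_add, smul_comm r α]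

/-- The value of a quasipolynomial at a point, as a map of right `R`-modules. -/
def ev (x : ℂ) : QP R →ₗ[Rᵐᵒᵖ] R where
  toFun := QP.eval x
  map_add' f g := by
    rw [QP.eval, Finsupp.sum_add_index']
    · rfl
    · simp
    · simp
  map_smul' r f := by
    rw [RingHom.id_apply, ← MulOpposite.op_unop r, QP.eval, Finsupp.sum_smul_index', QP.eval,
      Finsupp.smul_sum]
    · refine Finset.sum_congr rfl fun α _ => ?_
      dsimp only
      rw [op_smul_poly, ← evalS_apply, map_mul, evalS_C, ← evalS_apply, op_smul_eq_mul,
        smul_mul_assoc]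
    · simp

theorem ev_apply (x : ℂ) (f : QP R) : ev x f = QP.eval x f := rfl

theorem ev_single (x α : ℂ) (p : R[X]) :
    ev x (Finsupp.single α p) = Complex.exp (α * x) • evalS x p := by
  rw [ev_apply, QP.eval, Finsupp.sum_single_index (by simp), evalS_apply]

theorem ev_poly_smul (x : ℂ) (b : R[X]) (f : QP R) : ev x (b • f) = evalS x b * ev x f := by
  induction f using Finsupp.induction_linear with
  | zero => simp
  | add f g hf hg => rw [smul_add, map_add, map_add, mul_add, hf, hg]
  | single α p => rw [Finsupp.smul_single, ev_single, ev_single, smul_eq_mul, map_mul, mul_smul_comm]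

theorem poly_C_smul (r : R) (f : QP R) : (C r : R[X]) • f = r • f := by
  ext1 α
  rw [Finsupp.smul_apply, Finsupp.smul_apply, smul_eq_mul, smul_eq_C_mul]

theorem ev_smul (x : ℂ) (r : R) (f : QP R) : ev x (r • f) = r * ev x f := by
  rw [← poly_C_smul, ev_poly_smul, evalS_C]

/-! ### Operators with constant coefficients -/

/-- The operator `p(∂)` on quasipolynomials, for `p ∈ R[z]`. -/
def opOf : R[X] →+* Module.End Rᵐᵒᵖ (QP R) :=
  eval₂RingHom' (Module.toModuleEnd Rᵐᵒᵖ (QP R)) D fun r => LinearMap.ext fun f =>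
    (D_smul r f).symm

@[simp] theorem opOf_X : opOf (X : R[X]) = D := eval₂_X _ _

@[simp] theorem opOf_C (r : R) (f : QP R) : opOf (C r) f = r • f :=
  LinearMap.congr_fun (eval₂_C _ _) f

theorem opOf_mul (p q : R[X]) (f : QP R) : opOf (p * q) f = opOf p (opOf q f) := by
  rw [map_mul]; rfl

theorem opOf_X_pow (k : ℕ) (f : QP R) : opOf (X ^ k : R[X]) f = (D ^ k) f := by
  rw [map_pow, opOf_X]

theorem opOf_monomial (k : ℕ) (r : R) (f : QP R) : opOf (monomial k r) f = r • (D ^ k) f := by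
  rw [← C_mul_X_pow_eq_monomial, opOf_mul, opOf_C, opOf_X_pow]

theorem opOf_eq_sum (p : R[X]) {n : ℕ} (hp : p.natDegree < n) (f : QP R) :
    opOf p f = ∑ i ∈ Finset.range n, p.coeff i • (D ^ i) f := by
  conv_lhs => rw [p.as_sum_range' n hp]
  rw [map_sum, LinearMap.sum_apply]
  simp only [opOf_monomial]

/-- Scalar polynomials as elements of `R[z]`. -/
def sc : ℂ[X] →+* R[X] := mapRingHom (algebraMap ℂ R)

theorem sc_apply (h : ℂ[X]) : (sc h : R[X]) = h.map (algebraMap ℂ R) := rfl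

theorem algebraMap_smul_QP (c : ℂ) (f : QP R) : algebraMap ℂ R c • f = c • f :=
  algebraMap_smul R c f

theorem opOf_X_sub_C (α : ℂ) (f : QP R) : opOf (sc (X - C α)) f = D f - α • f := by
  simp [sc, map_sub, opOf_X]

/-- For c = 0 one integrates. For c ≠ 0, dividing by c leaves an error of lower degree, so induction
on the degree applies. -/
theorem exists_derivative_add_smul_eq (c : ℂ) (p : R[X]) : ∃ q, derivative q + c • q = p := by
  by_cases hc : c = 0
  · subst hc
    induction p using Polynomial.induction_on' with
    | add p p' hp hp' =>
      obtain ⟨q, hq⟩ := hp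
      obtain ⟨q', hq'⟩ := hp'
      exact ⟨q + q', by rw [← hq, ← hq']; simp⟩
    | monomial n a =>
      refine ⟨monomial (n + 1) (((n + 1 : ℂ))⁻¹ • a), ?_⟩
      rw [zero_smul, add_zero, derivative_monomial, Nat.add_sub_cancel, ← Nat.cast_comm,
        ← nsmul_eq_mul, ← Nat.cast_smul_eq_nsmul ℂ, smul_smul, Nat.cast_add, Nat.cast_one,
        mul_inv_cancel₀ (Nat.cast_add_one_ne_zero n), one_smul]
  · induction p using Polynomial.induction_on' with
    | add p p' hp hp' =>
      obtain ⟨q, hq⟩ := hp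
      obtain ⟨q', hq'⟩ := hp'
      exact ⟨q + q', by rw [← hq, ← hq', map_add, smul_add]; abel⟩
    | monomial n a =>
      induction n generalizing a with
      | zero =>
        exact ⟨c⁻¹ • monomial 0 a, by
          rw [smul_smul, mul_inv_cancel₀ hc, one_smul, derivative_smul, monomial_zero_left,
            derivative_C, smul_zero, zero_add]⟩
      | succ n ih =>
        obtain ⟨q, hq⟩ := ih (a * ((n + 1 : ℕ) : R))
        refine ⟨c⁻¹ • (monomial (n + 1) a - q), ?_⟩
        rw [smul_smul, mul_inv_cancel₀ hc, one_smul, derivative_smul, derivative_sub,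
          derivative_monomial, Nat.add_sub_cancel, ← hq, add_sub_cancel_left, smul_smul,
          inv_mul_cancel₀ hc, one_smul]
        abel

theorem exists_D_sub_smul_eq (α : ℂ) (g : QP R) : ∃ f, D f - α • f = g := by
  induction g using Finsupp.induction_linear with
  | zero => exact ⟨0, by simp⟩
  | add f g hf hg =>
    obtain ⟨q, hq⟩ := hf
    obtain ⟨q', hq'⟩ := hg
    exact ⟨q + q', by rw [← hq, ← hq', map_add, smul_add]; abel⟩
  | single β p =>
    obtain ⟨q, hq⟩ := exists_derivative_add_smul_eq (β - α) p
    refine ⟨Finsupp.single β q, ?_⟩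
    rw [D_single, Finsupp.smul_single, ← Finsupp.single_sub, ← hq, sub_smul, add_sub_assoc]

/-- Induction over the linear factors of a monic polynomial. -/
theorem monic_induction {motive : ∀ h : ℂ[X], h.Monic → Prop} (one : motive 1 monic_one)
    (mul : ∀ α h (hh : h.Monic), motive h hh → motive ((X - C α) * h) ((monic_X_sub_C α).mul hh))
    (h : ℂ[X]) (hh : h.Monic) : motive h hh := by
  induction hn : h.natDegree generalizing h with
  | zero => obtain rfl := hh.natDegree_eq_zero.mp hn; exact one
  | succ n ih =>
    obtain ⟨α, hα⟩ := IsAlgClosed.exists_root h (by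
      rw [degree_eq_natDegree hh.ne_zero, hn]; exact_mod_cast Nat.succ_ne_zero n)
    obtain ⟨q, rfl⟩ := dvd_iff_isRoot.mpr hα
    have hq : q.Monic := (monic_X_sub_C α).of_mul_monic_left hh
    refine mul α q hq (ih q hq ?_)
    rw [(monic_X_sub_C α).natDegree_mul hq, natDegree_X_sub_C] at hn
    omega

theorem opOf_scalar_surjective {h : ℂ[X]} (hh : h.Monic) (g : QP R) : ∃ f, opOf (sc h) f = g := by
  induction h, hh using monic_induction generalizing g with
  | one => exact ⟨g, by simp⟩
  | mul α h _ ih =>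
    obtain ⟨f, hf⟩ := exists_D_sub_smul_eq α g
    obtain ⟨f', hf'⟩ := ih f
    exact ⟨f', by rw [map_mul, opOf_mul, hf', opOf_X_sub_C, hf]⟩

/-- At an exponent β ≠ α the polynomial factor would satisfy p' = (α - β) p, which leading
coefficients forbid unless p = 0. At α itself it has zero derivative. -/
theorem eq_single_of_D_eq_smul {α : ℂ} {f : QP R} (hf : D f = α • f) :
    ∃ c, f = Finsupp.single α (C c) := by
  have key : ∀ β, derivative (f β) = (α - β) • f β := fun β => by
    have := DFunLike.congr_fun hf β
    rw [D_apply, Finsupp.smul_apply] at this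
    rw [sub_smul, ← this, add_sub_cancel_right]
  refine ⟨(f α).coeff 0, Finsupp.ext fun β => ?_⟩
  by_cases h : α = β
  · subst h
    rw [Finsupp.single_eq_same]
    have h0 := key α
    rw [sub_self, zero_smul] at h0
    ext n
    rcases n with _ | n
    · simp
    · have h1 := congrArg (fun p => coeff p n) h0
      simp only [coeff_derivative, coeff_zero] at h1
      rw [coeff_C_succ]
      have h2 : ((n + 1 : ℂ)) • (f α).coeff (n + 1) = 0 := by
        rw [← h1, Algebra.smul_def, Algebra.commutes]; simp
      exact (smul_eq_zero.mp h2).resolve_left (Nat.cast_add_one_ne_zero n)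
  · rw [Finsupp.single_apply, if_neg h]
    by_contra h0
    have h1 := congrArg (fun p => coeff p (f β).natDegree) (key β)
    simp only [coeff_smul, coeff_natDegree] at h1
    rw [coeff_derivative, coeff_eq_zero_of_natDegree_lt (Nat.lt_succ_self _), zero_mul] at h1
    exact h0 (leadingCoeff_eq_zero.mp ((smul_eq_zero.mp h1.symm).resolve_left (sub_ne_zero.mpr h)))

/-- On p exp(αx) the operator ∂ - α differentiates p, so a high power kills it. Scalar operators
commute, so annihilators of summands can be multiplied. -/
theorem exists_scalar_annihilator (f : QP R) : ∃ h : ℂ[X], h.Monic ∧ opOf (sc h) f = 0 := by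
  induction f using Finsupp.induction_linear with
  | zero => exact ⟨1, monic_one, by simp⟩
  | add f g hf hg =>
    obtain ⟨h, hh, hf⟩ := hf
    obtain ⟨h', hh', hg⟩ := hg
    refine ⟨h * h', hh.mul hh', ?_⟩
    rw [map_add]
    nth_rw 1 [mul_comm h]
    rw [map_mul sc, map_mul sc, opOf_mul, opOf_mul, hf, hg]
    simp
  | single α p =>
    refine ⟨(X - C α) ^ (p.natDegree + 1), (monic_X_sub_C α).pow _, ?_⟩
    have key : ∀ k, opOf (sc ((X - C α) ^ k)) (Finsupp.single α p) =
        Finsupp.single α (derivative^[k] p) := by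
      intro k
      induction k with
      | zero => simp
      | succ k ih =>
        rw [pow_succ', map_mul, opOf_mul, ih, opOf_X_sub_C, D_single,
          Finsupp.smul_single, ← Finsupp.single_sub, add_sub_cancel_right,
          Function.iterate_succ_apply']
    rw [key, iterate_derivative_eq_zero (Nat.lt_succ_self _), Finsupp.single_zero]

theorem D_pow_opOf (k : ℕ) (p : R[X]) (f : QP R) : (D ^ k) (opOf p f) = opOf (p * X ^ k) f := by
  rw [← X_pow_mul, opOf_mul, opOf_X_pow]

theorem ev_opOf_eq_zero {x : ℂ} {f : QP R} (hf : ∀ i, ev x ((D ^ i) f) = 0) (p : R[X]) :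
    ev x (opOf p f) = 0 := by
  rw [opOf_eq_sum p (Nat.lt_succ_self _), map_sum]
  exact Finset.sum_eq_zero fun i _ => by rw [ev_smul, hf, mul_zero]

/-- A quasipolynomial is determined by its Taylor series at any point. -/
theorem eq_zero_of_jets {x : ℂ} {f : QP R} (hf : ∀ i, ev x ((D ^ i) f) = 0) : f = 0 := by
  obtain ⟨h, hh, hfh⟩ := exists_scalar_annihilator f
  induction h, hh using monic_induction with
  | one => simpa using hfh
  | mul α h _ ih =>
    refine ih ?_
    rw [map_mul, opOf_mul, opOf_X_sub_C] at hfh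
    obtain ⟨c, hc⟩ := eq_single_of_D_eq_smul (sub_eq_zero.mp hfh)
    have h1 := ev_opOf_eq_zero hf (sc h)
    rw [hc, ev_single, evalS_C] at h1
    rw [hc, (smul_eq_zero.mp h1).resolve_left (Complex.exp_ne_zero _), C_0, Finsupp.single_zero]

/-- The solutions of a scalar equation with constant coefficients have arbitrary jets. -/
theorem exists_scalar_solution {h : ℂ[X]} (hh : h.Monic) (x : ℂ) (s : ℕ → R) :
    ∃ f : QP R, opOf (sc h) f = 0 ∧ ∀ i < h.natDegree, ev x ((D ^ i) f) = s i := by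
  induction h, hh using monic_induction generalizing s with
  | one => exact ⟨0, by simp, by simp⟩
  | mul α h hh ih =>
    -- g plays the role of (∂ - α) f, which fixes the jets it must have.
    obtain ⟨g, hg, hgs⟩ := ih fun i => s (i + 1) - α • s i
    obtain ⟨f₀, hf₀⟩ := exists_D_sub_smul_eq α g
    -- A multiple of exp(αx) is in the kernel of ∂ - α and corrects the value at x to s 0.
    set f : QP R := f₀ + Finsupp.single α (C (Complex.exp (-(α * x)) • (s 0 - ev x f₀)))
    have hf : D f = g + α • f := by
      rw [← sub_eq_iff_eq_add, ← hf₀]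
      simp only [f, map_add, D_single, smul_add, derivative_C, zero_add, Finsupp.smul_single]
      abel
    refine ⟨f, ?_, ?_⟩
    · rw [mul_comm, map_mul, opOf_mul, opOf_X_sub_C, hf,
        add_sub_cancel_right, hg]
    · rw [(monic_X_sub_C α).natDegree_mul hh, natDegree_X_sub_C, add_comm]
      intro i
      induction i with
      | zero =>
        intro _
        rw [pow_zero, Module.End.one_apply, map_add, ev_single, evalS_C, smul_smul,
          ← Complex.exp_add, add_neg_cancel, Complex.exp_zero, one_smul, add_sub_cancel]
      | succ i ihi =>
        intro hi
        have h1 : (D ^ i) (α • f) = α • (D ^ i) f := by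
          rw [← algebraMap_smul_QP, ← opOf_C, D_pow_opOf, ← X_pow_mul_C, ← opOf_X_pow, X_pow_mul_C,
            opOf_mul, opOf_C, algebraMap_smul_QP]
        have h2 : ev x (α • (D ^ i) f) = α • ev x ((D ^ i) f) := by
          rw [← algebraMap_smul_QP, ev_smul, Algebra.smul_def]
        rw [pow_succ, Module.End.mul_apply, hf, map_add, map_add, h1, h2, hgs i (by omega),
          ihi (by omega), sub_add_cancel]

/-! ### The pairing -/

theorem wilson_apply (f : QP R) (p : R[X]) : wilson f p =
    f.sum fun α q => q.sum fun n r => (derivative^[n] p).eval (algebraMap ℂ R α) * r := rfl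

theorem wilson_single_monomial (α : ℂ) (n : ℕ) (r : R) (p : R[X]) :
    wilson (Finsupp.single α (monomial n r)) p = evalS α (derivative^[n] p) * r := by
  rw [wilson_apply, Finsupp.sum_single_index (by simp), sum_monomial_index _ _ (by simp)]
  rfl

theorem wilson_add (f g : QP R) (p : R[X]) : wilson (f + g) p = wilson f p + wilson g p := by
  rw [wilson_apply, Finsupp.sum_add_index']
  · rfl
  · simp
  · intro a b c
    rw [Polynomial.sum_add_index] <;> simp [mul_add]

theorem iterate_derivative_X_mul' (n : ℕ) (p : R[X]) :
    derivative^[n] (X * p) = X * derivative^[n] p + n • derivative^[n - 1] p := by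
  induction n with
  | zero => simp
  | succ n ih =>
    rw [Function.iterate_succ_apply', ih, map_add, derivative_mul, derivative_X, one_mul,
      derivative_smul, ← Function.iterate_succ_apply' derivative, Nat.add_sub_cancel, succ_nsmul]
    rcases n with _ | n
    · simp [add_comm]
    · rw [← Function.iterate_succ_apply' derivative (n + 1 - 1), Nat.add_sub_cancel]
      abel

/-- By Leibniz, (z p)⁽ⁿ⁾ = z p⁽ⁿ⁾ + n p⁽ⁿ⁻¹⁾, whose two terms match the two terms of (xⁿ exp(αx))'.
-/
theorem wilson_X_mul (f : QP R) (p : R[X]) : wilson f (X * p) = wilson (D f) p := by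
  induction f using Finsupp.induction_linear with
  | zero => simp [wilson_apply]
  | add f g hf hg => rw [map_add, wilson_add, wilson_add, hf, hg]
  | single α q =>
    induction q using Polynomial.induction_on' with
    | add q q' hq hq' =>
      rw [Finsupp.single_add, map_add, wilson_add, wilson_add, hq, hq']
    | monomial n r =>
      rw [D_single, Finsupp.single_add, wilson_add, smul_monomial, derivative_monomial,
        wilson_single_monomial, wilson_single_monomial, wilson_single_monomial, 
        iterate_derivative_X_mul', map_add, map_mul, evalS_X, map_nsmul, add_mul, add_comm]
      congr 1
      · rw [nsmul_eq_mul, mul_assoc, Nat.cast_comm, mul_assoc]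
      · rw [mul_smul_comm, Algebra.smul_def, mul_assoc]

theorem wilson_C (f : QP R) (s : R) : wilson f (C s) = s * ev 0 f := by
  induction f using Finsupp.induction_linear with
  | zero => simp [wilson_apply]
  | add f g hf hg => rw [map_add, wilson_add, hf, hg, mul_add]
  | single α q =>
    induction q using Polynomial.induction_on' with
    | add q q' hq hq' => rw [Finsupp.single_add, map_add, wilson_add, hq, hq', mul_add]
    | monomial n r =>
      rw [wilson_single_monomial, ev_single, mul_zero, Complex.exp_zero, one_smul]
      rcases n with _ | n
      · simp
      · rw [iterate_derivative_C (Nat.succ_pos n), ← C_mul_X_pow_eq_monomial]; simp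

/-- Multiplication by z is adjoint to ∂, so everything reduces to constant p, where the pairing is
the value at 0. This turns Wilson's conditions into statements about jets. -/
theorem wilson_eq (f : QP R) (p : R[X]) : wilson f p = ev 0 (opOf p f) := by
  induction p using Polynomial.induction_on' with
  | add p q hp hq => rw [map_add, map_add, LinearMap.add_apply, map_add, hp, hq]
  | monomial n r =>
    induction n generalizing f with
    | zero => rw [monomial_zero_left, wilson_C, opOf_C, ev_smul]
    | succ n ih =>
      rw [← X_mul_monomial, wilson_X_mul, ih, X_mul, opOf_mul, opOf_X]

theorem wilson_op_smul (r : Rᵐᵒᵖ) (f : QP R) (p : R[X]) :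
    wilson (r • f) p = r • wilson f p := by
  rw [wilson_eq, wilson_eq, map_smul, map_smul]

theorem wilson_opOf (f : QP R) (p q : R[X]) : wilson (opOf q f) p = wilson f (p * q) := by
  rw [wilson_eq, wilson_eq, opOf_mul]

theorem wilson_sum {ι : Type*} (s : Finset ι) (f : ι → QP R) (p : R[X]) :
    wilson (∑ i ∈ s, f i) p = ∑ i ∈ s, wilson (f i) p := by
  simp only [wilson_eq, map_sum]

theorem eq_zero_of_wilson {f : QP R} (hf : ∀ p, wilson f p = 0) : f = 0 :=
  eq_zero_of_jets (x := 0) fun i => by rw [← opOf_X_pow, ← wilson_eq, hf]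

theorem mem_perp {V : Submodule Rᵐᵒᵖ (QP R)} {p : R[X]} :
    p ∈ perp V ↔ ∀ f ∈ V, wilson f p = 0 := by
  simp [perp, Submodule.mem_iInf, LinearMap.mem_ker]

theorem perp_span {ι : Type*} (f : ι → QP R) :
    perp (Submodule.span Rᵐᵒᵖ (Set.range f)) = ⨅ j, LinearMap.ker (wilson (f j)) := by
  ext p
  rw [mem_perp, Submodule.mem_iInf]
  refine ⟨fun h j => h _ (Submodule.subset_span ⟨j, rfl⟩), fun h g hg => ?_⟩
  induction hg using Submodule.span_induction with
  | mem x hx => obtain ⟨j, rfl⟩ := hx; exact h j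
  | zero => simp [wilson_eq]
  | add x y _ _ hx hy => rw [wilson_add, hx, hy, add_zero]
  | smul r x _ hx => rw [wilson_op_smul, hx, smul_zero]

end Algebra

section Algebra

variable {R : Type*} [Ring R] [Algebra ℂ R]

/-! ### Differential operators and their symbols -/

theorem leftMulQR_apply (a : RatR R) (f : QR R) (α : ℂ) : leftMulQR a f α = a * f α := by
  simp [leftMulQR]

theorem dQR_single (α : ℂ) (u : RatR R) :
    dQR R (Finsupp.single α u) = Finsupp.single α (ratRDeriv R u + α • u) := by
  simp [dQR]

theorem dQR_apply (f : QR R) (α : ℂ) : dQR R f α = ratRDeriv R (f α) + α • f α := by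
  classical
  induction f using Finsupp.induction_linear with
  | zero => simp
  | add f g hf hg =>
    simp only [map_add, Finsupp.add_apply, hf, hg, smul_add]
    abel
  | single β u =>
    rw [dQR_single, Finsupp.single_apply, Finsupp.single_apply]
    split_ifs with h
    · rw [h]
    · simp

theorem leftMulQR_mul (a b : RatR R) : leftMulQR (a * b) = leftMulQR a * leftMulQR b := by
  refine LinearMap.ext fun f => Finsupp.ext fun α => ?_
  rw [Module.End.mul_apply]
  simp only [leftMulQR_apply, mul_assoc]

theorem leftMulQR_add (a b : RatR R) : leftMulQR (a + b) = leftMulQR a + leftMulQR b := by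
  refine LinearMap.ext fun f => Finsupp.ext fun α => ?_
  rw [LinearMap.add_apply, Finsupp.add_apply]
  simp only [leftMulQR_apply, add_mul]

@[simp] theorem leftMulQR_zero : leftMulQR (0 : RatR R) = 0 := by
  refine LinearMap.ext fun f => Finsupp.ext fun α => ?_
  simp [leftMulQR_apply]

@[simp] theorem leftMulQR_one : leftMulQR (1 : RatR R) = 1 := by
  refine LinearMap.ext fun f => Finsupp.ext fun α => ?_
  simp [leftMulQR_apply]

theorem dQR_mul_leftMulQR (a : RatR R) :
    dQR R * leftMulQR a = leftMulQR (ratRDeriv R a) + leftMulQR a * dQR R := by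
  refine LinearMap.ext fun f => Finsupp.ext fun α => ?_
  simp only [LinearMap.add_apply, Finsupp.add_apply, Module.End.mul_apply, dQR_apply,
    leftMulQR_apply, ratRDeriv_mul, mul_add, mul_smul_comm, add_assoc]

theorem toQR_apply (f : QP R) (α : ℂ) : f.toQR α = polyToRat R (f α) := by simp [QP.toQR]

theorem toQR_add (f g : QP R) : (f + g).toQR = f.toQR + g.toQR := by
  refine Finsupp.ext fun α => ?_
  simp only [Finsupp.add_apply, toQR_apply, map_add]

@[simp] theorem toQR_zero : (0 : QP R).toQR = 0 := by
  refine Finsupp.ext fun α => ?_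
  simp only [Finsupp.zero_apply, toQR_apply, map_zero]

theorem toQR_sum {ι : Type*} (s : Finset ι) (f : ι → QP R) :
    (∑ i ∈ s, f i).toQR = ∑ i ∈ s, (f i).toQR :=
  map_sum (AddMonoidHom.mk' (QP.toQR (R := R)) toQR_add) f s

theorem toQR_injective : Function.Injective (QP.toQR (R := R)) := fun f g h => by
  refine Finsupp.ext fun α => polyToRat_injective ?_
  rw [← toQR_apply, ← toQR_apply, h]

theorem dQR_toQR (f : QP R) : dQR R f.toQR = (D f).toQR := by
  refine Finsupp.ext fun α => ?_
  rw [dQR_apply, toQR_apply, toQR_apply, D_apply, map_add, ratRDeriv_polyToRat]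
  congr 1
  rw [← algebraMap_smul R α (f α), map_smul, algebraMap_smul]

theorem dQR_pow_toQR (k : ℕ) (f : QP R) : (dQR R ^ k) f.toQR = ((D ^ k) f).toQR := by
  induction k with
  | zero => simp
  | succ k ih => rw [pow_succ', Module.End.mul_apply, ih, dQR_toQR, pow_succ', Module.End.mul_apply]

theorem leftMulQR_toQR (b : R[X]) (f : QP R) :
    leftMulQR (polyToRat R b) f.toQR = (b • f).toQR := by
  refine Finsupp.ext fun α => ?_
  rw [leftMulQR_apply, toQR_apply, toQR_apply, Finsupp.smul_apply, smul_eq_mul, polyToRat_mul]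

/-- The symbol of a differential operator. -/
def symb (P : DiffOp R) : (RatR R)[X] := ⟨.ofCoeff P⟩

theorem coeff_symb (P : DiffOp R) (k : ℕ) : (symb P).coeff k = P k := rfl

/-- The differential operator with a given symbol. -/
def ofSymb (S : (RatR R)[X]) : DiffOp R := S.toFinsupp.coeff

theorem ofSymb_apply (S : (RatR R)[X]) (k : ℕ) : ofSymb S k = S.coeff k := rfl

theorem symb_injective : Function.Injective (symb (R := R)) := fun P Q h => by
  ext1 k
  rw [← coeff_symb, h, coeff_symb]

/-- The action of the differential operator with a given symbol. -/
def actP (S : (RatR R)[X]) : Module.End ℂ (QR R) := (ofSymb S).act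

theorem actP_symb (P : DiffOp R) : actP (symb P) = P.act := rfl

theorem actP_add (S T : (RatR R)[X]) : actP (S + T) = actP S + actP T := by
  have : ofSymb (S + T) = ofSymb S + ofSymb T := by
    ext1 k
    rw [Finsupp.add_apply, ofSymb_apply, ofSymb_apply, ofSymb_apply, coeff_add]
  rw [actP, this, DiffOp.act, Finsupp.sum_add_index']
  · rfl
  · simp
  · intro k a b; rw [leftMulQR_add, add_mul]

theorem actP_monomial (k : ℕ) (a : RatR R) : actP (monomial k a) = leftMulQR a * dQR R ^ k := by
  have : ofSymb (monomial k a) = Finsupp.single k a := by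
    classical
    ext1 j
    rw [ofSymb_apply, coeff_monomial, Finsupp.single_apply]
  rw [actP, this, DiffOp.act, Finsupp.sum_single_index (by simp)]

@[simp] theorem actP_zero : actP (0 : (RatR R)[X]) = 0 := by
  rw [← monomial_zero_right 0, actP_monomial, leftMulQR_zero, zero_mul]

theorem actP_sub_add (S T : (RatR R)[X]) : actP (S - T) + actP T = actP S := by
  rw [← actP_add, sub_add_cancel]

theorem actP_sum {ι : Type*} (s : Finset ι) (S : ι → (RatR R)[X]) :
    actP (∑ i ∈ s, S i) = ∑ i ∈ s, actP (S i) :=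
  map_sum (AddMonoidHom.mk' (actP (R := R)) actP_add) S s

theorem actP_eq_sum (S : (RatR R)[X]) {n : ℕ} (hS : ∀ k, n ≤ k → S.coeff k = 0) :
    actP S = ∑ k ∈ Finset.range n, leftMulQR (S.coeff k) * dQR R ^ k := by
  have : S = ∑ k ∈ Finset.range n, monomial k (S.coeff k) := by
    ext k
    simp only [finsetSum_coeff, coeff_monomial, Finset.sum_ite_eq', Finset.mem_range]
    split_ifs with h
    · rfl
    · exact hS k (not_lt.mp h)
  conv_lhs => rw [this]
  rw [actP_sum]
  simp only [actP_monomial]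

theorem actP_C_mul (a : RatR R) (S : (RatR R)[X]) : actP (C a * S) = leftMulQR a * actP S := by
  induction S using Polynomial.induction_on' with
  | add S T hS hT => rw [mul_add, actP_add, actP_add, mul_add, hS, hT]
  | monomial k b => rw [C_mul_monomial, actP_monomial, actP_monomial, leftMulQR_mul, mul_assoc]

/-- The symbol of the operator `∂ₓ ∘ S`. -/
def dSymb (S : (RatR R)[X]) : (RatR R)[X] := X * S + S.sum fun k a => monomial k (ratRDeriv R a)

theorem coeff_dSymb_succ (S : (RatR R)[X]) (k : ℕ) :
    (dSymb S).coeff (k + 1) = S.coeff k + ratRDeriv R (S.coeff (k + 1)) := by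
  rw [dSymb, coeff_add, coeff_X_mul, Polynomial.sum_def]
  simp only [finsetSum_coeff, coeff_monomial, Finset.sum_ite_eq']
  split_ifs with h
  · rfl
  · rw [notMem_support_iff.mp h, map_zero]

theorem actP_dSymb (S : (RatR R)[X]) : actP (dSymb S) = dQR R * actP S := by
  induction S using Polynomial.induction_on' with
  | add S T hS hT =>
    have : dSymb (S + T) = dSymb S + dSymb T := by
      rw [dSymb, Polynomial.sum_add_index _ _ _ (by simp) (by simp), mul_add, dSymb, dSymb]
      abel
    rw [this, actP_add, actP_add, mul_add, hS, hT]
  | monomial k a =>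
    rw [dSymb, sum_monomial_index _ _ (by simp), X_mul_monomial, actP_add, actP_monomial,
      actP_monomial, actP_monomial, ← mul_assoc, dQR_mul_leftMulQR, add_mul, pow_succ', mul_assoc,
      add_comm]

theorem actP_dSymb_iterate (k : ℕ) (S : (RatR R)[X]) :
    actP (dSymb^[k] S) = dQR R ^ k * actP S := by
  induction k with
  | zero => simp
  | succ k ih => rw [Function.iterate_succ_apply', actP_dSymb, ih, pow_succ', mul_assoc]

/-- Monic symbols of order `l`. -/
def IsMonicSymb (S : (RatR R)[X]) (l : ℕ) : Prop := S.coeff l = 1 ∧ ∀ k, l < k → S.coeff k = 0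

theorem ratRDeriv_one : ratRDeriv R 1 = 0 := ratRDeriv_const 1

theorem IsMonicSymb.dSymb_iterate {S : (RatR R)[X]} {l : ℕ} (hS : IsMonicSymb S l) (k : ℕ) :
    IsMonicSymb (dSymb^[k] S) (k + l) := by
  induction k with
  | zero => simpa using hS
  | succ k ih =>
    rw [Function.iterate_succ_apply', show k + 1 + l = k + l + 1 by omega]
    constructor
    · rw [coeff_dSymb_succ, ih.1, ih.2 _ (Nat.lt_succ_self _), map_zero, add_zero]
    · intro j hj
      obtain ⟨j, rfl⟩ : ∃ i, j = i + 1 := ⟨j - 1, by omega⟩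
      rw [coeff_dSymb_succ, ih.2 _ (by omega), ih.2 _ (by omega), map_zero, add_zero]

/-- The symbol of a composition. -/
def compSymb (Q S : (RatR R)[X]) : (RatR R)[X] := Q.sum fun k a => C a * dSymb^[k] S

theorem actP_compSymb (Q S : (RatR R)[X]) : actP (compSymb Q S) = actP Q * actP S := by
  rw [compSymb, Polynomial.sum_def, actP_sum]
  conv_rhs => rw [← Q.sum_monomial_eq, Polynomial.sum_def, actP_sum, Finset.sum_mul]
  refine Finset.sum_congr rfl fun k _ => ?_
  rw [actP_C_mul, actP_dSymb_iterate, actP_monomial, mul_assoc]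

/-- Only the k-th term of Q reaches order k + l, and there the monic factor contributes 1. -/
theorem coeff_compSymb {Q S : (RatR R)[X]} {l : ℕ} (hS : IsMonicSymb S l) {k : ℕ}
    (hQ : Q.natDegree ≤ k) : (compSymb Q S).coeff (k + l) = Q.coeff k ∧
      ∀ j, k + l < j → (compSymb Q S).coeff j = 0 := by
  simp only [compSymb, Polynomial.sum_def, finsetSum_coeff, coeff_C_mul]
  constructor
  · rw [Finset.sum_eq_single k, (hS.dSymb_iterate k).1, mul_one]
    · intro i hi hik
      have := le_natDegree_of_mem_supp i hi
      rw [(hS.dSymb_iterate i).2 _ (by omega), mul_zero]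
    · intro hk
      rw [notMem_support_iff.mp hk, zero_mul]
  · intro j hj
    refine Finset.sum_eq_zero fun i hi => ?_
    have := le_natDegree_of_mem_supp i hi
    rw [(hS.dSymb_iterate i).2 _ (by omega), mul_zero]

/-- Division with remainder by a monic differential operator. -/
theorem exists_div {S : (RatR R)[X]} {l : ℕ} (hS : IsMonicSymb S l) (T : (RatR R)[X]) :
    ∃ Q U : (RatR R)[X], actP T = actP Q * actP S + actP U ∧ ∀ k, l ≤ k → U.coeff k = 0 := by
  have key : ∀ n (T : (RatR R)[X]), (∀ k, n + l ≤ k → T.coeff k = 0) →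
      ∃ Q U : (RatR R)[X], actP T = actP Q * actP S + actP U ∧ ∀ k, l ≤ k → U.coeff k = 0 := by
    intro n
    induction n with
    | zero => exact fun T hT => ⟨0, T, by simp, by simpa using hT⟩
    | succ n ih =>
      intro T hT
      obtain ⟨Q, U, h, hU⟩ := ih (T - C (T.coeff (n + l)) * dSymb^[n] S) fun k hk => by
        rw [coeff_sub, coeff_C_mul]
        rcases eq_or_lt_of_le hk with rfl | hk
        · rw [(hS.dSymb_iterate n).1, mul_one, sub_self]
        · rw [(hS.dSymb_iterate n).2 k hk, mul_zero, hT k (by omega), sub_zero]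
      refine ⟨Q + monomial n (T.coeff (n + l)), U, ?_, hU⟩
      rw [← actP_sub_add T (C (T.coeff (n + l)) * dSymb^[n] S), h, actP_C_mul, actP_dSymb_iterate,
        actP_add, add_mul, actP_monomial, mul_assoc, add_right_comm]
  exact key (T.natDegree + 1) T fun k hk => coeff_eq_zero_of_natDegree_lt (by omega)

/-! ### Uniqueness of symbols, and operators with constant coefficients -/

theorem dQR_pow_single_one (α : ℂ) (k : ℕ) :
    (dQR R ^ k) (Finsupp.single α 1) = Finsupp.single α (α ^ k • 1) := by
  induction k with
  | zero => simp
  | succ k ih =>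
    rw [pow_succ', Module.End.mul_apply, ih, dQR_single, map_smul, ratRDeriv_one, smul_zero,
      zero_add, smul_smul, pow_succ']

/-- Applied to exp(αx), an operator gives its symbol at α, and a symbol vanishing at every scalar is
zero. -/
theorem eq_zero_of_actP {T : (RatR R)[X]} (hT : actP T = 0) : T = 0 := by
  have h0 := eq_zero_of_infinite_sum_pow_smul (ofSymb T) Set.infinite_univ fun α _ => by
    have h1 := DFunLike.congr_fun (LinearMap.congr_fun hT (Finsupp.single α 1)) α
    rw [LinearMap.zero_apply, Finsupp.zero_apply, actP, DiffOp.act, Finsupp.sum,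
      LinearMap.sum_apply, Finsupp.finsetSum_apply] at h1
    rw [← h1, Finsupp.sum]
    refine Finset.sum_congr rfl fun k _ => ?_
    rw [Module.End.mul_apply, dQR_pow_single_one, leftMulQR_apply, Finsupp.single_eq_same,
      mul_smul_comm, mul_one]
  ext1 k
  exact DFunLike.congr_fun h0 k

theorem actP_injective : Function.Injective (actP (R := R)) := fun S T h => by
  have h1 := actP_sub_add S T
  refine sub_eq_zero.mp (eq_zero_of_actP (LinearMap.ext fun f => Finsupp.ext fun α => ?_))
  have h2 := DFunLike.congr_fun (LinearMap.congr_fun h1 f) α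
  rw [h, LinearMap.add_apply, Finsupp.add_apply] at h2
  exact add_eq_right.mp h2

/-- The symbol of `p(∂)`. -/
def constS : R[X] →+* (RatR R)[X] := mapRingHom Algebra.TensorProduct.includeLeftRingHom

theorem coeff_constS (p : R[X]) (k : ℕ) : (constS p).coeff k = p.coeff k ⊗ₜ[ℂ] (1 : RatFunc ℂ) := by
  rw [constS, coe_mapRingHom, coeff_map]; rfl

theorem tmul_one_injective : Function.Injective fun r : R => r ⊗ₜ[ℂ] (1 : RatFunc ℂ) := by
  intro r s h
  simp only [← polyToRat_C] at h
  exact C_injective (polyToRat_injective h)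

/-- Constants commute with ∂ₓ, so no Leibniz terms arise and symbols multiply as polynomials. -/
theorem actP_mul_constS (S : (RatR R)[X]) (p : R[X]) :
    actP (S * constS p) = actP S * actP (constS p) := by
  induction S using Polynomial.induction_on' with
  | add S T hS hT => rw [add_mul, actP_add, actP_add, add_mul, hS, hT]
  | monomial k a =>
    induction p using Polynomial.induction_on' with
    | add p q hp hq => rw [map_add, mul_add, actP_add, actP_add, mul_add, hp, hq]
    | monomial j c =>
      have hc : Commute (dQR R) (leftMulQR (c ⊗ₜ[ℂ] (1 : RatFunc ℂ))) := by
        rw [commute_iff_eq, dQR_mul_leftMulQR, ratRDeriv_const, leftMulQR_zero, zero_add]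
      have h1 : constS (monomial j c) = monomial j (c ⊗ₜ[ℂ] (1 : RatFunc ℂ)) := by
        rw [constS, coe_mapRingHom, map_monomial]; rfl
      rw [h1, monomial_mul_monomial, actP_monomial, actP_monomial, actP_monomial, leftMulQR_mul,
        pow_add, mul_assoc, mul_assoc, ← mul_assoc _ (dQR R ^ k), ← (hc.pow_left k).eq, mul_assoc]

theorem actP_constS_toQR (p : R[X]) (f : QP R) : actP (constS p) f.toQR = (opOf p f).toQR := by
  induction p using Polynomial.induction_on' with
  | add p q hp hq =>
    rw [map_add, actP_add, LinearMap.add_apply, hp, hq, map_add, LinearMap.add_apply, toQR_add]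
  | monomial k r =>
    have h1 : constS (monomial k r) = monomial k (r ⊗ₜ[ℂ] (1 : RatFunc ℂ)) := by
      rw [constS, coe_mapRingHom, map_monomial]; rfl
    rw [h1, actP_monomial, Module.End.mul_apply, dQR_pow_toQR, opOf_monomial, ← polyToRat_C,
      leftMulQR_toQR, poly_C_smul]

theorem mem_ker_iff (P : DiffOp R) (f : QP R) : f ∈ P.ker ↔ actP (symb P) f.toQR = 0 := Iff.rfl

theorem subsingleton_RatR [Subsingleton R] : Subsingleton (RatR R) := by
  refine subsingleton_of_zero_eq_one ?_
  rw [← polyToRat_one, Subsingleton.elim (1 : R[X]) 0, map_zero]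

theorem nontrivial_RatR [Nontrivial R] : Nontrivial (RatR R) :=
  tmul_one_injective.nontrivial

theorem DiffOp.IsConst.exists_constS {L : DiffOp R} (hL : L.IsConst) : ∃ p, symb L = constS p := by
  choose c hc using hL
  refine ⟨∑ k ∈ L.support, monomial k (c k), ?_⟩
  ext1 k
  simp only [coeff_constS, finsetSum_coeff, coeff_monomial, Finset.sum_ite_eq', coeff_symb]
  split_ifs with h
  · exact hc k
  · rw [zero_tmul, Finsupp.notMem_support_iff.mp h]

/-- A Darboux operator right-divides a monic operator with scalar constant coefficients. -/
theorem DiffOp.IsDarboux.exists_scalar [Module.Finite ℂ R] {P : DiffOp R} {l : ℕ}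
    (hP : P.IsDarboux l) : ∃ (h : ℂ[X]) (Q : (RatR R)[X]) (k : ℕ), h.Monic ∧ IsMonicSymb Q k ∧
      h.natDegree = k + l ∧ actP (constS (sc h)) = actP Q * actP (symb P) := by
  rcases subsingleton_or_nontrivial R with hR | hR
  · have := subsingleton_RatR (R := R)
    refine ⟨X ^ l, 0, 0, monic_X_pow l, ⟨Subsingleton.elim _ _, fun _ _ => Subsingleton.elim _ _⟩,
      by simp, ?_⟩
    refine LinearMap.ext fun f => Finsupp.ext fun α => Subsingleton.elim _ _
  have := nontrivial_RatR (R := R)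
  obtain ⟨hPm, L, n, hLm, hLc, Q, hQ⟩ := hP
  obtain ⟨p, hp⟩ := hLc.exists_constS
  have hpn : p.coeff n = 1 := tmul_one_injective (by
    simp only [← coeff_constS, ← hp]; exact hLm.1)
  have hpk : ∀ k, n < k → p.coeff k = 0 := fun k hk => tmul_one_injective (by
    simp only [← coeff_constS, ← hp, zero_tmul]; exact hLm.2 k hk)
  have hpm : p.Monic := monic_of_natDegree_le_of_coeff_eq_one n
    (natDegree_le_iff_coeff_eq_zero.mpr hpk) hpn
  -- A monic polynomial is regular, so a left multiple of L is scalar. P still right-divides that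
  -- multiple, since the new factor stands on the left.
  obtain ⟨d, y, hd, -, hyp⟩ := exists_mul_eq_scalar p fun y hy => by
    by_contra hy0
    exact hy0 (hpm.mul_right_eq_zero_iff.mp hy)
  have hh : (d * C d.leadingCoeff⁻¹).Monic := monic_mul_leadingCoeff_inv hd
  generalize hhd : d * C d.leadingCoeff⁻¹ = h at hh
  have hy : sc (C d.leadingCoeff⁻¹) * y * p = sc h := by
    rw [mul_assoc, hyp, ← sc_apply, ← hhd, mul_comm d, map_mul]
  generalize sc (C d.leadingCoeff⁻¹) * y = y' at hy
  set Q' := compSymb (constS y') (symb Q)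
  have hcomp : actP (constS (sc h)) = actP Q' * actP (symb P) := by
    rw [actP_compSymb, mul_assoc, actP_symb, actP_symb, ← hQ, ← actP_symb, hp, ← actP_mul_constS,
      ← map_mul, hy]
  -- Comparing top coefficients with the monic h(∂) forces the quotient to be monic of order deg h -
  -- l.
  have hS := coeff_compSymb (Q := Q') (S := symb P) hPm le_rfl
  rw [← actP_compSymb] at hcomp
  rw [← actP_injective hcomp] at hS
  have hcm : (constS (sc h) : (RatR R)[X]).Monic := (hh.map _).map _
  have hdeg : (constS (sc h) : (RatR R)[X]).natDegree = h.natDegree := by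
    have h1 := (hh.map (algebraMap ℂ R)).natDegree_map
      (Algebra.TensorProduct.includeLeftRingHom : R →+* RatR R)
    rwa [hh.natDegree_map] at h1
  have hle : (constS (sc h) : (RatR R)[X]).natDegree ≤ Q'.natDegree + l :=
    natDegree_le_iff_coeff_eq_zero.mpr hS.2
  have hQ0 : Q' ≠ 0 := fun h0 => by
    rw [actP_compSymb, h0, actP_zero, zero_mul] at hcomp
    exact hcm.ne_zero (eq_zero_of_actP hcomp)
  have hge : Q'.natDegree + l ≤ (constS (sc h) : (RatR R)[X]).natDegree :=
    le_natDegree_of_ne_zero (by rw [hS.1]; simpa using hQ0)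
  have heq := le_antisymm hle hge
  refine ⟨h, Q', Q'.natDegree, hh, ⟨?_, fun k hk => coeff_eq_zero_of_natDegree_lt hk⟩, ?_, ?_⟩
  · rw [← hS.1, ← heq]; exact hcm
  · rw [← hdeg, heq]
  · rw [hcomp, actP_compSymb]

end Algebra

section Algebra

variable {R : Type*} [Ring R] [Algebra ℂ R]

/-! ### Equations with polynomial coefficients -/

/-- `T` is a differential operator of order less than `n` with coefficients in `R[x]`. -/
def IsLower (n : ℕ) (T : QP R → QP R) : Prop :=
  ∃ b : ℕ → R[X], ∀ f, T f = ∑ j ∈ Finset.range n, b j • (D ^ j) f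

theorem IsLower.add {n : ℕ} {S T : QP R → QP R} (hS : IsLower n S) (hT : IsLower n T) :
    IsLower n fun f => S f + T f := by
  obtain ⟨b, hb⟩ := hS
  obtain ⟨c, hc⟩ := hT
  exact ⟨fun j => b j + c j, fun f => by simp only [hb, hc, add_smul, Finset.sum_add_distrib]⟩

theorem isLower_zero (n : ℕ) : IsLower n fun _ : QP R => 0 :=
  ⟨fun _ => 0, fun f => by simp⟩

theorem IsLower.smul {n : ℕ} {T : QP R → QP R} (a : R[X]) (hT : IsLower n T) :
    IsLower n fun f => a • T f := by
  obtain ⟨b, hb⟩ := hT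
  exact ⟨fun j => a * b j, fun f => by simp only [hb, Finset.smul_sum, mul_smul]⟩

theorem isLower_smul_D_pow {n j : ℕ} (hj : j < n) (a : R[X]) :
    IsLower n fun f : QP R => a • (D ^ j) f :=
  ⟨fun i => if i = j then a else 0, fun f => by simp [ite_smul, hj]⟩

theorem IsLower.sum {n : ℕ} {ι : Type*} (s : Finset ι) {T : ι → QP R → QP R}
    (hT : ∀ i ∈ s, IsLower n (T i)) : IsLower n fun f => ∑ i ∈ s, T i f := by
  classical
  induction s using Finset.induction_on with
  | empty => simpa using isLower_zero n
  | insert a s ha ih =>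
    simp only [Finset.sum_insert ha]
    exact (hT a (Finset.mem_insert_self a s)).add
      (ih fun i hi => hT i (Finset.mem_insert_of_mem hi))

theorem IsLower.comp_D {n : ℕ} {T : QP R → QP R} (hT : IsLower n T) :
    IsLower (n + 1) fun f => D (T f) := by
  obtain ⟨b, hb⟩ := hT
  have : ∀ f : QP R, D (T f) = ∑ j ∈ Finset.range n,
      (derivative (b j) • (D ^ j) f + b j • (D ^ (j + 1)) f) := fun f => by
    rw [hb, map_sum]
    exact Finset.sum_congr rfl fun j _ => by rw [D_poly_smul, pow_succ', Module.End.mul_apply]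
  simp only [this]
  refine IsLower.sum _ fun j hj => ?_
  have := Finset.mem_range.mp hj
  exact (isLower_smul_D_pow (by omega) _).add (isLower_smul_D_pow (by omega) _)

theorem IsLower.mono {n k : ℕ} (h : n ≤ k) {T : QP R → QP R} (hT : IsLower n T) :
    IsLower k T := by
  obtain ⟨b, hb⟩ := hT
  have : T = fun f : QP R => ∑ j ∈ Finset.range n, b j • (D ^ j) f := funext hb
  rw [this]
  exact IsLower.sum _ fun j hj =>
    isLower_smul_D_pow ((Finset.mem_range.mp hj).trans_le h) _

/-- `B` is a differential operator of order `n` with coefficients in `R[x]` and leading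
coefficient `d`. -/
def IsOp (n : ℕ) (d : ℂ[X]) (B : QP R → QP R) : Prop :=
  ∃ T : QP R → QP R, IsLower n T ∧ ∀ f, B f = (sc d : R[X]) • (D ^ n) f + T f

theorem IsOp.comp_D {n : ℕ} {d : ℂ[X]} {B : QP R → QP R} (hB : IsOp n d B) :
    IsOp (n + 1) d fun f => D (B f) := by
  obtain ⟨T, hT, h⟩ := hB
  refine ⟨_, (isLower_smul_D_pow (Nat.lt_succ_self n) (derivative (sc d))).add hT.comp_D, fun f => ?_⟩
  beta_reduce
  rw [h, map_add, D_poly_smul, pow_succ', Module.End.mul_apply]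
  abel

theorem IsOp.comp_D_pow {n : ℕ} {d : ℂ[X]} {B : QP R → QP R} (hB : IsOp n d B) (i : ℕ) :
    IsOp (n + i) d fun f => (D ^ i) (B f) := by
  induction i with
  | zero => simpa using hB
  | succ i ih =>
    simp only [pow_succ', Module.End.mul_apply, ← add_assoc]
    exact ih.comp_D

theorem evalS_sc (x : ℂ) (d : ℂ[X]) : evalS x (sc d : R[X]) = algebraMap ℂ R (d.eval x) :=
  evalS_map x d

/-- The jets of a solution, in terms of the leading coefficient and the lower jets. -/
theorem IsOp.exists_ev {n : ℕ} {d : ℂ[X]} {B : QP R → QP R} (hB : IsOp n d B) (x : ℂ) :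
    ∃ b : ℕ → R, ∀ f, ev x (B f) = d.eval x • ev x ((D ^ n) f) +
      ∑ j ∈ Finset.range n, b j * ev x ((D ^ j) f) := by
  obtain ⟨T, ⟨b, hb⟩, h⟩ := hB
  refine ⟨fun j => evalS x (b j), fun f => ?_⟩
  rw [h, hb, map_add, map_sum, ev_poly_smul, evalS_sc, ← Algebra.smul_def]
  simp only [ev_poly_smul]

/-- Derivatives of B f = 0 at x express each jet of order ≥ n by lower ones, as d(x) is invertible.
All jets vanish, and they determine f. -/
theorem IsOp.eq_zero {n : ℕ} {d : ℂ[X]} {B : QP R → QP R} (hB : IsOp n d B) {x : ℂ}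
    (hd : d.eval x ≠ 0) {f : QP R} (hf : B f = 0) (hjet : ∀ i < n, ev x ((D ^ i) f) = 0) :
    f = 0 := by
  refine eq_zero_of_jets (x := x) fun i => ?_
  induction i using Nat.strong_induction_on with
  | _ i ih =>
    by_cases hi : i < n
    · exact hjet i hi
    · obtain ⟨j, rfl⟩ := Nat.exists_eq_add_of_le (not_lt.mp hi)
      obtain ⟨b, hb⟩ := (hB.comp_D_pow j).exists_ev x
      have h := hb f
      rw [hf, map_zero, map_zero, Finset.sum_eq_zero, add_zero] at h
      · exact (smul_eq_zero.mp h.symm).resolve_left hd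
      · intro k hk
        rw [ih k (Finset.mem_range.mp hk), mul_zero]

theorem isOp_opOf {h : ℂ[X]} (hh : h.Monic) :
    IsOp h.natDegree 1 fun f : QP R => opOf (sc h) f := by
  refine ⟨_, IsLower.sum (Finset.range h.natDegree) fun i hi =>
    isLower_smul_D_pow (Finset.mem_range.mp hi) (C ((sc h : R[X]).coeff i)), fun f => ?_⟩
  beta_reduce
  rw [opOf_eq_sum _ (Nat.lt_succ_of_le (show (sc h : R[X]).natDegree ≤ _ from natDegree_map_le)),
    Finset.sum_range_succ, add_comm]
  simp only [poly_C_smul, sc_apply, coeff_map]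
  rw [coeff_natDegree, hh, map_one, one_smul, Polynomial.map_one, one_smul]

theorem eq_zero_of_opOf_scalar {h : ℂ[X]} (hh : h.Monic) {x : ℂ} {f : QP R}
    (hf : opOf (sc h) f = 0) (hjet : ∀ i < h.natDegree, ev x ((D ^ i) f) = 0) : f = 0 :=
  (isOp_opOf hh).eq_zero (by simp) hf hjet

/-! ### Clearing denominators in operators -/

/-- A scalar polynomial as an element of `R(x)`. -/
abbrev ratP (d : ℂ[X]) : RatR R := ratS (algebraMap ℂ[X] (RatFunc ℂ) d)

theorem ratP_eq (d : ℂ[X]) : (ratP d : RatR R) = polyToRat R (sc d) := (polyToRat_scalar d).symm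

theorem ratP_mul (c d : ℂ[X]) : (ratP (c * d) : RatR R) = ratP c * ratP d := by
  rw [ratP, map_mul, ratS_mul]

theorem leftMulQR_ratP_toQR (d : ℂ[X]) (f : QP R) :
    leftMulQR (ratP d) f.toQR = ((sc d : R[X]) • f).toQR := by
  rw [ratP_eq, leftMulQR_toQR]

theorem ratP_mul_cancel {d : ℂ[X]} (hd : d ≠ 0) {a b : RatR R} (h : ratP d * a = ratP d * b) :
    a = b := ratS_mul_cancel (RatFunc.algebraMap_ne_zero hd) h

theorem eq_zero_of_leftMulQR {d : ℂ[X]} (hd : d ≠ 0) {v : QR R} (h : leftMulQR (ratP d) v = 0) :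
    v = 0 := by
  refine Finsupp.ext fun α => ratP_mul_cancel hd ?_
  rw [← leftMulQR_apply, h, Finsupp.zero_apply, mul_zero]

theorem ratRDeriv_ratP (d : ℂ[X]) : ratRDeriv R (ratP d) = ratP (derivative d) := by
  rw [ratP_eq, ratP_eq, ratRDeriv_polyToRat, sc_apply, derivative_map, sc_apply]

theorem exists_isOp_of_symb {S : (RatR R)[X]} {l : ℕ} (hS : IsMonicSymb S l) :
    ∃ (d : ℂ[X]) (B : QP R → QP R), d ≠ 0 ∧ IsOp l d B ∧
      ∀ f : QP R, leftMulQR (ratP d) (actP S f.toQR) = (B f).toQR := by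
  obtain ⟨d, b, hd, hb⟩ := exists_common_denom l S.coeff
  refine ⟨d, fun f => (sc d : R[X]) • (D ^ l) f + ∑ i ∈ Finset.range l, b i • (D ^ i) f, hd,
    ⟨_, ⟨b, fun f => rfl⟩, fun f => rfl⟩, fun f => ?_⟩
  rw [actP_eq_sum S (n := l + 1) fun k hk => hS.2 k hk, Finset.sum_range_succ, hS.1,
    leftMulQR_one, one_mul, LinearMap.add_apply, map_add, dQR_pow_toQR, leftMulQR_ratP_toQR,
    add_comm, toQR_add, LinearMap.sum_apply, map_sum, toQR_sum]
  congr 1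
  refine Finset.sum_congr rfl fun i hi => ?_
  rw [Module.End.mul_apply, ← Module.End.mul_apply, ← leftMulQR_mul, hb i (Finset.mem_range.mp hi),
    dQR_pow_toQR, leftMulQR_toQR]

/-- The operator dⁱ⁺¹ ∂ⁱ d⁻¹ has polynomial coefficients: each derivative of d⁻¹ costs one more
factor d. -/
theorem exists_isOp_dQR_pow (d : ℂ[X]) (i : ℕ) : ∃ B : QP R → QP R, IsOp i (d ^ i) B ∧
    ∀ u v, leftMulQR (ratP d) v = QP.toQR u →
      leftMulQR (ratP (d ^ (i + 1))) ((dQR R ^ i) v) = (B u).toQR := by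
  induction i with
  | zero => exact ⟨id, ⟨_, isLower_zero 0, by simp⟩, fun u v h => by simpa using h⟩
  | succ i ih =>
    obtain ⟨B, hB, hBu⟩ := ih
    obtain ⟨T, hT, h⟩ := hB.comp_D
    obtain ⟨T', hT', h'⟩ := hB
    -- This is the correction in dⁱ⁺² ∂ = d ∂ dⁱ⁺¹ - (i + 1) d' dⁱ⁺¹.
    set c : ℂ[X] := -((i + 1 : ℕ) * derivative d)
    refine ⟨fun u => (sc d : R[X]) • D (B u) + (sc c : R[X]) • B u, ⟨_, (hT.smul (sc d)).add
      ((isLower_smul_D_pow (Nat.lt_succ_self i) (sc c * sc (d ^ i))).add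
        ((hT'.mono (Nat.le_succ i)).smul (sc c))), fun u => ?_⟩, fun u v huv => ?_⟩
    · have h0 : D (B u) = (sc (d ^ i) : R[X]) • (D ^ (i + 1)) u + T u := h u
      beta_reduce
      rw [h0, h', smul_add, smul_add, ← mul_smul, ← mul_smul, ← map_mul, ← pow_succ']
      abel
    · have h1 : (leftMulQR (ratP (d ^ (i + 1 + 1))) : Module.End ℂ (QR R)) * dQR R =
          leftMulQR (ratP d) * (dQR R * leftMulQR (ratP (d ^ (i + 1)))) +
            leftMulQR (ratP c) * leftMulQR (ratP (d ^ (i + 1))) := by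
        have h2 : d * derivative (d ^ (i + 1)) + c * d ^ (i + 1) = 0 := by
          simp only [c]
          rw [derivative_pow_succ]
          push_cast
          rw [show (C ((i : ℂ) + 1) : ℂ[X]) = (i : ℂ[X]) + 1 by simp]
          ring
        have h3 : (ratP (d * derivative (d ^ (i + 1))) : RatR R) + ratP (c * d ^ (i + 1)) = 0 := by
          rw [ratP_eq, ratP_eq, ← map_add, ← map_add, h2, map_zero, map_zero]
        rw [dQR_mul_leftMulQR, ratRDeriv_ratP, mul_add, ← leftMulQR_mul, ← mul_assoc,
          ← leftMulQR_mul, ← leftMulQR_mul, ← ratP_mul, ← ratP_mul, ← ratP_mul, add_right_comm (leftMulQR _),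
          ← leftMulQR_add, h3, ← pow_succ', leftMulQR_zero, zero_add]
      rw [pow_succ' (dQR R), Module.End.mul_apply, ← Module.End.mul_apply, h1, LinearMap.add_apply,
        Module.End.mul_apply, Module.End.mul_apply, Module.End.mul_apply, hBu u v huv, dQR_toQR,
        leftMulQR_ratP_toQR, leftMulQR_ratP_toQR, ← toQR_add]

/-- Here v = d⁻¹ u may have poles. With c a denominator of the coefficients of Q, the factor dᵏ⁺¹ c
clears every term of Q v and leaves leading coefficient c dᵏ. -/
theorem exists_isOp_of_symb_of_denom {Q : (RatR R)[X]} {k : ℕ} (hQ : IsMonicSymb Q k) {d : ℂ[X]}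
    (hd : d ≠ 0) : ∃ (d₁ d₂ : ℂ[X]) (B : QP R → QP R), d₂ ≠ 0 ∧ IsOp k d₂ B ∧
      ∀ u v, leftMulQR (ratP d) v = QP.toQR u →
        leftMulQR (ratP d₁) (actP Q v) = (B u).toQR := by
  choose B hB hBu using exists_isOp_dQR_pow (R := R) d
  obtain ⟨c, b, hc, hb⟩ := exists_common_denom k Q.coeff
  obtain ⟨T, hT, h⟩ := hB k
  have hlow : ∀ i ∈ Finset.range k, IsLower k fun u => (sc (d ^ (k - i)) * b i) • B i u := by
    intro i hi
    obtain ⟨T, hT, h⟩ := hB i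
    have hi := Finset.mem_range.mp hi
    simp only [h, smul_add, ← mul_smul]
    exact (isLower_smul_D_pow hi _).add ((hT.mono hi.le).smul _)
  refine ⟨d ^ (k + 1) * c, c * d ^ k, fun u => (sc c : R[X]) • B k u +
    ∑ i ∈ Finset.range k, (sc (d ^ (k - i)) * b i) • B i u, mul_ne_zero hc (pow_ne_zero k hd),
    ⟨_, (hT.smul (sc c)).add (IsLower.sum _ hlow), fun u => ?_⟩, fun u v huv => ?_⟩
  · beta_reduce
    rw [h, smul_add, ← mul_smul, ← map_mul, add_assoc]
  · rw [actP_eq_sum Q (n := k + 1) fun j hj => hQ.2 j hj, Finset.sum_range_succ, hQ.1,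
      leftMulQR_one, one_mul, LinearMap.add_apply, map_add, add_comm, toQR_add,
      LinearMap.sum_apply, map_sum, toQR_sum]
    congr 1
    · rw [mul_comm, ratP_mul, leftMulQR_mul, Module.End.mul_apply, hBu k u v huv,
        leftMulQR_ratP_toQR]
    · refine Finset.sum_congr rfl fun i hi => ?_
      have hi := Finset.mem_range.mp hi
      have h1 : (ratP (d ^ (k + 1) * c) : RatR R) * Q.coeff i =
          polyToRat R (sc (d ^ (k - i)) * b i) * ratP (d ^ (i + 1)) := by
        rw [polyToRat_mul, ← hb i hi, ← ratP_eq, mul_assoc, mul_assoc, ← ratS_comm, ← mul_assoc,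
          ← mul_assoc, ← ratP_mul, ← ratP_mul]
        congr 2
        rw [show k + 1 = (k - i) + (i + 1) by omega, pow_add]
        ring
      rw [Module.End.mul_apply, ← Module.End.mul_apply, ← leftMulQR_mul, h1, leftMulQR_mul,
        Module.End.mul_apply, hBu i u v huv, leftMulQR_toQR]

/-! ### Jets of the kernel of a Darboux operator -/

theorem exists_recursive_sequence (l k : ℕ) (r : ℕ → R) (F : ℕ → (ℕ → R) → R)
    (hF : ∀ n s s', (∀ j < n, s j = s' j) → F n s = F n s') :
    ∃ s : ℕ → R, (∀ i < l, s i = r i) ∧ ∀ i < k, s (l + i) = F (l + i) s := by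
  induction k with
  | zero => exact ⟨r, fun _ _ => rfl, by simp⟩
  | succ k ih =>
    obtain ⟨s, hs, hsk⟩ := ih
    have hne : ∀ j < l + k, Function.update s (l + k) (F (l + k) s) j = s j := fun j hj =>
      Function.update_of_ne hj.ne _ _
    refine ⟨Function.update s (l + k) (F (l + k) s), fun i hi => ?_, fun i hi => ?_⟩
    · rw [hne i (by omega), hs i hi]
    · rw [hF (l + i) _ s fun j hj => hne j (by omega)]
      rcases Nat.lt_succ_iff_lt_or_eq.mp hi with h | rfl
      · rw [hne _ (by omega), hsk i h]
      · rw [Function.update_self]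

/-- Off finitely many points, the jets of the kernel of a Darboux operator are arbitrary and
determine the elements of the kernel. -/
theorem DiffOp.IsDarboux.jets [Module.Finite ℂ R] {P : DiffOp R} {l : ℕ} (hP : P.IsDarboux l) :
    ∃ δ h : ℂ[X], δ ≠ 0 ∧ h.Monic ∧ (∀ f ∈ P.ker, opOf (sc h) f = 0) ∧ ∀ x, δ.eval x ≠ 0 →
      (∀ f ∈ P.ker, (∀ i < l, ev x ((D ^ i) f) = 0) → f = 0) ∧
      ∀ r : ℕ → R, ∃ f ∈ P.ker, ∀ i < l, ev x ((D ^ i) f) = r i := by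
  obtain ⟨h, Q, k, hh, hQ, hk, hact⟩ := hP.exists_scalar
  obtain ⟨d, B, hd, hB, hBf⟩ := exists_isOp_of_symb (S := symb P) hP.1
  obtain ⟨d₁, d₂, A, hd₂, hA, hAu⟩ := exists_isOp_of_symb_of_denom hQ hd
  have hmem : ∀ f, f ∈ P.ker ↔ B f = 0 := fun f => by
    rw [mem_ker_iff]
    refine ⟨fun hf => toQR_injective ?_, fun hf => eq_zero_of_leftMulQR hd ?_⟩
    · rw [← hBf, hf, map_zero, toQR_zero]
    · rw [hBf, hf, toQR_zero]
  refine ⟨d * d₂, h, mul_ne_zero hd hd₂, hh, fun f hf => toQR_injective ?_, fun x hx => ?_⟩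
  · rw [← actP_constS_toQR, hact, Module.End.mul_apply, (mem_ker_iff P f).mp hf, map_zero,
      toQR_zero]
  rw [eval_mul] at hx
  have hx1 := left_ne_zero_of_mul hx
  have hx2 := right_ne_zero_of_mul hx
  refine ⟨fun f hf hjet => hB.eq_zero hx1 ((hmem f).mp hf) hjet, fun r => ?_⟩
  choose b hb using fun i => (hB.comp_D_pow i).exists_ev x
  -- Beyond order l the jets are chosen so that the first k jets of B f at x vanish: d(x) sₙ +
  -- ∑_{j<n} b_{n-l,j} sⱼ = 0. Since deg h = k + l, a solution of h(∂) with these jets exists.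
  obtain ⟨s, hsr, hs⟩ := exists_recursive_sequence l k r
    (fun n s => -((d.eval x)⁻¹ • ∑ j ∈ Finset.range n, b (n - l) j * s j)) fun n s s' hss => by
      rw [Finset.sum_congr rfl fun j hj => by rw [hss j (Finset.mem_range.mp hj)]]
  obtain ⟨f, hf, hfs⟩ := exists_scalar_solution hh x s
  -- h(∂) = Q P gives A (B f) = 0. As A has order k and B f has zero k-jet at x, B f = 0.
  refine ⟨f, (hmem f).mpr (hA.eq_zero hx2 (toQR_injective ?_) fun i hi => ?_), fun i hi => ?_⟩
  · rw [← hAu _ _ (hBf f), ← Module.End.mul_apply (actP Q), ← hact, actP_constS_toQR, hf, toQR_zero,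
      map_zero]
  · have h1 : ∑ j ∈ Finset.range (l + i), b i j * ev x ((D ^ j) f) =
        ∑ j ∈ Finset.range (l + i), b i j * s j := Finset.sum_congr rfl fun j hj => by
      have := Finset.mem_range.mp hj
      rw [hfs j (by omega)]
    rw [hb, hfs _ (by omega), hs i hi, h1, smul_neg, smul_smul, mul_inv_cancel₀ hx1, one_smul,
      Nat.add_sub_cancel_left, neg_add_cancel]
  · rw [hfs i (by omega), hsr i hi]

theorem exists_eval_ne_zero {δ : ℂ[X]} (hδ : δ ≠ 0) : ∃ x, δ.eval x ≠ 0 := by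
  by_contra! h
  exact hδ (Polynomial.funext fun x => by rw [h, eval_zero])

/-- The kernel of a Darboux operator of order `l` is free of rank `l`, and the corresponding
`l` functionals on `R[z]` have dual polynomials. -/
theorem DiffOp.IsDarboux.exists_dual [Module.Finite ℂ R] {P : DiffOp R} {l : ℕ}
    (hP : P.IsDarboux l) : ∃ (F : Fin l → QP R) (q : Fin l → R[X]),
      (∀ j, F j ∈ P.ker) ∧ (∀ s j, wilson (F j) (q s) = if s = j then 1 else 0) ∧
      ∀ f ∈ P.ker, f = ∑ j, MulOpposite.op (wilson f (q j)) • F j := by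
  obtain ⟨δ, h, hδ, hh, hker, hjets⟩ := hP.jets
  obtain ⟨x, hx⟩ := exists_eval_ne_zero hδ
  obtain ⟨huniq, hex⟩ := hjets x hx
  choose F hF hFj using fun j : Fin l => hex (Pi.single (j : ℕ) 1)
  choose φ hφ hφj using fun i : ℕ => exists_scalar_solution (R := R) hh 0 (Pi.single i 1)
  have hexp : ∀ f, opOf (sc h) f = 0 →
      f = ∑ i ∈ Finset.range h.natDegree, MulOpposite.op (ev 0 ((D ^ i) f)) • φ i := fun f hf => by
    rw [← sub_eq_zero]
    refine eq_zero_of_opOf_scalar hh (x := 0) ?_ fun s hs => ?_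
    · simp only [map_sub, map_sum, map_smul, hf, hφ, smul_zero, Finset.sum_const_zero, sub_zero]
    · simp only [map_sub, map_sum, map_smul, hφj _ s hs]
      rw [sub_eq_zero, Finset.sum_eq_single s]
      · simp
      · intro i _ hi
        rw [Pi.single_eq_of_ne hi.symm, smul_zero]
      · intro h; exact absurd (Finset.mem_range.mpr hs) h
  -- These polynomials move jets from x to 0: expanding a solution f as ∑ φᵢ · f⁽ⁱ⁾(0) gives f⁽ˢ⁾(x)
  -- = ∑ φᵢ⁽ˢ⁾(x) f⁽ⁱ⁾(0) = ⟨q_s, f⟩.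
  set q : Fin l → R[X] := fun s => ∑ i ∈ Finset.range h.natDegree,
    monomial i (ev x ((D ^ (s : ℕ)) (φ i)))
  have hq : ∀ f, opOf (sc h) f = 0 → ∀ s, wilson f (q s) = ev x ((D ^ (s : ℕ)) f) := by
    intro f hf s
    conv_rhs => rw [hexp f hf]
    simp only [q, wilson_eq, map_sum, opOf_monomial, ev_smul, map_smul,
      op_smul_eq_mul]
  refine ⟨F, q, hF, fun s j => ?_, fun f hf => ?_⟩
  · rw [hq _ (hker _ (hF j)), hFj j s s.2, Pi.single_apply]
    simp only [Fin.val_inj]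
  · rw [← sub_eq_zero]
    refine huniq _ (Submodule.sub_mem _ hf (Submodule.sum_mem _ fun j _ =>
      Submodule.smul_mem _ _ (hF j))) fun i hi => ?_
    simp only [map_sub, map_sum, map_smul, hq f (hker f hf), hFj _ i hi]
    rw [sub_eq_zero, Finset.sum_eq_single ⟨i, hi⟩]
    · simp
    · intro j _ hj
      rw [Pi.single_eq_of_ne, smul_zero]
      rintro rfl
      exact hj rfl
    · intro h; exact absurd (Finset.mem_univ _) h

/-! ### Operators, kernels and orthogonal complements determine one another -/

/-- Double orthogonality: p - ∑ ⟨p, Fⱼ⟩ qⱼ lies in V^⊥, so ⟨p, f⟩ = ∑ ⟨p, Fⱼ⟩⟨qⱼ, f⟩ for every p,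
and nondegeneracy of the pairing gives f = ∑ Fⱼ ⟨qⱼ, f⟩. -/
theorem DiffOp.IsDarboux.le_ker_of_perp_le [Module.Finite ℂ R] {P : DiffOp R} {l : ℕ}
    (hP : P.IsDarboux l) {f : QP R} (hf : ∀ p ∈ perp P.ker, wilson f p = 0) : f ∈ P.ker := by
  obtain ⟨F, q, hF, hFq, hexp⟩ := hP.exists_dual
  suffices h : f = ∑ j, MulOpposite.op (wilson f (q j)) • F j by
    rw [h]
    exact Submodule.sum_mem _ fun j _ => Submodule.smul_mem _ _ (hF j)
  rw [← sub_eq_zero]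
  refine eq_zero_of_wilson fun p => ?_
  have hsub : ∀ g p, wilson (f - g) p = wilson f p - wilson g p := fun g p => by
    simp only [wilson_eq, map_sub]
  have hp : p - ∑ j, wilson (F j) p • q j ∈ perp P.ker := mem_perp.mpr fun g hg => by
    rw [hexp g hg, wilson_sum]
    refine Finset.sum_eq_zero fun j _ => ?_
    rw [wilson_op_smul, map_sub, map_sum]
    simp only [map_smul, hFq, smul_eq_mul, mul_ite, mul_one, mul_zero, Finset.sum_ite_eq',
      Finset.mem_univ, if_true, sub_self, smul_zero]
  have h1 := hf _ hp
  rw [map_sub, map_sum, sub_eq_zero] at h1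
  rw [hsub, sub_eq_zero, h1, wilson_sum]
  refine Finset.sum_congr rfl fun j _ => ?_
  rw [map_smul, wilson_op_smul, op_smul_eq_mul, smul_eq_mul]

theorem DiffOp.IsDarboux.ker_eq_of_perp_eq [Module.Finite ℂ R] {P P' : DiffOp R} {l l' : ℕ}
    (hP : P.IsDarboux l) (hP' : P'.IsDarboux l') (h : perp P.ker = perp P'.ker) :
    P.ker = P'.ker :=
  le_antisymm
    (fun f hf => hP'.le_ker_of_perp_le fun _ hp => mem_perp.mp (h ▸ hp) f hf)
    (fun f hf => hP.le_ker_of_perp_le fun _ hp => mem_perp.mp (h.symm ▸ hp) f hf)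

theorem infinite_eval_ne_zero {δ : ℂ[X]} (hδ : δ ≠ 0) : {x | δ.eval x ≠ 0}.Infinite := by
  have : {x | δ.eval x ≠ 0} = {x | δ.IsRoot x}ᶜ := rfl
  rw [this]
  exact (finite_setOfPred_isRoot hδ).infinite_compl

/-- A symbol of order less than `l` that annihilates the kernel of a Darboux operator of order `l`
is zero. -/
theorem DiffOp.IsDarboux.eq_zero_of_ker_le [Module.Finite ℂ R] {P : DiffOp R} {l : ℕ}
    (hP : P.IsDarboux l) {U : (RatR R)[X]} (hU : ∀ k, l ≤ k → U.coeff k = 0)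
    (hker : ∀ f ∈ P.ker, actP U f.toQR = 0) : U = 0 := by
  obtain ⟨δ, h, hδ, -, -, hjets⟩ := hP.jets
  obtain ⟨d, b, hd, hb⟩ := exists_common_denom l U.coeff
  have hzero : ∀ f ∈ P.ker, ∑ i ∈ Finset.range l, b i • (D ^ i) f = 0 := fun f hf => by
    refine toQR_injective ?_
    have h1 := congrArg (leftMulQR (ratP d)) (hker f hf)
    rw [actP_eq_sum U hU, LinearMap.sum_apply, map_sum, map_zero] at h1
    rw [toQR_zero, ← h1, toQR_sum]
    refine Finset.sum_congr rfl fun i hi => ?_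
    rw [Module.End.mul_apply, ← Module.End.mul_apply, ← leftMulQR_mul,
      hb i (Finset.mem_range.mp hi), dQR_pow_toQR, leftMulQR_toQR]
  have hb0 : ∀ i < l, b i = 0 := fun i hi => by
    refine eq_zero_of_infinite_evalS _ (infinite_eval_ne_zero hδ) fun x hx => ?_
    obtain ⟨f, hf, hfj⟩ := (hjets x hx).2 (Pi.single i 1)
    have h1 := congrArg (ev x) (hzero f hf)
    rw [map_zero, map_sum, Finset.sum_eq_single i] at h1
    · rw [← h1, ev_poly_smul, hfj i hi, Pi.single_eq_same, mul_one]
    · intro j hj hji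
      rw [ev_poly_smul, hfj j (Finset.mem_range.mp hj), Pi.single_eq_of_ne hji, mul_zero]
    · intro h; exact absurd (Finset.mem_range.mpr hi) h
  ext1 k
  rw [coeff_zero]
  by_cases hk : l ≤ k
  · exact hU k hk
  · refine ratP_mul_cancel hd ?_
    rw [mul_zero, ratP, hb k (not_le.mp hk), hb0 k (not_le.mp hk), map_zero]

/-- The leading terms cancel, so the difference has order less than l and kills V. -/
theorem DiffOp.IsDarboux.eq_of_ker_eq [Module.Finite ℂ R] {P P' : DiffOp R} {l : ℕ}
    (hP : P.IsDarboux l) (hP' : P'.IsDarboux l) (h : P.ker = P'.ker) : P = P' := by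
  refine symb_injective (sub_eq_zero.mp (hP.eq_zero_of_ker_le (fun k hk => ?_) fun f hf => ?_))
  · rw [coeff_sub, sub_eq_zero, coeff_symb, coeff_symb]
    rcases eq_or_lt_of_le hk with rfl | hk
    · rw [hP.1.1, hP'.1.1]
    · rw [hP.1.2 k hk, hP'.1.2 k hk]
  · have h1 := LinearMap.congr_fun (actP_sub_add (symb P) (symb P')) f.toQR
    rw [LinearMap.add_apply, (mem_ker_iff P f).mp hf, (mem_ker_iff P' f).mp (h ▸ hf), add_zero] at h1
    exact h1

end Algebra

section Algebra

variable {R : Type*} [Ring R] [Algebra ℂ R]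

/-! ### Composition with operators with constant coefficients -/

/-- The operator `P ∘ c(∂)`. -/
def compConst (P : DiffOp R) (c : R[X]) : DiffOp R := ofSymb (symb P * constS c)

theorem symb_compConst (P : DiffOp R) (c : R[X]) : symb (compConst P c) = symb P * constS c := rfl

theorem act_compConst (P : DiffOp R) (c : R[X]) :
    (compConst P c).act = P.act * actP (constS c) := by
  rw [← actP_symb, symb_compConst, actP_mul_constS, actP_symb]

theorem mem_ker_compConst (P : DiffOp R) (c : R[X]) (f : QP R) :
    f ∈ (compConst P c).ker ↔ opOf c f ∈ P.ker := by
  change (compConst P c).act f.toQR = 0 ↔ P.act (opOf c f).toQR = 0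
  rw [act_compConst, Module.End.mul_apply, actP_constS_toQR]

theorem DiffOp.IsMonic.compConst {P : DiffOp R} {l k : ℕ} (hP : P.IsMonic l) {c : R[X]}
    (hc : c.coeff k = 1) (hck : ∀ j, k < j → c.coeff j = 0) : (compConst P c).IsMonic (l + k) := by
  have h1 : (symb P).natDegree ≤ l := natDegree_le_iff_coeff_eq_zero.mpr hP.2
  have h2 : (constS c : (RatR R)[X]).natDegree ≤ k :=
    (natDegree_map_le).trans (natDegree_le_iff_coeff_eq_zero.mpr hck)
  constructor
  · change (symb P * constS c).coeff (l + k) = 1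
    rw [coeff_mul_add_eq_of_natDegree_le h1 h2, coeff_symb, hP.1, coeff_constS, hc, one_mul]
    rfl
  · intro j hj
    exact coeff_eq_zero_of_natDegree_lt ((natDegree_mul_le.trans (add_le_add h1 h2)).trans_lt hj)

theorem DiffOp.IsDarboux.compConst {P : DiffOp R} {l k : ℕ} (hP : P.IsDarboux l) {c : R[X]}
    (hc : c.coeff k = 1) (hck : ∀ j, k < j → c.coeff j = 0) :
    (compConst P c).IsDarboux (l + k) := by
  obtain ⟨hm, L, n, hLm, hLc, Q, hQ⟩ := hP
  refine ⟨hm.compConst hc hck, AdelicGr.compConst L c, n + k, hLm.compConst hc hck, fun j => ?_,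
    Q, ?_⟩
  · obtain ⟨p, hp⟩ := hLc.exists_constS
    refine ⟨(p * c).coeff j, ?_⟩
    rw [← coeff_symb, symb_compConst, hp, ← map_mul, coeff_constS]
  · rw [act_compConst, act_compConst, hQ, mul_assoc]

/-- Solutions of γ(∂) with a unit jet at 0 read off the coefficients of the remainder of s modulo γ.
-/
theorem exists_eq_mul_sc {γ : ℂ[X]} (hγ : γ.Monic) {s : R[X]}
    (hs : ∀ φ : QP R, opOf (sc γ) φ = 0 → wilson φ s = 0) : ∃ q, s = q * sc γ := by
  rcases subsingleton_or_nontrivial R with hR | hR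
  · exact ⟨0, Subsingleton.elim _ _⟩
  have hm : (sc γ : R[X]).Monic := hγ.map _
  have hdeg : (s %ₘ sc γ).degree < γ.natDegree := by
    refine (degree_modByMonic_lt s hm).trans_le ?_
    exact degree_le_natDegree.trans (by exact_mod_cast natDegree_map_le)
  have hdiv := modByMonic_add_div s (sc γ)
  have hr : s %ₘ sc γ = 0 := by
    ext i
    by_cases hi : i < γ.natDegree
    · obtain ⟨φ, hφ, hφj⟩ := exists_scalar_solution (R := R) hγ 0 (Pi.single i 1)
      have h1 := hs φ hφ
      rw [← hdiv, map_add, sc_apply, map_mul_comm, ← sc_apply, ← wilson_opOf, hφ] at h1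
      have h2 : ∀ q : R[X], wilson 0 q = 0 := fun q => by rw [wilson_eq, map_zero, map_zero]
      rw [h2, add_zero, wilson_eq, opOf_eq_sum _ (n := γ.natDegree), map_sum,
        Finset.sum_eq_single i] at h1
      · rwa [ev_smul, hφj i hi, Pi.single_eq_same, mul_one] at h1
      · intro j hj hji
        rw [ev_smul, hφj j (Finset.mem_range.mp hj), Pi.single_eq_of_ne hji, mul_zero]
      · intro h; exact absurd (Finset.mem_range.mpr hi) h
      · rcases eq_or_ne (s %ₘ sc γ) 0 with h0 | h0
        · rw [h0, natDegree_zero]; omega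
        · exact (natDegree_lt_iff_degree_lt h0).mpr hdeg
    · rw [coeff_zero]
      refine coeff_eq_zero_of_degree_lt (hdeg.trans_le ?_)
      exact_mod_cast not_lt.mp hi
  refine ⟨s /ₘ sc γ, ?_⟩
  conv_lhs => rw [← hdiv, hr, zero_add]
  exact map_mul_comm _ _

/-- The adjunction ⟨p, c(∂) f⟩ = ⟨p c, f⟩ gives one inclusion. Conversely, g(∂) maps ker γ(∂) into
ker c(∂), so p g is divisible by γ = c g and hence p = q c. Since c(∂) is onto, q annihilates all of
ker P. -/
theorem perp_ker_compConst {P : DiffOp R} {γ : ℂ[X]} (hγ : γ.Monic) {c g : R[X]}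
    (hcg : c * g = sc γ) (hgc : g * c = sc γ) (p : R[X]) :
    p ∈ perp (compConst P c).ker ↔ ∃ q ∈ perp P.ker, p = q * c := by
  constructor
  · intro hp
    rw [mem_perp] at hp
    obtain ⟨q, hq⟩ : ∃ q, p * g = q * sc γ := exists_eq_mul_sc hγ fun φ hφ => by
      rw [← wilson_opOf]
      refine hp _ ((mem_ker_compConst P c _).mpr ?_)
      rw [← opOf_mul, hcg, hφ]
      exact zero_mem _
    have hpq : p = q * c := by
      rw [← hcg, ← mul_assoc] at hq
      have h1 : (p - q * c) * sc γ = 0 := by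
        rw [← hgc, ← mul_assoc, sub_mul, hq, sub_self, zero_mul]
      exact sub_eq_zero.mp ((hγ.map _).mul_left_eq_zero_iff.mp h1)
    refine ⟨q, mem_perp.mpr fun f hf => ?_, hpq⟩
    obtain ⟨ψ, hψ⟩ := opOf_scalar_surjective hγ f
    have h1 : opOf c (opOf g ψ) = f := by rw [← opOf_mul, hcg, hψ]
    rw [← h1, wilson_opOf, ← hpq]
    exact hp _ ((mem_ker_compConst P c _).mpr (by rwa [h1]))
  · rintro ⟨q, hq, rfl⟩
    rw [mem_perp] at hq ⊢
    intro f hf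
    rw [← wilson_opOf]
    exact hq _ ((mem_ker_compConst P c f).mp hf)

theorem inverse_eq_of_mul {A : Type*} [MonoidWithZero A] {a b : A} (h : a * b = 1) (h' : b * a = 1) :
    Ring.inverse a = b :=
  Ring.inverse_unit ⟨a, b, h, h'⟩

theorem ratS_inv_mul {γ : ℂ[X]} (hγ : γ ≠ 0) :
    (ratS (algebraMap ℂ[X] (RatFunc ℂ) γ)⁻¹ : RatR R) * ratP γ = 1 := by
  rw [ratP, ← ratS_mul, inv_mul_cancel₀ (RatFunc.algebraMap_ne_zero hγ), ratS_one]

theorem inverse_polyToRat {γ : ℂ[X]} (hγ : γ ≠ 0) {c g : R[X]}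
    (hcg : c * g = sc γ) (hgc : g * c = sc γ) :
    Ring.inverse (polyToRat R g) = polyToRat R c * ratS (algebraMap ℂ[X] (RatFunc ℂ) γ)⁻¹ := by
  apply inverse_eq_of_mul
  · rw [← mul_assoc, ← polyToRat_mul, hgc, ← ratP_eq, ← ratS_comm, ratS_inv_mul hγ]
  · rw [← ratS_comm, mul_assoc, ← polyToRat_mul, hcg, ← ratP_eq, ratS_inv_mul hγ]

theorem mem_mulRat {N : Submodule R R[X]} {c a : RatR R} :
    a ∈ mulRat N c ↔ ∃ p ∈ N, polyToRat R p * c = a := by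
  simp [mulRat, Submodule.mem_map]

theorem mulRat_perp_eq {P : DiffOp R} {γ : ℂ[X]} (hγ : γ.Monic) {c g : R[X]}
    (hcg : c * g = sc γ) (hgc : g * c = sc γ) :
    mulRat (perp P.ker) (Ring.inverse (polyToRat R g)) =
      mulRat (perp (compConst P c).ker) (ratS (algebraMap ℂ[X] (RatFunc ℂ) γ)⁻¹) := by
  ext a
  rw [inverse_polyToRat hγ.ne_zero hcg hgc, mem_mulRat, mem_mulRat]
  simp only [perp_ker_compConst hγ hcg hgc]
  constructor
  · rintro ⟨p, hp, rfl⟩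
    exact ⟨p * c, ⟨p, hp, rfl⟩, by rw [polyToRat_mul, mul_assoc]⟩
  · rintro ⟨p, ⟨q, hq, rfl⟩, rfl⟩
    exact ⟨q, hq, by rw [polyToRat_mul, mul_assoc]⟩

/-! ### Wave functions -/

theorem exp_iteratedDeriv (k : ℕ) (x z : ℂ) :
    iteratedDeriv k (fun t : ℂ => Complex.exp (t * z)) x = z ^ k * Complex.exp (x * z) := by
  have := congrFun (iteratedDeriv_cexp_const_mul k z) x
  simpa only [mul_comm z] using this

variable [Module.Finite ℂ R]

/-- The value of a rational function in terms of any scalar denominator. -/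
theorem evalRat_eq {d : ℂ[X]} {a : RatR R} {p : R[X]} (h : ratP d * a = polyToRat R p) {x : ℂ}
    (hx : d.eval x ≠ 0) : evalRat x a = (d.eval x)⁻¹ • evalS x p := by
  have hd : d ≠ 0 := by rintro rfl; simp at hx
  set b := Module.finBasis ℂ R
  have hcoord : ∀ i, TensorProduct.lid ℂ (RatFunc ℂ) (LinearMap.rTensor (RatFunc ℂ) (b.coord i)
      (polyToRat R p)) = algebraMap ℂ[X] (RatFunc ℂ) (p.sum fun k r => monomial k (b.coord i r)) := by
    intro i
    clear h
    induction p using Polynomial.induction_on' with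
    | add p q hp hq =>
      rw [map_add, map_add, map_add, hp, hq, ← map_add, Polynomial.sum_add_index]
      · simp
      · simp
    | monomial k r =>
      rw [polyToRat_monomial, sum_monomial_index _ _ (by simp), LinearMap.rTensor_tmul,
        TensorProduct.lid_tmul, ← smul_X_eq_monomial, Algebra.algebraMap_eq_smul_one, smul_assoc,
        ← Algebra.algebraMap_eq_smul_one, map_pow, RatFunc.algebraMap_X]
  have hmul : ∀ i (a : RatR R), TensorProduct.lid ℂ (RatFunc ℂ)
      (LinearMap.rTensor (RatFunc ℂ) (b.coord i) (ratP d * a)) = algebraMap ℂ[X] (RatFunc ℂ) d *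
        TensorProduct.lid ℂ (RatFunc ℂ) (LinearMap.rTensor (RatFunc ℂ) (b.coord i) a) := by
    intro i a
    induction a using TensorProduct.induction_on with
    | zero => simp
    | add a a' ha ha' => rw [mul_add, map_add, map_add, ha, ha', map_add, map_add, mul_add]
    | tmul r q => simp [ratS]
  have hval : ∀ i, RatFunc.eval (RingHom.id ℂ) x (TensorProduct.lid ℂ (RatFunc ℂ)
      (LinearMap.rTensor (RatFunc ℂ) (b.coord i) a)) =
      (d.eval x)⁻¹ * (p.sum fun k r => monomial k (b.coord i r)).eval x := by
    intro i
    have h1 := hmul i a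
    rw [h, hcoord] at h1
    generalize TensorProduct.lid ℂ (RatFunc ℂ) (LinearMap.rTensor (RatFunc ℂ) (b.coord i) a) = q at h1 ⊢
    have hq : q.denom ∣ d := (RatFunc.denom_dvd hd).mpr ⟨_, by
      rw [h1, mul_div_cancel_left₀ _ (RatFunc.algebraMap_ne_zero hd)]⟩
    have hq' : q.denom.eval x ≠ 0 := fun h0 => hx (eval_eq_zero_of_dvd_of_eval_eq_zero hq h0)
    have h2 := RatFunc.eval_mul (f := RingHom.id ℂ) (a := x)
      (x := algebraMap ℂ[X] (RatFunc ℂ) d) (y := q) (by simp) hq'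
    rw [← h1, RatFunc.eval_algebraMap, RatFunc.eval_algebraMap] at h2
    change eval x _ = eval x d * _ at h2
    rw [eq_inv_mul_iff_mul_eq₀ hx, ← h2]
    rfl
  refine (Finset.sum_congr rfl fun i _ => congrArg (· • b i) (hval i)).trans ?_
  simp only [mul_smul]
  rw [← Finset.smul_sum]
  congr 1
  clear h hval hcoord
  induction p using Polynomial.induction_on' with
  | add p q hp hq =>
    rw [map_add, ← hp, ← hq, ← Finset.sum_add_distrib]
    refine Finset.sum_congr rfl fun i _ => ?_
    rw [Polynomial.sum_add_index _ _ _ (by simp) (by simp), eval_add, add_smul]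
  | monomial k r =>
    have hm : ∀ i, ((monomial k r).sum fun k r => monomial k (b.coord i r)) =
        monomial k (b.coord i r) := fun i => sum_monomial_index _ _ (by simp)
    simp only [hm, eval_monomial]
    rw [← C_mul_X_pow_eq_monomial, map_mul, map_pow, evalS_C, evalS_X, ← map_pow,
      ← Algebra.commutes, ← Algebra.smul_def]
    conv_rhs => rw [← b.sum_repr r, Finset.smul_sum]
    refine Finset.sum_congr rfl fun i _ => ?_
    rw [Module.Basis.coord_apply, mul_comm, mul_smul]

theorem evalRat_zero (x : ℂ) : evalRat x (0 : RatR R) = 0 := by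
  rw [evalRat_eq (d := 1) (p := 0) (by simp) (by simp), map_zero, smul_zero]

/-- The value of a symbol at a point `x`, a polynomial in `z`. -/
def symbAt (x : ℂ) (P : DiffOp R) : R[X] := P.sum fun k a => monomial k (evalRat x a)

theorem coeff_symbAt (x : ℂ) (P : DiffOp R) (k : ℕ) : (symbAt x P).coeff k = evalRat x (P k) := by
  rw [symbAt, Finsupp.sum, finsetSum_coeff]
  simp only [coeff_monomial, Finset.sum_ite_eq']
  split_ifs with h
  · rfl
  · rw [Finsupp.notMem_support_iff.mp h, evalRat_zero]

theorem waveFun_eq (P : DiffOp R) (x z : ℂ) :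
    waveFun P (x, z) = Complex.exp (x * z) • evalS z (symbAt x P) := by
  rw [waveFun, symbAt, Finsupp.sum, Finsupp.sum, map_sum, Finset.smul_sum]
  refine Finset.sum_congr rfl fun k _ => ?_
  rw [exp_iteratedDeriv, ← C_mul_X_pow_eq_monomial, map_mul, map_pow, evalS_C, evalS_X, ← map_pow,
    ← Algebra.commutes, ← Algebra.smul_def, smul_smul, mul_comm]

/-- Pointwise values of rational coefficients are well behaved only away from poles, so d is a
common denominator of the coefficients of P. -/
theorem exists_symbAt_compConst (P : DiffOp R) (c : R[X]) : ∃ d : ℂ[X], d ≠ 0 ∧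
    ∀ x, d.eval x ≠ 0 → symbAt x (compConst P c) = symbAt x P * c := by
  obtain ⟨d, b, hd, hb⟩ := exists_common_denom ((symb P).natDegree + 1) P
  have hb' : ∀ i, ∃ p, ratP d * P i = polyToRat R p := fun i => by
    by_cases hi : i < (symb P).natDegree + 1
    · exact ⟨b i, hb i hi⟩
    · refine ⟨0, ?_⟩
      rw [← coeff_symb, coeff_eq_zero_of_natDegree_lt (by omega), mul_zero, map_zero]
  choose p hp using hb'
  refine ⟨d, hd, fun x hx => ?_⟩
  ext n
  have h1 : ratP d * compConst P c n =
      polyToRat R (∑ ij ∈ Finset.HasAntidiagonal.antidiagonal n, p ij.1 * C (c.coeff ij.2)) := by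
    rw [← coeff_symb, symb_compConst, coeff_mul, Finset.mul_sum, map_sum]
    refine Finset.sum_congr rfl fun ij _ => ?_
    rw [coeff_symb, coeff_constS, ← mul_assoc, hp, polyToRat_mul, polyToRat_C]
  rw [coeff_symbAt, evalRat_eq h1 hx, coeff_mul, map_sum, Finset.smul_sum]
  refine Finset.sum_congr rfl fun ij _ => ?_
  rw [coeff_symbAt, evalRat_eq (hp _) hx, map_mul, evalS_C, smul_mul_assoc]

theorem eventually_eval_ne_zero {d : ℂ[X]} (hd : d ≠ 0) :
    ∀ᶠ x in Filter.cofinite, d.eval x ≠ 0 := by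
  have : {x | d.eval x ≠ 0}ᶜ = {x | d.IsRoot x} := by ext x; simp
  rw [Filter.Eventually, Filter.mem_cofinite, this]
  exact finite_setOfPred_isRoot hd

theorem waveFun_compConst (P : DiffOp R) (c : R[X]) :
    ∀ᶠ w in (Filter.cofinite : Filter ℂ) ×ˢ (Filter.cofinite : Filter ℂ),
      waveFun (compConst P c) w = waveFun P w * evalS w.2 c := by
  obtain ⟨d, hd, h⟩ := exists_symbAt_compConst P c
  filter_upwards [(eventually_eval_ne_zero hd).prod_inl _] with ⟨x, z⟩ hx
  rw [waveFun_eq, waveFun_eq, h x hx, map_mul, smul_mul_assoc]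

/-- A differential operator is determined by its wave function. -/
theorem eq_of_waveFun {P P' : DiffOp R} (h : ∀ᶠ w in (Filter.cofinite : Filter ℂ) ×ˢ
    (Filter.cofinite : Filter ℂ), waveFun P w = waveFun P' w) : P = P' := by
  obtain ⟨p, hp, q, hq, hpq⟩ := Filter.eventually_prod_iff.mp h
  -- For a good x the exponential cancels and two polynomials in z agree at infinitely many points.
  -- Afterwards the same argument in x compares the coefficients.
  have hsymb : ∀ x, p x → symbAt x P = symbAt x P' := fun x hx => by
    refine sub_eq_zero.mp (eq_zero_of_infinite_evalS _ (Filter.frequently_cofinite_iff_infinite.mp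
      hq.frequently) fun z hz => ?_)
    have h1 := hpq hx hz
    rw [waveFun_eq, waveFun_eq] at h1
    rw [map_sub, sub_eq_zero]
    exact smul_right_injective R (Complex.exp_ne_zero (x * z)) h1
  ext1 k
  obtain ⟨d, b, hd, hb⟩ := exists_common_denom (R := R) 2 fun i => if i = 0 then P k else P' k
  have h0 := hb 0 (by omega)
  have h1 := hb 1 (by omega)
  simp only [if_true, one_ne_zero, if_false] at h0 h1
  have hb01 : b 0 = b 1 := by
    refine sub_eq_zero.mp (eq_zero_of_infinite_evalS _ (Filter.frequently_cofinite_iff_infinite.mp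
      (hp.and (eventually_eval_ne_zero hd)).frequently) fun x hx => ?_)
    have h2 := congrArg (fun q => coeff q k) (hsymb x hx.1)
    simp only [coeff_symbAt] at h2
    rw [evalRat_eq h0 hx.2, evalRat_eq h1 hx.2] at h2
    rw [map_sub, sub_eq_zero]
    exact smul_right_injective R (inv_ne_zero hx.2) h2
  exact ratP_mul_cancel hd (by rw [ratP, h0, h1, hb01])

/-! ### Passage to scalar normalizations -/

variable {m l : ℕ} {e : Fin m → R}

omit [Module.Finite ℂ R] in
theorem sum_idempotent_mul (he : CompleteOrthogonalIdempotents e) (a b : Fin m → ℂ[X]) :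
    (∑ k, sc (a k) * C (e k)) * (∑ k, sc (b k) * C (e k)) = ∑ k, sc (a k * b k) * C (e k) := by
  rw [Finset.sum_mul_sum]
  refine Finset.sum_congr rfl fun i _ => ?_
  have h1 : ∀ j, sc (a i) * C (e i) * (sc (b j) * C (e j)) =
      if i = j then sc (a i * b i) * C (e i) else 0 := fun j => by
    rw [mul_assoc, ← mul_assoc (C (e i)), sc_apply (b j), ← map_mul_comm, mul_assoc, ← C_mul]
    split_ifs with hij
    · subst hij
      rw [(he.idem i).eq, map_mul, mul_assoc]; rfl
    · rw [he.ortho hij, C_0, mul_zero, mul_zero]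
  simp only [h1, Finset.sum_ite_eq, Finset.mem_univ, if_true]

omit [Module.Finite ℂ R] in
theorem sum_idempotent_const (he : CompleteOrthogonalIdempotents e) (a : ℂ[X]) :
    ∑ k, sc a * C (e k) = sc a := by
  rw [← Finset.mul_sum, ← map_sum, he.complete, C_1, mul_one]

/-- A based point can be normalized by a scalar polynomial that is divisible by all the polynomials
`∏ⱼ (z - α_{kj})`. -/
theorem BasedPoint.exists_scalar_form (he : CompleteOrthogonalIdempotents e) (b : BasedPoint e)
    {γ : ℂ[X]} (hγ : γ.Monic) (hdvd : ∀ k, (∏ j, (X - C (b.α k j)) : ℂ[X]) ∣ γ)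
    (hl : b.l ≤ γ.natDegree) :
    ∃ P : DiffOp R, P.IsDarboux γ.natDegree ∧
      b.iotaTilde = mulRat (perp P.ker) (ratS (algebraMap ℂ[X] (RatFunc ℂ) γ)⁻¹) ∧
      b.normFun = ((fun w : ℂ × ℂ => (γ.eval w.2)⁻¹ • waveFun P w : ℂ × ℂ → R) : Mer R) := by
  choose q hq using hdvd
  have hgm : ∀ k, (∏ j, (X - C (b.α k j)) : ℂ[X]).Monic := fun k =>
    monic_prod_of_monic _ _ fun j _ => monic_X_sub_C _
  have hqm : ∀ k, (q k).Monic := fun k => (hgm k).of_mul_monic_left (hq k ▸ hγ)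
  have hqd : ∀ k, (q k).natDegree = γ.natDegree - b.l := fun k => by
    have h1 := congrArg natDegree (hq k)
    rw [(hgm k).natDegree_mul (hqm k), natDegree_prod_of_monic _ _ fun j _ => monic_X_sub_C _] at h1
    simp only [natDegree_X_sub_C, Finset.sum_const, Finset.card_univ, Fintype.card_fin,
      smul_eq_mul, mul_one] at h1
    omega
  -- The complementary factor of `g_α`. All q_k have degree deg γ - l, so c is monic although its
  -- e_k-components differ.
  set c : R[X] := ∑ k, sc (q k) * C (e k)
  have hcoeff : ∀ i, c.coeff i = ∑ k, (q k).coeff i • e k := fun i => by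
    simp only [c, finsetSum_coeff, coeff_mul_C, sc_apply, coeff_map, Algebra.smul_def]
  have hc1 : c.coeff (γ.natDegree - b.l) = 1 := by
    rw [hcoeff, ← he.complete]
    exact Finset.sum_congr rfl fun k _ => by rw [← hqd k, coeff_natDegree, hqm k, one_smul]
  have hc0 : ∀ j, γ.natDegree - b.l < j → c.coeff j = 0 := fun j hj => by
    rw [hcoeff]
    exact Finset.sum_eq_zero fun k _ => by
      rw [coeff_eq_zero_of_natDegree_lt (by rwa [hqd k]), zero_smul]
  have hgP : gPoly e b.α = ∑ k, sc (∏ j, (X - C (b.α k j))) * C (e k) := rfl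
  have hcg : c * gPoly e b.α = sc γ := by
    rw [hgP, sum_idempotent_mul he, ← sum_idempotent_const he γ]
    exact Finset.sum_congr rfl fun k _ => by rw [mul_comm (q k), ← hq k]
  have hgc : gPoly e b.α * c = sc γ := by
    rw [hgP, sum_idempotent_mul he, ← sum_idempotent_const he γ]
    exact Finset.sum_congr rfl fun k _ => by rw [← hq k]
  have hdarb := b.isDarboux.compConst hc1 hc0
  rw [Nat.add_sub_cancel' hl] at hdarb
  refine ⟨compConst b.P c, hdarb, mulRat_perp_eq hγ hcg hgc, ?_⟩
  refine Filter.Germ.coe_eq.mpr ?_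
  filter_upwards [waveFun_compConst b.P c,
    (eventually_eval_ne_zero hγ.ne_zero).prod_inr Filter.cofinite] with w hw hγw
  have hg : ∑ k, (∏ j, (w.2 - b.α k j)) • e k = evalS w.2 (gPoly e b.α) := by
    simp only [gPoly, map_sum, map_mul, evalS_map, evalS_C, eval_prod, eval_sub, eval_X, eval_C,
      Algebra.smul_def]
  rw [hg, hw, inverse_eq_of_mul (b := (γ.eval w.2)⁻¹ • evalS w.2 c), mul_smul_comm]
  · rw [mul_smul_comm, ← map_mul, hgc, evalS_sc, Algebra.algebraMap_eq_smul_one, smul_smul,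
      inv_mul_cancel₀ hγw, one_smul]
  · rw [smul_mul_assoc, ← map_mul, hcg, evalS_sc, Algebra.algebraMap_eq_smul_one, smul_smul,
      inv_mul_cancel₀ hγw, one_smul]

/-- A monic polynomial that is divisible by the exponent polynomials of two based points. -/
theorem exists_common_gamma {l l' : ℕ} (α : Fin m → Fin l → ℂ) (α' : Fin m → Fin l' → ℂ) :
    ∃ γ : ℂ[X], γ.Monic ∧ (∀ k, (∏ j, (X - C (α k j)) : ℂ[X]) ∣ γ) ∧
      (∀ k, (∏ j, (X - C (α' k j)) : ℂ[X]) ∣ γ) ∧ l ≤ γ.natDegree ∧ l' ≤ γ.natDegree := by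
  have hm : ∀ {l : ℕ} (α : Fin m → Fin l → ℂ), (∏ k, ∏ j, (X - C (α k j)) : ℂ[X]).Monic :=
    fun α => monic_prod_of_monic _ _ fun k _ => monic_prod_of_monic _ _ fun j _ => monic_X_sub_C _
  have hmm := (hm α).mul (hm α')
  -- The power of X secures the degree bounds even when m = 0 and the products are empty.
  refine ⟨X ^ (l + l') * ((∏ k, ∏ j, (X - C (α k j))) * ∏ k, ∏ j, (X - C (α' k j))),
    (monic_X_pow _).mul hmm, fun k => ?_, fun k => ?_, ?_, ?_⟩
  · exact ((Finset.dvd_prod_of_mem _ (Finset.mem_univ k)).mul_right _).mul_left _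
  · exact ((Finset.dvd_prod_of_mem (fun k => ∏ j, (X - C (α' k j))) (Finset.mem_univ k)).mul_left
      _).mul_left _
  all_goals
    rw [(monic_X_pow _).natDegree_mul hmm, natDegree_X_pow]
    omega

omit [Module.Finite ℂ R] in
theorem mulRat_injective {γ : ℂ[X]} (hγ : γ ≠ 0) {N N' : Submodule R R[X]}
    (h : mulRat N (ratS (algebraMap ℂ[X] (RatFunc ℂ) γ)⁻¹) =
      mulRat N' (ratS (algebraMap ℂ[X] (RatFunc ℂ) γ)⁻¹)) : N = N' := by
  have key : ∀ p (N : Submodule R R[X]),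
      p ∈ N ↔ polyToRat R p * ratS (algebraMap ℂ[X] (RatFunc ℂ) γ)⁻¹ ∈
        mulRat N (ratS (algebraMap ℂ[X] (RatFunc ℂ) γ)⁻¹) := fun p N => by
    rw [mem_mulRat]
    refine ⟨fun hp => ⟨p, hp, rfl⟩, ?_⟩
    rintro ⟨q, hq, h⟩
    have h1 := congrArg (fun t => t * ratP γ) h
    simp only [mul_assoc, ratS_inv_mul hγ, mul_one] at h1
    rwa [← polyToRat_injective h1]
  ext p
  rw [key p N, key p N', h]

/-- The normalized function and the point of the rational Grassmannian determine each other. -/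
theorem BasedPoint.normFun_eq_iff (he : CompleteOrthogonalIdempotents e) (b b' : BasedPoint e) :
    b.normFun = b'.normFun ↔ b.iotaTilde = b'.iotaTilde := by
  -- A common γ gives both operators the same order and the same invertible scalar factor.
  obtain ⟨γ, hγ, h1, h2, h3, h4⟩ := exists_common_gamma b.α b'.α
  obtain ⟨P, hP, hPι, hPn⟩ := b.exists_scalar_form he hγ h1 h3
  obtain ⟨P', hP', hPι', hPn'⟩ := b'.exists_scalar_form he hγ h2 h4
  rw [hPι, hPn, hPι', hPn']
  constructor
  · intro h
    have hPP : P = P' := by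
      refine eq_of_waveFun ?_
      filter_upwards [Filter.Germ.coe_eq.mp h,
        (eventually_eval_ne_zero hγ.ne_zero).prod_inr Filter.cofinite] with w hw hγw
      exact smul_right_injective R (inv_ne_zero hγw) hw
    rw [hPP]
  · intro h
    rw [hP.eq_of_ker_eq hP' (hP.ker_eq_of_perp_eq hP' (mulRat_injective hγ.ne_zero h))]

end Algebra

/-! ### Kernels of surjections onto projective modules -/

/-- A section σ of φ makes σφ a projection with the same kernel. -/
theorem isComplemented_ker {A Y Z : Type*} [Ring A] [AddCommGroup Y] [Module A Y] [AddCommGroup Z]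
    [Module A Z] [Module.Projective A Z] (φ : Y →ₗ[A] Z) (hφ : Function.Surjective φ) :
    IsComplemented (LinearMap.ker φ) := by
  obtain ⟨σ, hσ⟩ := Module.projective_lifting_property φ LinearMap.id hφ
  have hσ' : ∀ z, φ (σ z) = z := fun z => LinearMap.congr_fun hσ z
  have hid : IsIdempotentElem (σ ∘ₗ φ) := LinearMap.ext fun y => by
    simp only [Module.End.mul_apply, LinearMap.comp_apply, hσ']
  have hker : LinearMap.ker (σ ∘ₗ φ) = LinearMap.ker φ :=
    LinearMap.ker_comp_of_ker_eq_bot _ (LinearMap.ker_eq_bot.mpr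
      (Function.LeftInverse.injective hσ'))
  exact ⟨_, hker ▸ (LinearMap.IsIdempotentElem.isCompl hid).symm⟩

theorem exists_prod_equiv_of_surjective {A Y Z : Type*} [Ring A] [AddCommGroup Y] [Module A Y]
    [AddCommGroup Z] [Module A Z] [Module.Projective A Z] (φ : Y →ₗ[A] Z)
    (hφ : Function.Surjective φ) : Nonempty ((LinearMap.ker φ × Z) ≃ₗ[A] Y) := by
  obtain ⟨σ, hσ⟩ := Module.projective_lifting_property φ LinearMap.id hφ
  have hσ' : ∀ z, φ (σ z) = z := fun z => LinearMap.congr_fun hσ z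
  refine ⟨LinearEquiv.ofBijective ((LinearMap.ker φ).subtype.coprod σ) ⟨?_, fun y => ?_⟩⟩
  · rw [injective_iff_map_eq_zero]
    rintro ⟨k, z⟩ h
    rw [LinearMap.coprod_apply] at h
    have hk : φ (k : Y) = 0 := k.2
    have h1 := congrArg φ h
    simp only [map_add, hσ', Submodule.subtype_apply, hk, zero_add, map_zero] at h1
    subst h1
    simp only [map_zero, add_zero, Submodule.subtype_apply] at h
    exact Prod.ext (Subtype.ext h) rfl
  · refine ⟨(⟨y - σ (φ y), ?_⟩, φ y), ?_⟩
    · rw [LinearMap.mem_ker, map_sub, hσ', sub_self]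
    · simp

section Algebra

variable {R : Type*} [Ring R] [Algebra ℂ R]

/-! ### Points of the rational Grassmannian -/

/-- Division with remainder by a scalar monic polynomial. -/
def divEquivFun (h : ℂ[X]) : (R[X] × (Fin h.natDegree → R)) →ₗ[R] R[X] :=
  (LinearMap.toSpanSingleton R[X] R[X] (sc h)).restrictScalars R |>.coprod
    (Fintype.linearCombination R fun i : Fin h.natDegree => (X : R[X]) ^ (i : ℕ))

theorem divEquivFun_apply (h : ℂ[X]) (p : R[X]) (s : Fin h.natDegree → R) :
    divEquivFun h (p, s) = p * sc h + ∑ i, s i • X ^ (i : ℕ) := by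
  simp [divEquivFun, Fintype.linearCombination_apply]

theorem degree_sum_smul_X_pow_lt {n : ℕ} (s : Fin n → R) :
    (∑ i, s i • (X : R[X]) ^ (i : ℕ)).degree < n := by
  refine (degree_sum_le _ _).trans_lt ((Finset.sup_lt_iff (WithBot.bot_lt_coe _)).mpr fun i _ => ?_)
  refine (degree_smul_le _ _).trans_lt ((degree_X_pow_le _).trans_lt ?_)
  exact_mod_cast i.2

theorem coeff_sum_smul_X_pow {n : ℕ} (s : Fin n → R) (i : Fin n) :
    (∑ i, s i • (X : R[X]) ^ (i : ℕ)).coeff i = s i := by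
  simp only [finsetSum_coeff, coeff_smul, coeff_X_pow, Fin.val_inj, smul_eq_mul, mul_ite, mul_one,
    mul_zero, Finset.sum_ite_eq, Finset.mem_univ, if_true]

theorem divEquivFun_bijective {h : ℂ[X]} (hh : h.Monic) :
    Function.Bijective (divEquivFun (R := R) h) := by
  rcases subsingleton_or_nontrivial R with hR | hR
  · exact ⟨fun _ _ _ => Subsingleton.elim _ _, fun y => ⟨0, Subsingleton.elim _ _⟩⟩
  have hm : (sc h : R[X]).Monic := hh.map _
  have hdeg : (sc h : R[X]).degree = h.natDegree := by
    rw [degree_eq_natDegree hm.ne_zero, sc_apply, hh.natDegree_map]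
  constructor
  · rw [injective_iff_map_eq_zero]
    rintro ⟨p, s⟩ hps
    rw [divEquivFun_apply, sc_apply, ← map_mul_comm, ← sc_apply, add_comm] at hps
    obtain ⟨h1, h2⟩ := div_modByMonic_unique p _ hm ⟨hps, hdeg ▸ degree_sum_smul_X_pow_lt s⟩
    rw [zero_divByMonic] at h1
    rw [zero_modByMonic] at h2
    refine Prod.ext h1.symm (_root_.funext fun i => ?_)
    change s i = 0
    rw [← coeff_sum_smul_X_pow s i, ← h2, coeff_zero]
  · intro y
    refine ⟨(y /ₘ sc h, fun i => (y %ₘ sc h).coeff i), ?_⟩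
    rw [divEquivFun_apply]
    conv_rhs => rw [← modByMonic_add_div y (sc h), sc_apply, map_mul_comm, ← sc_apply, add_comm]
    congr 1
    have hlt := degree_modByMonic_lt y hm
    rw [hdeg] at hlt
    ext j
    by_cases hj : j < h.natDegree
    · exact coeff_sum_smul_X_pow _ ⟨j, hj⟩
    · have hj' : (h.natDegree : WithBot ℕ) ≤ j := by exact_mod_cast not_lt.mp hj
      rw [coeff_eq_zero_of_degree_lt ((degree_sum_smul_X_pow_lt _).trans_le hj'),
        coeff_eq_zero_of_degree_lt (hlt.trans_le hj')]

/-- `R[z] ≅ R[z] × Rⁿ`. -/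
def divEquiv {h : ℂ[X]} (hh : h.Monic) : (R[X] × (Fin h.natDegree → R)) ≃ₗ[R] R[X] :=
  LinearEquiv.ofBijective (divEquivFun h) (divEquivFun_bijective hh)

/-- The kernel of a surjection `R[z] → Rⁿ` that contains the multiples of a scalar polynomial is a
free module. -/
theorem free_ker {n : ℕ} (W : R[X] →ₗ[R] (Fin n → R)) (hW : Function.Surjective W) {h : ℂ[X]}
    (hh : h.Monic) (hWh : ∀ p, W (p * sc h) = 0) : Module.Free R (LinearMap.ker W) := by
  set w : (Fin h.natDegree → R) →ₗ[R] (Fin n → R) :=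
    W ∘ₗ (divEquiv hh).toLinearMap ∘ₗ LinearMap.inr R R[X] _
  have hΘ : ∀ p s, W (divEquiv hh (p, s)) = w s := fun p s => by
    change W (divEquivFun h (p, s)) = W (divEquivFun h (0, s))
    rw [divEquivFun_apply, divEquivFun_apply, zero_mul, map_add, map_add, hWh, map_zero]
  have hw : Function.Surjective w := fun v => by
    obtain ⟨y, rfl⟩ := hW v
    obtain ⟨⟨p, s⟩, rfl⟩ := (divEquiv hh).surjective y
    exact ⟨s, (hΘ p s).symm⟩
  have hker : (LinearMap.ker W).comap (divEquiv hh).toLinearMap =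
      (⊤ : Submodule R R[X]).prod (LinearMap.ker w) := by
    ext ⟨p, s⟩
    simp only [Submodule.mem_comap, LinearMap.mem_ker, Submodule.mem_prod, Submodule.mem_top,
      true_and]
    exact Eq.congr_left (hΘ p s)
  obtain ⟨e₁⟩ := exists_prod_equiv_of_surjective w hw
  have hX := monic_X_pow (R := ℂ) n
  have hXn : (X ^ n : ℂ[X]).natDegree = n := natDegree_X_pow n
  have e₂ : (R[X] × (Fin n → R)) ≃ₗ[R] R[X] := hXn ▸ divEquiv (R := R) hX
  have e₃ : ((⊤ : Submodule R R[X]).prod (LinearMap.ker w)) ≃ₗ[R] LinearMap.ker W :=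
    hker ▸ (divEquiv hh).ofSubmodule' (LinearMap.ker W)
  have e₅ : ((⊤ : Submodule R R[X]).prod (LinearMap.ker w)) ≃ₗ[R] (R[X] × LinearMap.ker w) :=
    { toFun := fun x => (x.1.1, ⟨x.1.2, x.2.2⟩)
      map_add' := fun _ _ => rfl
      map_smul' := fun _ _ => rfl
      invFun := fun y => ⟨(y.1, y.2), ⟨trivial, y.2.2⟩⟩
      left_inv := fun _ => rfl
      right_inv := fun _ => rfl }
  -- With N = deg h, ker W ≅ R[z] × ker w, where ker w is only known to satisfy ker w × Rⁿ ≅ R^N.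
  -- Writing R[z] ≅ R[z] × Rⁿ supplies the missing Rⁿ.
  have e₄ : (R[X] × (Fin h.natDegree → R)) ≃ₗ[R] LinearMap.ker W :=
    ((LinearEquiv.refl R R[X]).prodCongr e₁.symm).trans <|
    ((LinearEquiv.refl R R[X]).prodCongr (LinearEquiv.prodComm R _ _)).trans <|
    (LinearEquiv.prodAssoc R _ _ _).symm.trans <|
    (e₂.prodCongr (LinearEquiv.refl R _)).trans <|
    e₅.symm.trans e₃
  exact Module.Free.of_equiv e₄

theorem mulRat_eq_map (N : Submodule R R[X]) (c : RatR R) :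
    mulRat N c = N.map (LinearMap.mulRight R c ∘ₗ polyToRat R) := by
  rw [mulRat, Submodule.map_comp]

/-- V^⊥ is the kernel of a surjection R[z] → R^{deg γ} that vanishes on multiples of h. Dividing by
γ identifies R[z] with γ⁻¹R[z], and the surjection then gives both the quotient and its splitting
modulo h R[z]. -/
theorem mulRat_mem_GrRat [Module.Finite ℂ R] {P : DiffOp R} {γ : ℂ[X]} (hγ : γ.Monic)
    (hP : P.IsDarboux γ.natDegree) :
    mulRat (perp P.ker) (ratS (algebraMap ℂ[X] (RatFunc ℂ) γ)⁻¹) ∈ GrRat R := by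
  obtain ⟨F, q, hF, hFq, hexp⟩ := hP.exists_dual
  obtain ⟨-, h, -, hh, hker, -⟩ := hP.jets
  set W : R[X] →ₗ[R] (Fin γ.natDegree → R) := LinearMap.pi fun j => wilson (F j)
  have hWker : perp P.ker = LinearMap.ker W := by
    ext p
    rw [mem_perp, LinearMap.mem_ker]
    refine ⟨fun hp => _root_.funext fun j => hp _ (hF j), fun hp f hf => ?_⟩
    rw [hexp f hf, wilson_sum]
    refine Finset.sum_eq_zero fun j _ => ?_
    rw [wilson_op_smul, show wilson (F j) p = 0 from congrFun hp j, smul_zero]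
  have hW : Function.Surjective W := fun v => by
    refine ⟨∑ s, v s • q s, _root_.funext fun j => ?_⟩
    change wilson (F j) _ = _
    simp only [map_sum, map_smul, hFq, smul_eq_mul, mul_ite, mul_one, mul_zero,
      Finset.sum_ite_eq', Finset.mem_univ, if_true]
  have hWh : ∀ p, W (p * sc h) = 0 := fun p => _root_.funext fun j => by
    change wilson (F j) _ = 0
    rw [← wilson_opOf, hker _ (hF j), wilson_eq, map_zero, map_zero]
  set ψ : R[X] →ₗ[R] RatR R :=
    LinearMap.mulRight R (ratS (algebraMap ℂ[X] (RatFunc ℂ) γ)⁻¹) ∘ₗ polyToRat R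
  have hψ : Function.Injective ψ := fun p p' hpp => by
    have h1 := congrArg (fun t => t * ratP γ) hpp
    simp only [ψ, LinearMap.comp_apply, LinearMap.mulRight_apply, mul_assoc,
      ratS_inv_mul hγ.ne_zero, mul_one] at h1
    exact polyToRat_injective h1
  rw [mulRat_eq_map, hWker]
  have hfree := free_ker W hW hh hWh
  refine ⟨Module.Free.of_equiv (Submodule.equivMapOfInjective ψ hψ (LinearMap.ker W)), h, γ,
    hh.ne_zero, hγ.ne_zero, ?_⟩
  have hG : scalarMul R (algebraMap ℂ[X] (RatFunc ℂ) γ)⁻¹ = LinearMap.range ψ := by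
    rw [LinearMap.range_eq_map]
    exact mulRat_eq_map _ _
  intro H G
  have hHM : H ≤ (LinearMap.ker W).map ψ := by
    intro a ha
    obtain ⟨p, -, rfl⟩ := mem_mulRat.mp ha
    -- The extra γ cancels the denominator, and the factor h puts the element in the kernel.
    refine ⟨p * sc γ * sc h, hWh _, ?_⟩
    simp only [ψ, LinearMap.comp_apply, LinearMap.mulRight_apply, polyToRat_mul]
    rw [← ratP_eq, ← ratP_eq, mul_assoc, mul_assoc, ratS_comm _ (ratP h * _), mul_assoc,
      ratS_inv_mul hγ.ne_zero, mul_one]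
    rfl
  have hMG : (LinearMap.ker W).map ψ ≤ G := by
    change _ ≤ scalarMul R _
    rw [hG]
    exact LinearMap.map_le_range
  set e : R[X] ≃ₗ[R] G := (LinearEquiv.ofInjective ψ hψ).trans (LinearEquiv.ofEq _ _ hG.symm)
  have he : ∀ p, (e p : RatR R) = ψ p := fun p => rfl
  set φ : G →ₗ[R] (Fin γ.natDegree → R) := W ∘ₗ e.symm.toLinearMap
  have hφ : Function.Surjective φ := hW.comp e.symm.surjective
  have hφker : LinearMap.ker φ = ((LinearMap.ker W).map ψ).submoduleOf G := by
    ext y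
    obtain ⟨p, rfl⟩ := e.surjective y
    change W (e.symm (e p)) = 0 ↔ (e p : RatR R) ∈ (LinearMap.ker W).map ψ
    rw [e.symm_apply_apply, he]
    exact ⟨fun hp => ⟨p, hp, rfl⟩, fun ⟨p', hp', h⟩ => hψ h ▸ hp'⟩
  refine ⟨hHM, hMG, ?_, ⟨Module.Basis.ofEquivFun
    ((Submodule.quotEquivOfEq _ _ hφker.symm).trans (φ.quotKerEquivOfSurjective hφ))⟩⟩
  have hle : H.submoduleOf G ≤ LinearMap.ker φ := hφker ▸ Submodule.comap_mono hHM
  have hsurj : Function.Surjective ((H.submoduleOf G).liftQ φ hle) := fun v => by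
    obtain ⟨y, hy⟩ := hφ v
    exact ⟨(H.submoduleOf G).mkQ y, hy⟩
  have hcompl := isComplemented_ker _ hsurj
  rwa [Submodule.ker_liftQ, hφker] at hcompl

theorem BasedPoint.iotaTilde_mem [Module.Finite ℂ R] {m : ℕ} {e : Fin m → R}
    (he : CompleteOrthogonalIdempotents e) (b : BasedPoint e) : b.iotaTilde ∈ GrRat R := by
  obtain ⟨γ, hγ, h1, -, h3, -⟩ := exists_common_gamma b.α b.α
  obtain ⟨P, hP, hPι, -⟩ := b.exists_scalar_form he hγ h1 h3
  rw [hPι]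
  exact mulRat_mem_GrRat hγ hP

end Algebra

section Algebra

variable {R : Type*} [Ring R] [Algebra ℂ R]

/-! ### Primitive idempotents -/

/-- The corner ring of a primitive idempotent of a finite dimensional algebra is local: its
elements are nilpotent or invertible. -/
theorem IsPrimitiveIdempotent.isNilpotent_or_isUnit [Module.Finite ℂ R] {e : R}
    (he : IsPrimitiveIdempotent e) {a : R} (hl : e * a = a) (hr : a * e = a) :
    IsNilpotent a ∨ IsUnit (1 - e + a) := by
  have hid : e * e = e := he.1
  obtain ⟨q, hq, hqa⟩ := (Algebra.IsIntegral.isIntegral (R := ℂ) a : IsIntegral ℂ a)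
  obtain ⟨ν, hν, hdvd⟩ := Polynomial.exists_eq_pow_rootMultiplicity_mul_and_not_dvd q hq.ne_zero 0
  set k := q.rootMultiplicity 0
  rw [map_zero, sub_zero] at hν hdvd
  -- The exponent k + 1 instead of k makes ε below a multiple of a, hence an element of the corner,
  -- even if k = 0.
  have hν0 : aeval a (X ^ (k + 1) * ν) = 0 := by
    rw [pow_succ', mul_assoc, ← hν, map_mul, show aeval a q = 0 from hqa, mul_zero]
  have hcop : IsCoprime (X ^ (k + 1) : ℂ[X]) ν :=
    ((Polynomial.irreducible_X.coprime_iff_not_dvd.mpr hdvd)).pow_left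
  obtain ⟨s, t, hst⟩ := hcop
  -- Fitting's idempotent: a is nilpotent where ε vanishes and invertible where ε is the identity.
  -- Primitivity leaves only ε = 0 and ε = e.
  set ε : R := aeval a (s * X ^ (k + 1)) with hε
  have hεt : 1 - ε = aeval a (t * ν) := by
    rw [hε, ← map_one (aeval (R := ℂ) a), ← map_sub, ← hst]; congr 1; ring
  have hεid : ε * ε = ε := by
    have : ε * (1 - ε) = 0 := by
      rw [hεt, hε, ← map_mul, show s * X ^ (k + 1) * (t * ν) = s * t * (X ^ (k + 1) * ν) by ring,
        map_mul, hν0, mul_zero]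
    rw [mul_sub, mul_one, sub_eq_zero] at this
    exact this.symm
  have hε1 : ε = aeval a (s * X ^ k) * a := by
    rw [hε, pow_succ, ← mul_assoc, map_mul _ _ X, aeval_X]
  have hε2 : ε = a * aeval a (s * X ^ k) := by
    rw [hε, pow_succ', mul_left_comm, map_mul _ X, aeval_X]
  have hεr : ε * e = ε := by rw [hε1, mul_assoc, hr]
  have hεl : e * ε = ε := by rw [hε2, ← mul_assoc, hl]
  rcases he.2.2 ε (e - ε) hεid (by
      change (e - ε) * (e - ε) = e - ε
      rw [mul_sub, sub_mul, sub_mul, hid, hεl, hεr, hεid]; abel)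
      (by rw [mul_sub, hεr, hεid, sub_self]) (by rw [sub_mul, hεl, hεid, sub_self]) (by abel)
    with h | h
  · left
    refine ⟨k + 1, ?_⟩
    have h1 : aeval a (t * ν) = 1 := by rw [← hεt, h, sub_zero]
    rw [← mul_one (a ^ (k + 1)), ← h1, show a ^ (k + 1) = aeval a (X ^ (k + 1) : ℂ[X]) by simp,
      ← map_mul, mul_left_comm, map_mul, hν0, mul_zero]
  · right
    have hee : ε = e := (sub_eq_zero.mp h).symm
    rw [hee] at hε1 hε2
    set b := aeval a (s * X ^ k)
    have hb : e * b = b * e := by rw [hε1, mul_assoc, ← hε2, ← hε1]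
    have hbe : a * (e * b) = e := by rw [← mul_assoc, hr, ← hε2]
    have hbe' : e * b * a = e := by rw [mul_assoc, ← hε1, hid]
    have hbe3 : e * b * e = e * b := by rw [mul_assoc, ← hb, ← mul_assoc, hid]
    have hbe4 : e * (e * b) = e * b := by rw [← mul_assoc, hid]
    refine ⟨⟨1 - e + a, 1 - e + e * b, ?_, ?_⟩, rfl⟩
    · simp only [mul_add, add_mul, sub_mul, mul_sub, mul_one, one_mul, hid, hbe, hr, hbe4]; abel
    · simp only [mul_add, add_mul, sub_mul, mul_sub, mul_one, one_mul, hid, hbe', hl, hbe3]; abel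

/-- In a local ring a unit sum has a unit summand. A corner element u is a unit of eRe when 1 - e +
u is a unit of R. After dividing by the sum, either the chosen summand is a unit, or it is nilpotent
and the rest is a unit. -/
theorem IsPrimitiveIdempotent.exists_isUnit_of_sum_corner [Module.Finite ℂ R] {e : R}
    (he : IsPrimitiveIdempotent e) {ι : Type*} (s : Finset ι) (u : ι → R)
    (hl : ∀ i, e * u i = u i) (hr : ∀ i, u i * e = u i)
    (hu : IsUnit (1 - e + ∑ i ∈ s, u i)) : ∃ i ∈ s, IsUnit (1 - e + u i) := by
  classical
  have hid : e * e = e := he.1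
  induction s using Finset.induction_on with
  | empty =>
    rw [Finset.sum_empty, add_zero] at hu
    exact absurd (hu.mul_right_eq_zero.mp (by rw [sub_mul, one_mul, hid, sub_self])) he.2.1
  | insert a s ha ih =>
    rw [Finset.sum_insert ha] at hu
    obtain ⟨T, hT⟩ := hu
    set S := ∑ i ∈ s, u i
    have hSl : e * S = S := by rw [Finset.mul_sum]; exact Finset.sum_congr rfl fun i _ => hl i
    have hSr : S * e = S := by rw [Finset.sum_mul]; exact Finset.sum_congr rfl fun i _ => hr i
    set w : R := ↑T⁻¹
    have h1 : (T : R) * (1 - e) = 1 - e := by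
      rw [hT]
      simp only [add_mul, sub_mul, mul_sub, mul_one, one_mul, hid, hr, hSr]; abel
    have h1' : (1 - e) * (T : R) = 1 - e := by
      rw [hT]
      simp only [mul_add, sub_mul, mul_sub, mul_one, one_mul, hid, hl, hSl]; abel
    have h2 : w * (1 - e) = 1 - e := by rw [← h1, ← mul_assoc, T.inv_mul, one_mul, h1]
    have h2' : (1 - e) * w = 1 - e := by rw [← h1', mul_assoc, T.mul_inv, mul_one, h1']
    have h3 : w * u a + w * S = e := by
      have : w * (T : R) = 1 := T.inv_mul
      rw [hT, mul_add, h2, mul_add] at this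
      rw [← sub_eq_zero]; rw [← sub_eq_zero] at this; rw [← this]; abel
    have h4 : e * (w * u a) = w * u a := by
      have h5 : e * w = w - (1 - e) := by rw [← h2', sub_mul, one_mul]; abel
      rw [← mul_assoc, h5, sub_mul, sub_mul, one_mul, hl]; abel
    rcases he.isNilpotent_or_isUnit h4 (by rw [mul_assoc, hr]) with h | h
    · have h6 : IsUnit (w * (1 - e + S)) := by
        have := h.isUnit_one_sub
        rwa [show 1 - w * u a = w * (1 - e + S) by rw [mul_add, h2, ← h3]; abel] at this
      obtain ⟨i, hi, h7⟩ := ih (by simpa [w] using h6)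
      exact ⟨i, Finset.mem_insert_of_mem hi, h7⟩
    · refine ⟨a, Finset.mem_insert_self a s, ?_⟩
      rw [show 1 - e + w * u a = w * (1 - e + u a) by rw [mul_add, h2]] at h
      simpa [w] using h

/-- The part n = (1 - e) cᵢ outside the corner is square zero, and 1 - e + cᵢ = (1 - e + e cᵢ)(1 +
n). -/
theorem IsPrimitiveIdempotent.exists_isUnit_of_sum [Module.Finite ℂ R] {e : R}
    (he : IsPrimitiveIdempotent e) {ι : Type*} (s : Finset ι) (c : ι → R)
    (hr : ∀ i, c i * e = c i) (hc : ∑ i ∈ s, c i = e) : ∃ i ∈ s, IsUnit (1 - e + c i) := by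
  have hid : e * e = e := he.1
  obtain ⟨i, hi, h⟩ := he.exists_isUnit_of_sum_corner s (fun i => e * c i)
    (fun i => by rw [← mul_assoc, hid]) (fun i => by rw [mul_assoc, hr])
    (by rw [← Finset.mul_sum, hc, hid, sub_add_cancel]; exact isUnit_one)
  refine ⟨i, hi, ?_⟩
  set n := (1 - e) * c i with hn
  have hen : e * n = 0 := by rw [hn, ← mul_assoc, mul_sub, hid, mul_one, sub_self, zero_mul]
  have hcn : c i * n = 0 := by
    rw [hn, ← mul_assoc, mul_sub, hr, mul_one, sub_self, zero_mul]
  have hnn : n ^ 2 = 0 := by rw [sq]; nth_rw 1 [hn]; rw [mul_assoc, hcn, mul_zero]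
  have h1 : (1 - e + e * c i) * (1 + n) = 1 - e + c i := by
    rw [mul_add, mul_one, add_mul, sub_mul, one_mul, hen, mul_assoc, hcn, hn, sub_mul]
    simp only [one_mul, mul_zero]; abel
  rw [← h1]
  exact h.mul (IsNilpotent.isUnit_one_add ⟨2, hnn⟩)

/-! ### Exchanging basis vectors -/

theorem sum_smul_update {S M ι : Type*} [Ring S] [AddCommGroup M] [Module S M] [Fintype ι]
    [DecidableEq ι] (f : ι → M) (c d : ι → S) (j : ι) :
    ∑ i, d i • Function.update f j (∑ i, c i • f i) i =
      ∑ i, (Function.update d j 0 i + d j * c i) • f i := by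
  have h1 : ∀ i, d i • Function.update f j (∑ i, c i • f i) i =
      Function.update d j 0 i • f i + if i = j then d j • ∑ i, c i • f i else 0 := by
    intro i
    by_cases h : i = j
    · subst h; simp
    · simp [h]
  simp only [h1, Finset.sum_add_distrib, Finset.sum_ite_eq', Finset.mem_univ, if_true, add_smul,
    Finset.smul_sum, mul_smul]

theorem linearIndependent_update {S M ι : Type*} [Ring S] [AddCommGroup M] [Module S M] [Fintype ι]
    [DecidableEq ι] {f : ι → M} (hf : LinearIndependent S f) (c : ι → S) {j : ι}
    (hc : IsUnit (c j)) : LinearIndependent S (Function.update f j (∑ i, c i • f i)) := by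
  rw [Fintype.linearIndependent_iff] at hf ⊢
  intro d hd
  rw [sum_smul_update] at hd
  have h := hf _ hd
  have hj : d j = 0 := by
    have := h j
    rw [Function.update_self, zero_add] at this
    exact hc.mul_left_eq_zero.mp this
  intro i
  by_cases hij : i = j
  · rw [hij, hj]
  · simpa [hij, hj] using h i

theorem span_range_update {S M ι : Type*} [Ring S] [AddCommGroup M] [Module S M] [Fintype ι]
    [DecidableEq ι] (f : ι → M) (c : ι → S) {j : ι} (hc : IsUnit (c j)) :
    Submodule.span S (Set.range (Function.update f j (∑ i, c i • f i))) =
      Submodule.span S (Set.range f) := by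
  have hmem : ∀ i, i ≠ j →
      f i ∈ Submodule.span S (Set.range (Function.update f j (∑ i, c i • f i))) := fun i hi =>
    Submodule.subset_span ⟨i, by simp [hi]⟩
  apply le_antisymm
  · rw [Submodule.span_le]
    rintro _ ⟨i, rfl⟩
    by_cases hij : i = j
    · subst hij
      rw [Function.update_self]
      exact Submodule.sum_mem _ fun k _ => Submodule.smul_mem _ _ (Submodule.subset_span ⟨k, rfl⟩)
    · rw [Function.update_of_ne hij]
      exact Submodule.subset_span ⟨i, rfl⟩
  · rw [Submodule.span_le]
    rintro _ ⟨i, rfl⟩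
    by_cases hij : i = j
    · subst hij
      obtain ⟨u, hu⟩ := hc
      have h1 : c i • f i ∈ Submodule.span S
          (Set.range (Function.update f i (∑ i, c i • f i))) := by
        have h2 := Finset.add_sum_erase Finset.univ (fun k => c k • f k) (Finset.mem_univ i)
        rw [← eq_sub_iff_add_eq] at h2
        rw [h2]
        refine Submodule.sub_mem _ (Submodule.subset_span ⟨i, by simp⟩) (Submodule.sum_mem _ ?_)
        exact fun k hk => Submodule.smul_mem _ _ (hmem k (Finset.ne_of_mem_erase hk))
      have h3 := Submodule.smul_mem _ (↑u⁻¹ : S) h1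
      rwa [← hu, smul_smul, u.inv_mul, one_smul] at h3
    · exact hmem i hij

/-! ### Adapted bases -/

theorem toQR_single (α : ℂ) (p : R[X]) :
    QP.toQR (Finsupp.single α p) = Finsupp.single α (polyToRat R p) := by
  simp [QP.toQR]

/-- Differential operators respect the decomposition by exponents. -/
theorem act_single (P : DiffOp R) (α : ℂ) (v : QR R) :
    P.act (Finsupp.single α (v α)) = Finsupp.single α (P.act v α) := by
  classical
  have hD : ∀ v : QR R, dQR R (Finsupp.single α (v α)) = Finsupp.single α (dQR R v α) := by
    intro v
    rw [dQR_single, dQR_apply]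
  have hDk : ∀ (k : ℕ) (v : QR R),
      (dQR R ^ k) (Finsupp.single α (v α)) = Finsupp.single α ((dQR R ^ k) v α) := by
    intro k
    induction k with
    | zero => intro v; simp
    | succ k ih =>
      intro v
      rw [pow_succ', Module.End.mul_apply, ih, hD, Module.End.mul_apply]
  rw [DiffOp.act, Finsupp.sum, LinearMap.sum_apply, LinearMap.sum_apply, Finsupp.finsetSum_apply,
    Finsupp.single_finsetSum]
  refine Finset.sum_congr rfl fun k _ => ?_
  rw [Module.End.mul_apply, hDk, Module.End.mul_apply]
  simp [leftMulQR]

/-- The kernel is graded by exponents because P preserves each of them. -/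
theorem single_mem_ker {P : DiffOp R} {f : QP R} (hf : f ∈ P.ker) (α : ℂ) :
    (Finsupp.single α (f α) : QP R) ∈ P.ker := by
  have h0 : P.act f.toQR = 0 := hf
  change P.act (QP.toQR (Finsupp.single α (f α))) = 0
  rw [toQR_single, ← toQR_apply, act_single, h0]
  simp

theorem op_smul_op_smul (a b : R) (f : QP R) :
    MulOpposite.op a • MulOpposite.op b • f = MulOpposite.op (b * a) • f := by
  rw [smul_smul, ← MulOpposite.op_mul]

/-- Any basis of the kernel can be made adapted one component at a time. -/
theorem exists_basis_of_components [Module.Finite ℂ R] {m l : ℕ} {e : Fin m → R}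
    (he : CompleteOrthogonalIdempotents e) (hprim : ∀ k, IsPrimitiveIdempotent (e k))
    {P : DiffOp R} (F : Fin l → QP R) (hF : LinearIndependent Rᵐᵒᵖ F)
    (hspan : Submodule.span Rᵐᵒᵖ (Set.range F) = P.ker) (s : Finset (Fin m × Fin l)) :
    ∃ v : Fin m → Fin l → QP R, (∀ k j, MulOpposite.op (e k) • v k j = v k j) ∧
      (∀ k j, (k, j) ∈ s → ∃ α p, v k j = Finsupp.single α p) ∧
      LinearIndependent Rᵐᵒᵖ (fun j => ∑ k, v k j) ∧
      Submodule.span Rᵐᵒᵖ (Set.range fun j => ∑ k, v k j) = P.ker := by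
  classical
  induction s using Finset.induction_on with
  | empty =>
    have hsum : (fun j => ∑ k, MulOpposite.op (e k) • F j) = F := by
      funext j
      rw [← Finset.sum_smul, ← Finset.op_sum, he.complete, MulOpposite.op_one, one_smul]
    refine ⟨fun k j => MulOpposite.op (e k) • F j, fun k j => ?_, by simp, ?_, ?_⟩
    · rw [op_smul_op_smul, (he.idem k).eq]
    · rwa [hsum]
    · rwa [hsum]
  | insert a s ha ih =>
    obtain ⟨k₀, j₀⟩ := a
    obtain ⟨v, hv, hs, hli, hsp⟩ := ih
    set f : Fin l → QP R := fun j => ∑ k, v k j with hf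
    have hfk : ∀ k j, MulOpposite.op (e k) • f j = v k j := by
      intro k j
      rw [hf, Finset.smul_sum, Finset.sum_eq_single k, hv]
      · intro i _ hik
        rw [← hv i, op_smul_op_smul, he.ortho hik, MulOpposite.op_zero, zero_smul]
      · simp
    have hvker : v k₀ j₀ ∈ P.ker := by
      rw [← hfk, ← hsp]
      exact Submodule.smul_mem _ _ (Submodule.subset_span ⟨j₀, rfl⟩)
    have hcoef : ∀ α, ∃ c : Fin l → R, Finsupp.single α (v k₀ j₀ α) =
        ∑ j, MulOpposite.op (c j) • f j := by
      intro α
      have := single_mem_ker hvker α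
      rw [← hsp, Submodule.mem_span_range_iff_exists_fun] at this
      obtain ⟨c, hc⟩ := this
      exact ⟨fun j => (c j).unop, by simpa using hc.symm⟩
    choose c hc using hcoef
    have hfix : ∀ α, MulOpposite.op (e k₀) • Finsupp.single α (v k₀ j₀ α) =
        (Finsupp.single α (v k₀ j₀ α) : QP R) := by
      intro α
      rw [Finsupp.smul_single]
      congr 1
      conv_rhs => rw [← hv]
      rfl
    have hc' : ∀ α, Finsupp.single α (v k₀ j₀ α) =
        ∑ j, MulOpposite.op (c α j * e k₀) • f j := by
      intro α
      rw [← hfix, hc, Finset.smul_sum]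
      simp only [op_smul_op_smul]
    -- The exponent components add up to f_{j₀} e_{k₀}, and coefficients in a basis are unique.
    have hsumc : ∑ α ∈ (v k₀ j₀).support, c α j₀ * e k₀ = e k₀ := by
      have h1 : ∑ j, (MulOpposite.op (∑ α ∈ (v k₀ j₀).support, c α j * e k₀) -
          if j = j₀ then MulOpposite.op (e k₀) else 0) • f j = 0 := by
        simp only [sub_smul, Finset.sum_sub_distrib, ite_smul, zero_smul, Finset.sum_ite_eq',
          Finset.mem_univ, if_true, hfk, Finset.op_sum, Finset.sum_smul]
        rw [Finset.sum_comm]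
        simp only [← hc']
        rw [sub_eq_zero]
        exact Finsupp.sum_single (v k₀ j₀)
      have h2 := Fintype.linearIndependent_iff.mp hli _ h1 j₀
      rw [if_pos rfl, sub_eq_zero] at h2
      exact MulOpposite.op_injective h2
    obtain ⟨α, -, hα⟩ := (hprim k₀).exists_isUnit_of_sum _ _
      (fun α => by rw [mul_assoc, (he.idem k₀).eq]) hsumc
    -- The coefficients of the new vector: f_{j₀}(1 - e_{k₀}) plus the chosen exponent component.
    -- Its j₀-th coefficient is the unit just found, so the exchange keeps a basis and alters only
    -- the (k₀, j₀) component.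
    set d : Fin l → Rᵐᵒᵖ := fun j => MulOpposite.op (c α j * e k₀) +
      if j = j₀ then MulOpposite.op (1 - e k₀) else 0 with hd
    have hdj : IsUnit (d j₀) := by
      rw [hd]
      simp only [if_true]
      rw [← MulOpposite.op_add, add_comm]
      exact hα.op
    set v' : Fin m → Fin l → QP R := fun k j =>
      if (k, j) = (k₀, j₀) then Finsupp.single α (v k₀ j₀ α) else v k j with hv'
    have hsum' : (fun j => ∑ k, v' k j) = Function.update f j₀ (∑ j, d j • f j) := by
      funext j
      by_cases hj : j = j₀
      · subst hj
        rw [Function.update_self, hd]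
        simp only [add_smul, Finset.sum_add_distrib, ite_smul, zero_smul, Finset.sum_ite_eq',
          Finset.mem_univ, if_true, ← hc', MulOpposite.op_sub, MulOpposite.op_one, sub_smul,
          one_smul, hfk]
        rw [← Finset.add_sum_erase _ _ (Finset.mem_univ k₀)]
        congr 1
        · simp [hv']
        · change _ = ∑ k, v k j - _
          rw [← Finset.add_sum_erase _ _ (Finset.mem_univ k₀), add_sub_cancel_left]
          refine Finset.sum_congr rfl fun k hk => ?_
          simp [hv', Finset.ne_of_mem_erase hk]
      · rw [Function.update_of_ne hj]
        simp [hv', hj, hf]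
    refine ⟨v', fun k j => ?_, fun k j hkj => ?_, ?_, ?_⟩
    · by_cases h : (k, j) = (k₀, j₀)
      · simp only [hv', if_pos h]
        rw [(Prod.mk.inj h).1]
        exact hfix α
      · simp only [hv', if_neg h, hv]
    · by_cases h : (k, j) = (k₀, j₀)
      · exact ⟨α, _, if_pos h⟩
      · obtain ⟨β, p, hβ⟩ := hs k j ((Finset.mem_insert.mp hkj).resolve_left h)
        exact ⟨β, p, by rw [← hβ]; exact if_neg h⟩
    · rw [hsum']
      exact linearIndependent_update hli d hdj
    · rw [hsum', span_range_update f d hdj, hsp]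

theorem DiffOp.IsDarboux.exists_adapted [Module.Finite ℂ R] {m l : ℕ} {e : Fin m → R}
    (he : CompleteOrthogonalIdempotents e) (hprim : ∀ k, IsPrimitiveIdempotent (e k))
    {P : DiffOp R} (hP : P.IsDarboux l) : ∃ (p : Fin m → Fin l → R[X]) (α : Fin m → Fin l → ℂ),
      LinearIndependent Rᵐᵒᵖ (adapted e p α) ∧
      Submodule.span Rᵐᵒᵖ (Set.range (adapted e p α)) = P.ker := by
  obtain ⟨F, q, hF, hdual, hexp⟩ := hP.exists_dual
  have hli : LinearIndependent Rᵐᵒᵖ F := by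
    rw [Fintype.linearIndependent_iff]
    intro c hc s
    have h1 : wilson (∑ j, c j • F j) (q s) = (c s).unop := by
      rw [wilson_sum, Finset.sum_eq_single s]
      · rw [← MulOpposite.op_unop (c s), wilson_op_smul, hdual]; simp
      · intro j _ hj
        rw [← MulOpposite.op_unop (c j), wilson_op_smul, hdual, if_neg hj.symm,
          MulOpposite.op_unop, smul_zero]
      · simp
    rw [hc] at h1
    rw [← MulOpposite.unop_inj, ← h1, wilson_eq, map_zero, map_zero]
    rfl
  have hspan : Submodule.span Rᵐᵒᵖ (Set.range F) = P.ker := by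
    refine le_antisymm (Submodule.span_le.mpr (Set.range_subset_iff.mpr hF)) fun f hf => ?_
    rw [hexp f hf]
    exact Submodule.sum_mem _ fun j _ => Submodule.smul_mem _ _ (Submodule.subset_span ⟨j, rfl⟩)
  obtain ⟨v, hv, hs, h1, h2⟩ := exists_basis_of_components he hprim F hli hspan Finset.univ
  choose α p hp using fun k j => hs k j (Finset.mem_univ _)
  have : adapted e p α = fun j => ∑ k, v k j := by
    funext j
    refine Finset.sum_congr rfl fun k _ => ?_
    rw [← hv, hp, Finsupp.smul_single, op_smul_poly]
  exact ⟨p, α, by rwa [this], by rwa [this]⟩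

theorem exists_basedPoint [Module.Finite ℂ R] {m : ℕ} {e : Fin m → R}
    (he : CompleteOrthogonalIdempotents e) (hprim : ∀ k, IsPrimitiveIdempotent (e k))
    (Φ : DecGrAd R) : ∃ b : BasedPoint e, b.point = Φ := by
  obtain ⟨_, P, l, hP, rfl⟩ := Φ
  obtain ⟨p, α, h1, h2⟩ := hP.exists_adapted he hprim
  exact ⟨⟨l, P, p, α, hP, h1, h2⟩, rfl⟩

end Algebra

section Algebra

variable {R : Type*} [Ring R] [Algebra ℂ R]

/-! ### Wronski matrices of adapted families -/

/-- The conjugate `exp(-αx) ∘ ∂ₓ ∘ exp(αx)` of the derivative. -/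
def twistD (α : ℂ) (p : R[X]) : R[X] := derivative p + α • p

theorem twistD_iterate_mul_C (α : ℂ) (i : ℕ) (p : R[X]) (r : R) :
    (twistD α)^[i] (p * C r) = (twistD α)^[i] p * C r := by
  induction i with
  | zero => rfl
  | succ i ih =>
    rw [Function.iterate_succ_apply', ih, Function.iterate_succ_apply', twistD, twistD,
      derivative_mul, derivative_C, mul_zero, add_zero, add_mul, smul_mul_assoc]

theorem D_pow_single (α : ℂ) (i : ℕ) (p : R[X]) :
    (D ^ i) (Finsupp.single α p : QP R) = Finsupp.single α ((twistD α)^[i] p) := by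
  induction i with
  | zero => rfl
  | succ i ih =>
    rw [pow_succ', Module.End.mul_apply, ih, D_single, Function.iterate_succ_apply', twistD]

variable {m l : ℕ} {e : Fin m → R}

/-- The polynomial factor of the `i`-th derivative of the `j`-th member of an adapted family. -/
def wronEntry (e : Fin m → R) (p : Fin m → Fin l → R[X]) (α : Fin m → Fin l → ℂ) (i : ℕ)
    (j : Fin l) : R[X] :=
  ∑ k, (twistD (α k j))^[i] (p k j * C (e k))

/-- The exponential factor `∑ₖ exp(α_{kj} x) e_k` of the `j`-th member of an adapted family. -/
def expPart (e : Fin m → R) (α : Fin m → Fin l → ℂ) (j : Fin l) : QP R :=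
  ∑ k, Finsupp.single (α k j) (C (e k))

/-- Orthogonality of the e_k sorts the products, so all derivatives of f_j share one exponential
factor on the right. -/
theorem D_pow_adapted (he : CompleteOrthogonalIdempotents e) (p : Fin m → Fin l → R[X])
    (α : Fin m → Fin l → ℂ) (i : ℕ) (j : Fin l) :
    (D ^ i) (adapted e p α j) = wronEntry e p α i j • expPart e α j := by
  rw [adapted, map_sum, expPart, Finset.smul_sum]
  refine Finset.sum_congr rfl fun k _ => ?_
  rw [D_pow_single, Finsupp.smul_single, smul_eq_mul, wronEntry, Finset.sum_mul,
    Finset.sum_eq_single k]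
  · rw [← twistD_iterate_mul_C, mul_assoc, ← C_mul, (he.idem k).eq]
  · intro k' _ hk
    rw [← twistD_iterate_mul_C, mul_assoc, ← C_mul, he.ortho hk, C_0, mul_zero]
    have h0 := twistD_iterate_mul_C (α k' j) i 0 (0 : R)
    rwa [C_0, mul_zero, mul_zero] at h0
  · simp

/-- The value of the exponential factor. -/
def expVal (e : Fin m → R) (α : Fin m → Fin l → ℂ) (x : ℂ) (j : Fin l) : R :=
  ∑ k, Complex.exp (α k j * x) • e k

theorem ev_expPart (α : Fin m → Fin l → ℂ) (x : ℂ) (j : Fin l) :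
    ev x (expPart e α j) = expVal e α x j := by
  simp only [expPart, map_sum, ev_single, evalS_C, expVal]

theorem expVal_mul_neg (he : CompleteOrthogonalIdempotents e) (α : Fin m → Fin l → ℂ) (x : ℂ)
    (j : Fin l) : expVal e α x j * expVal e (-α) x j = 1 := by
  rw [expVal, expVal, Finset.sum_mul_sum, ← he.complete]
  refine Finset.sum_congr rfl fun k _ => ?_
  rw [Finset.sum_eq_single k]
  · rw [smul_mul_smul_comm, (he.idem k).eq, ← Complex.exp_add]
    simp
  · intro k' _ hk
    rw [smul_mul_smul_comm, he.ortho hk.symm, smul_zero]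
  · simp

theorem expVal_neg_mul (he : CompleteOrthogonalIdempotents e) (α : Fin m → Fin l → ℂ) (x : ℂ)
    (j : Fin l) : expVal e (-α) x j * expVal e α x j = 1 := by
  have := expVal_mul_neg he (-α) x j
  rwa [neg_neg] at this

theorem ev_D_pow_adapted (he : CompleteOrthogonalIdempotents e) (p : Fin m → Fin l → R[X])
    (α : Fin m → Fin l → ℂ) (x : ℂ) (i : ℕ) (j : Fin l) :
    ev x ((D ^ i) (adapted e p α j)) = evalS x (wronEntry e p α i j) * expVal e α x j := by
  rw [D_pow_adapted he, ev_poly_smul, ev_expPart]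

/-- The matrix of polynomial factors of the Wronski matrix. -/
def wronMatrix (e : Fin m → R) (p : Fin m → Fin l → R[X]) (α : Fin m → Fin l → ℂ) :
    Matrix (Fin l) (Fin l) R[X] :=
  Matrix.of fun i j => wronEntry e p α i j

theorem wronskian_apply (F : Fin l → QP R) (x : ℂ) (i j : Fin l) :
    wronskian F x i j = ev x ((D ^ (i : ℕ)) (F j)) := by
  rw [Module.End.pow_apply]; rfl

theorem wronskian_adapted (he : CompleteOrthogonalIdempotents e) (p : Fin m → Fin l → R[X])
    (α : Fin m → Fin l → ℂ) (x : ℂ) :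
    wronskian (adapted e p α) x =
      (wronMatrix e p α).map (evalS x) * Matrix.diagonal (expVal e α x) := by
  ext i j
  rw [wronskian_apply, ev_D_pow_adapted he, Matrix.mul_diagonal, Matrix.map_apply, wronMatrix,
    Matrix.of_apply]

/-- The exponential factor is invertible at every x, so regularity of the values passes to the
polynomial factor at infinitely many points. -/
theorem wronMatrix_regular (he : CompleteOrthogonalIdempotents e) {p : Fin m → Fin l → R[X]}
    {α : Fin m → Fin l → ℂ} {s : Set ℂ} (hs : s.Infinite)
    (h : ∀ x ∈ s, ∀ y, wronskian (adapted e p α) x * y = 0 → y = 0)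
    (y : Matrix (Fin l) (Fin l) R[X]) (hy : wronMatrix e p α * y = 0) : y = 0 := by
  ext1 i j
  refine eq_zero_of_infinite_evalS _ hs fun x hx => ?_
  have h1 : (wronMatrix e p α).map (evalS x) * y.map (evalS x) = 0 := by
    rw [← Matrix.map_mul, hy, Matrix.map_zero _ (map_zero _)]
  have h2 := h x hx (Matrix.diagonal (expVal e (-α) x) * y.map (evalS x)) (by
    rw [wronskian_adapted he, Matrix.mul_assoc, ← Matrix.mul_assoc (Matrix.diagonal _),
      Matrix.diagonal_mul_diagonal]
    simp only [expVal_mul_neg he, Matrix.diagonal_one, Matrix.one_mul, h1])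
  have h3 : Matrix.diagonal (expVal e α x) * (Matrix.diagonal (expVal e (-α) x) *
      y.map (evalS x)) = 0 := by rw [h2, Matrix.mul_zero]
  rw [← Matrix.mul_assoc, Matrix.diagonal_mul_diagonal] at h3
  simp only [expVal_mul_neg he, Matrix.diagonal_one, Matrix.one_mul] at h3
  exact congrFun (congrFun h3 i) j

/-- The inverse of the Wronski matrix. -/
def wronInv (e : Fin m → R) (α : Fin m → Fin l → ℂ) (d : ℂ[X]) (N : Matrix (Fin l) (Fin l) R[X])
    (x : ℂ) : Matrix (Fin l) (Fin l) R :=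
  (d.eval x)⁻¹ • (Matrix.diagonal (expVal e (-α) x) * N.map (evalS x))

theorem scalar_map_evalS (x : ℂ) (d : ℂ[X]) :
    (Matrix.scalar (Fin l) (sc d : R[X])).map (evalS x) = d.eval x • (1 : Matrix _ _ R) := by
  rw [Matrix.scalar_apply, Matrix.diagonal_map (map_zero _)]
  ext i j
  by_cases hij : i = j
  · subst hij; simp [evalS_sc, Algebra.algebraMap_eq_smul_one]
  · simp [hij]

theorem wronskian_mul_wronInv (he : CompleteOrthogonalIdempotents e) {p : Fin m → Fin l → R[X]}
    {α : Fin m → Fin l → ℂ} {d : ℂ[X]} {N : Matrix (Fin l) (Fin l) R[X]}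
    (h : wronMatrix e p α * N = Matrix.scalar _ (sc d)) {x : ℂ} (hx : d.eval x ≠ 0) :
    wronskian (adapted e p α) x * wronInv e α d N x = 1 := by
  rw [wronskian_adapted he, wronInv, Matrix.mul_smul, Matrix.mul_assoc,
    ← Matrix.mul_assoc (Matrix.diagonal _), Matrix.diagonal_mul_diagonal]
  simp only [expVal_mul_neg he, Matrix.diagonal_one, Matrix.one_mul]
  rw [← Matrix.map_mul, h, scalar_map_evalS, smul_smul, inv_mul_cancel₀ hx, one_smul]

theorem wronInv_mul_wronskian (he : CompleteOrthogonalIdempotents e) {p : Fin m → Fin l → R[X]}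
    {α : Fin m → Fin l → ℂ} {d : ℂ[X]} {N : Matrix (Fin l) (Fin l) R[X]}
    (h : N * wronMatrix e p α = Matrix.scalar _ (sc d)) {x : ℂ} (hx : d.eval x ≠ 0) :
    wronInv e α d N x * wronskian (adapted e p α) x = 1 := by
  rw [wronskian_adapted he, wronInv, Matrix.smul_mul, Matrix.mul_assoc,
    ← Matrix.mul_assoc (N.map _), ← Matrix.map_mul, h, scalar_map_evalS, Matrix.smul_mul,
    Matrix.mul_smul, smul_smul, inv_mul_cancel₀ hx, one_smul, Matrix.one_mul,
    Matrix.diagonal_mul_diagonal]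
  simp only [expVal_neg_mul he, Matrix.diagonal_one]

theorem meromorphicAt_evalS (φ : Module.Dual ℂ R) (r : R) (p : R[X]) (x : ℂ) :
    MeromorphicAt (fun z => φ (r * evalS z p)) x := by
  induction p using Polynomial.induction_on' with
  | add p q hp hq => simpa only [map_add, mul_add] using hp.fun_add hq
  | monomial n a =>
    have : ∀ z : ℂ, φ (r * evalS z (monomial n a)) = z ^ n * φ (r * a) := fun z => by
      rw [evalS_apply, eval_monomial, ← map_pow, ← Algebra.commutes, ← Algebra.smul_def,
        mul_smul_comm, map_smul, smul_eq_mul]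
    simp only [this]
    fun_prop

theorem isMeromorphic_wronInv (e : Fin m → R) (α : Fin m → Fin l → ℂ) (d : ℂ[X])
    (N : Matrix (Fin l) (Fin l) R[X]) (i j : Fin l) :
    IsMeromorphic fun x => wronInv e α d N x i j := by
  intro φ x _
  have : ∀ z, φ (wronInv e α d N z i j) = (d.eval z)⁻¹ *
      ∑ k, Complex.exp (-α k i * z) * φ (e k * evalS z (N i j)) := fun z => by
    rw [wronInv, Matrix.smul_apply, Matrix.diagonal_mul, Matrix.map_apply, map_smul, smul_eq_mul,
      expVal, Finset.sum_mul, map_sum]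
    simp only [smul_mul_assoc, map_smul, smul_eq_mul, Pi.neg_apply]
  simp only [this]
  have h1 : MeromorphicAt (fun z => d.eval z) x := by
    have := meromorphicAt_evalS (LinearMap.id : Module.Dual ℂ ℂ) 1 d x
    simpa [evalS_apply] using this
  have h2 : ∀ k, MeromorphicAt (fun z => φ (e k * evalS z (N i j))) x := fun k =>
    meromorphicAt_evalS φ _ _ x
  have h3 : ∀ k, MeromorphicAt (fun z : ℂ => Complex.exp (-α k i * z)) x := fun k =>
    AnalyticAt.meromorphicAt (by fun_prop)
  exact h1.fun_inv.fun_mul (MeromorphicAt.fun_sum fun k _ => (h3 k).fun_mul (h2 k))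

theorem exists_wronMatrix_inverse [Module.Finite ℂ R] (he : CompleteOrthogonalIdempotents e)
    {p : Fin m → Fin l → R[X]} {α : Fin m → Fin l → ℂ} {s : Set ℂ} (hs : s.Infinite)
    (h : ∀ x ∈ s, ∀ y, wronskian (adapted e p α) x * y = 0 → y = 0) :
    ∃ (d : ℂ[X]) (N : Matrix (Fin l) (Fin l) R[X]), d ≠ 0 ∧
      wronMatrix e p α * N = Matrix.scalar _ (sc d) ∧
      N * wronMatrix e p α = Matrix.scalar _ (sc d) :=
  exists_matrix_mul_eq_scalar _ (wronMatrix_regular he hs h)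

theorem wronskian_mulVec (F : Fin l → QP R) (x : ℂ) (c : Fin l → R) (i : Fin l) :
    (wronskian F x).mulVec c i = ev x ((D ^ (i : ℕ)) (∑ j, MulOpposite.op (c j) • F j)) := by
  simp only [Matrix.mulVec, dotProduct, map_sum, map_smul, op_smul_eq_mul, wronskian_apply]

/-- The adapted bases of the kernels of Darboux operators are nondegenerate. -/
theorem BasedPoint.isNondegenerate [Module.Finite ℂ R] (he : CompleteOrthogonalIdempotents e)
    (b : BasedPoint e) : IsNondegenerate (adapted e b.p b.α) := by
  obtain ⟨δ, -, hδ, -, -, hjets⟩ := b.isDarboux.jets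
  obtain ⟨d, N, hd, h1, h2⟩ := exists_wronMatrix_inverse he (p := b.p) (α := b.α)
    (infinite_eval_ne_zero hδ) (fun x hx y hy => by
      ext1 i j
      -- A column of y killed by the Wronski matrix gives an element of the kernel with zero l-jet
      -- at x.
      set f : QP R := ∑ i, MulOpposite.op (y i j) • adapted e b.p b.α i with hf
      have hfker : f ∈ b.P.ker := by
        rw [← b.span_eq]
        exact Submodule.sum_mem _ fun i _ =>
          Submodule.smul_mem _ _ (Submodule.subset_span ⟨i, rfl⟩)
      have hf0 : f = 0 := (hjets x hx).1 f hfker fun i hi => by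
        rw [hf, ← wronskian_mulVec _ x (fun k => y k j) ⟨i, hi⟩]
        exact congrFun (congrFun hy ⟨i, hi⟩) j
      have := Fintype.linearIndependent_iff.mp b.linearIndependent _ hf0 i
      simpa using this)
  refine ⟨wronInv e b.α d N, isMeromorphic_wronInv e b.α d N, ?_⟩
  have : ∀ᶠ x in Filter.codiscrete ℂ, d.eval x ≠ 0 :=
    codiscrete_le_cofinite (eventually_eval_ne_zero hd)
  filter_upwards [this] with x hx
  exact ⟨wronskian_mul_wronInv he h1 hx, wronInv_mul_wronskian he h2 hx⟩

/-! ### From nondegenerate adapted families to Darboux operators -/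

theorem infinite_of_mem_codiscrete {s : Set ℂ} (hs : s ∈ Filter.codiscrete ℂ) : s.Infinite := by
  intro hfin
  have h1 := Filter.inter_mem hs hfin.compl_mem_codiscrete
  rw [Set.inter_compl_self, mem_codiscrete] at h1
  have h2 := h1 0
  rw [Set.compl_empty, Filter.principal_univ, disjoint_top] at h2
  exact Filter.NeBot.ne inferInstance h2

theorem exists_common_annihilator {ι : Type*} (s : Finset ι) (F : ι → QP R) :
    ∃ h : ℂ[X], h.Monic ∧ ∀ j ∈ s, opOf (sc h) (F j) = 0 := by
  classical
  choose h hh hF using fun j => exists_scalar_annihilator (F j)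
  refine ⟨∏ j ∈ s, h j, monic_prod_of_monic _ _ fun j _ => hh j, fun j hj => ?_⟩
  rw [← Finset.prod_erase_mul _ _ hj, map_mul, opOf_mul, hF, map_zero]

theorem leftMulQR_actP_toQR {S : (RatR R)[X]} {n : ℕ} (hS : ∀ k, n ≤ k → S.coeff k = 0) {d : ℂ[X]}
    {b : ℕ → R[X]} (hb : ∀ i < n, ratP d * S.coeff i = polyToRat R (b i)) (f : QP R) :
    leftMulQR (ratP d) (actP S f.toQR) =
      (∑ i ∈ Finset.range n, b i • (D ^ i) f).toQR := by
  rw [actP_eq_sum S hS, LinearMap.sum_apply, map_sum, toQR_sum]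
  refine Finset.sum_congr rfl fun i hi => ?_
  rw [Module.End.mul_apply, ← Module.End.mul_apply, ← leftMulQR_mul, hb i (Finset.mem_range.mp hi),
    dQR_pow_toQR, leftMulQR_toQR]

/-- A monic operator that annihilates a nondegenerate adapted family. -/
theorem exists_monic_annihilator (he : CompleteOrthogonalIdempotents e)
    {p : Fin m → Fin l → R[X]} {α : Fin m → Fin l → ℂ} {d : ℂ[X]} (hd : d ≠ 0)
    {N : Matrix (Fin l) (Fin l) R[X]} (hN : N * wronMatrix e p α = Matrix.scalar _ (sc d)) :
    ∃ S : (RatR R)[X], IsMonicSymb S l ∧ ∀ j, actP S (adapted e p α j).toQR = 0 := by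
  set r : Fin l → R[X] := fun j => wronEntry e p α l j with hr
  -- Cramer's rule for ∑ cᵢ f_j⁽ⁱ⁾ + d f_j⁽ˡ⁾ = 0: with r the row of l-th derivatives, c W = -r N W
  -- = -r d.
  set c : Fin l → R[X] := -(Matrix.vecMul r N) with hc
  set b : ℕ → R[X] := fun i => if h : i < l then c ⟨i, h⟩ else sc d with hb
  have hrow : ∀ j, ∑ i, c i * wronEntry e p α i j + sc d * r j = 0 := by
    intro j
    have h1 : Matrix.vecMul c (wronMatrix e p α) = -(Matrix.vecMul r (Matrix.scalar _ (sc d))) := by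
      rw [hc, Matrix.neg_vecMul, Matrix.vecMul_vecMul, hN]
    have h2 := congrFun h1 j
    rw [Pi.neg_apply, Matrix.scalar_apply, Matrix.vecMul_diagonal, sc_apply, ← map_mul_comm,
      ← sc_apply] at h2
    rw [← neg_eq_iff_add_eq_zero.mp h2.symm]
    rw [add_comm]; rfl
  set S : (RatR R)[X] := ∑ i ∈ Finset.range (l + 1),
    monomial i (ratS (algebraMap ℂ[X] (RatFunc ℂ) d)⁻¹ * polyToRat R (b i)) with hS
  have hSc : ∀ k, S.coeff k = if k < l + 1 then
      ratS (algebraMap ℂ[X] (RatFunc ℂ) d)⁻¹ * polyToRat R (b k) else 0 := fun k => by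
    simp only [hS, finsetSum_coeff, coeff_monomial, Finset.sum_ite_eq', Finset.mem_range]
  have hd' := RatFunc.algebraMap_ne_zero hd
  have hbl : b l = sc d := by simp [hb]
  have hSm : IsMonicSymb S l := by
    refine ⟨?_, fun k hk => by rw [hSc, if_neg (by omega)]⟩
    rw [hSc, if_pos (Nat.lt_succ_self l), hbl, ← ratP_eq, ← ratS_mul, inv_mul_cancel₀ hd', ratS_one]
  refine ⟨S, hSm, fun j => eq_zero_of_leftMulQR hd ?_⟩
  rw [leftMulQR_actP_toQR (n := l + 1) (b := b) hSm.2, ← toQR_zero]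
  · congr 1
    rw [Finset.sum_range_succ, hbl, ← Fin.sum_univ_eq_sum_range (fun i => b i • (D ^ i) _)]
    simp only [D_pow_adapted he, ← mul_smul, ← Finset.sum_smul, ← add_smul]
    have : ∀ i : Fin l, b i = c i := fun i => by simp [hb]
    simp only [this]
    rw [hrow, zero_smul]
  · intro i hi
    rw [hSc, if_pos hi, ← mul_assoc, ← ratS_mul, mul_inv_cancel₀ hd', ratS_one, one_mul]

/-- An operator of order less than `l` that annihilates a nondegenerate family is zero. -/
theorem eq_zero_of_annihilates_adapted (he : CompleteOrthogonalIdempotents e)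
    {p : Fin m → Fin l → R[X]} {α : Fin m → Fin l → ℂ} {d : ℂ[X]} (hd : d ≠ 0)
    {N : Matrix (Fin l) (Fin l) R[X]} (hN : wronMatrix e p α * N = Matrix.scalar _ (sc d))
    {U : (RatR R)[X]} (hU : ∀ k, l ≤ k → U.coeff k = 0)
    (h : ∀ j, actP U (adapted e p α j).toQR = 0) : U = 0 := by
  obtain ⟨c, b, hc, hb⟩ := exists_common_denom l U.coeff
  have h1 : ∀ j, ∑ i : Fin l, b i * wronEntry e p α i j = 0 := by
    intro j
    refine eq_zero_of_infinite_evalS _ (Set.infinite_univ (α := ℂ)) fun x _ => ?_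
    have h2 := leftMulQR_actP_toQR hU hb (adapted e p α j)
    rw [h, map_zero, ← toQR_zero] at h2
    have h3 := congrArg (ev x) (toQR_injective h2)
    rw [← Fin.sum_univ_eq_sum_range (fun i => b i • (D ^ i) (adapted e p α j))] at h3
    simp only [D_pow_adapted he, ← mul_smul, ← Finset.sum_smul] at h3
    rw [map_zero, ev_poly_smul, ev_expPart] at h3
    have h4 := congrArg (· * expVal e (-α) x j) h3.symm
    simpa only [mul_assoc, expVal_mul_neg he, mul_one, zero_mul] using h4
  have h2 : Matrix.vecMul (fun i : Fin l => b i) (wronMatrix e p α) = 0 := funext h1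
  have h3 : Matrix.vecMul (fun i : Fin l => b i) (Matrix.scalar _ (sc d)) = 0 := by
    rw [← hN, ← Matrix.vecMul_vecMul, h2, Matrix.zero_vecMul]
  ext1 k
  rw [coeff_zero]
  by_cases hk : k < l
  · have h4 := congrFun h3 ⟨k, hk⟩
    rw [Matrix.scalar_apply, Matrix.vecMul_diagonal, sc_apply, ← map_mul_comm, ← sc_apply] at h4
    refine ratP_mul_cancel (mul_ne_zero hd hc) ?_
    rw [ratP_mul, mul_assoc, hb k hk, ratP_eq, ← polyToRat_mul, mul_zero]
    change polyToRat R (sc d * b k) = 0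
    rw [show sc d * b k = 0 from h4, map_zero]
  · exact hU k (not_lt.mp hk)

/-- A nondegenerate adapted family is a basis of the kernel of a Darboux operator. -/
theorem IsNondegenerate.exists_basedPoint [Module.Finite ℂ R]
    (he : CompleteOrthogonalIdempotents e) {p : Fin m → Fin l → R[X]} {α : Fin m → Fin l → ℂ}
    (hnd : IsNondegenerate (adapted e p α)) : ∃ P : DiffOp R, P.IsDarboux l ∧
      LinearIndependent Rᵐᵒᵖ (adapted e p α) ∧
      Submodule.span Rᵐᵒᵖ (Set.range (adapted e p α)) = P.ker := by
  obtain ⟨N₀, -, hN₀⟩ := hnd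
  obtain ⟨d, N, hd, hN, hN'⟩ := exists_wronMatrix_inverse he (p := p) (α := α)
    (infinite_of_mem_codiscrete hN₀) (fun x hx y hy => by
      rw [← Matrix.one_mul y, ← hx.2, Matrix.mul_assoc, hy, Matrix.mul_zero])
  obtain ⟨S, hS, hSF⟩ := exists_monic_annihilator he hd hN'
  obtain ⟨h, hh, hhF⟩ := exists_common_annihilator Finset.univ (adapted e p α)
  -- Both h(∂) and S kill the family, so the remainder does too. Its order is less than l, hence it
  -- is zero and S right-divides h(∂).
  obtain ⟨Q, U, hQU, hU⟩ := exists_div hS (constS (sc h))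
  have hU0 : U = 0 := eq_zero_of_annihilates_adapted he hd hN hU fun j => by
    have h1 := LinearMap.congr_fun hQU (adapted e p α j).toQR
    rw [actP_constS_toQR, hhF j (Finset.mem_univ j), toQR_zero, LinearMap.add_apply,
      Module.End.mul_apply, hSF, map_zero, zero_add] at h1
    exact h1.symm
  rw [hU0, actP_zero, add_zero] at hQU
  set P : DiffOp R := ofSymb S
  have hP : P.IsDarboux l := by
    refine ⟨hS, ofSymb (constS (sc h)), h.natDegree, ⟨?_, fun k hk => ?_⟩, fun k => ⟨(sc h : R[X]).coeff k, ?_⟩,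
      ofSymb Q, hQU⟩
    · rw [ofSymb_apply, coeff_constS, sc_apply, coeff_map, coeff_natDegree, hh, map_one]; rfl
    · rw [ofSymb_apply, coeff_constS, sc_apply, coeff_map, coeff_eq_zero_of_natDegree_lt hk,
        map_zero, zero_tmul]
    · rw [ofSymb_apply, coeff_constS]
  obtain ⟨δ, -, hδ, -, -, hjets⟩ := hP.jets
  obtain ⟨x, hx⟩ := (infinite_eval_ne_zero (mul_ne_zero hδ hd)).nonempty
  rw [Set.mem_ofPred_eq, eval_mul] at hx
  have hW := wronskian_mul_wronInv he hN (right_ne_zero_of_mul hx)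
  have hW' := wronInv_mul_wronskian he hN' (right_ne_zero_of_mul hx)
  have hle : Submodule.span Rᵐᵒᵖ (Set.range (adapted e p α)) ≤ P.ker := by
    rw [Submodule.span_le]
    rintro _ ⟨j, rfl⟩
    exact hSF j
  refine ⟨P, hP, ?_, le_antisymm hle fun f hf => ?_⟩
  · rw [Fintype.linearIndependent_iff]
    intro c hc j
    have h1 : (wronskian (adapted e p α) x).mulVec (fun j => (c j).unop) = 0 := by
      ext1 i
      rw [wronskian_mulVec]
      simp only [MulOpposite.op_unop, hc, map_zero, Pi.zero_apply]
    have h2 := congrArg (wronInv e α d N x).mulVec h1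
    rw [Matrix.mulVec_mulVec, hW', Matrix.one_mulVec, Matrix.mulVec_zero] at h2
    exact MulOpposite.unop_injective (congrFun h2 j)
  -- The combination of the family with the same l-jet at x as f. Elements of the kernel are
  -- determined by this jet.
  · set c := (wronInv e α d N x).mulVec fun i => ev x ((D ^ (i : ℕ)) f)
    set g : QP R := ∑ j, MulOpposite.op (c j) • adapted e p α j
    have hg : g ∈ Submodule.span Rᵐᵒᵖ (Set.range (adapted e p α)) :=
      Submodule.sum_mem _ fun i _ => Submodule.smul_mem _ _ (Submodule.subset_span ⟨i, rfl⟩)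
    have h1 : f - g = 0 := (hjets x (left_ne_zero_of_mul hx)).1 _ (Submodule.sub_mem _ hf (hle hg))
      fun i hi => by
        rw [map_sub, map_sub, ← wronskian_mulVec _ x c ⟨i, hi⟩, Matrix.mulVec_mulVec, hW,
          Matrix.one_mulVec, sub_self]
    rw [sub_eq_zero.mp h1]
    exact hg

theorem BasedPoint.iotaTilde_eq (b : BasedPoint e) : b.iotaTilde =
    mulRat (⨅ j, LinearMap.ker (wilson (adapted e b.p b.α j))) (gInv e b.α) := by
  rw [iotaTilde, ← b.span_eq, perp_span]

end Algebra

end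

end AdelicGr

/-! ### Theorem C -/

theorem theoremC {R : Type*} [Ring R] [Algebra ℂ R] [Module.Finite ℂ R] {m : ℕ} (e : Fin m → R)
    (he : CompleteOrthogonalIdempotents e) (hprim : ∀ k, AdelicGr.IsPrimitiveIdempotent (e k)) :
    (∀ Φ : AdelicGr.DecGrAd R, ∃ b : AdelicGr.BasedPoint e, b.point = Φ) ∧
    (∀ b : AdelicGr.BasedPoint e, b.iotaTilde ∈ AdelicGr.GrRat R) ∧
    ∃ ι : AdelicGr.GrAd e → AdelicGr.GrRat R,
      (∀ b : AdelicGr.BasedPoint e, (ι b.norm : Submodule R (AdelicGr.RatR R)) = b.iotaTilde) ∧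
      Function.Injective ι ∧
      ∀ M : AdelicGr.GrRat R, M ∈ Set.range ι ↔
        ∃ (l : ℕ) (p : Fin m → Fin l → Polynomial R) (α : Fin m → Fin l → ℂ),
          AdelicGr.IsNondegenerate (AdelicGr.adapted e p α) ∧
          (M : Submodule R (AdelicGr.RatR R)) =
            AdelicGr.mulRat (⨅ j, LinearMap.ker (AdelicGr.wilson (AdelicGr.adapted e p α j)))
              (AdelicGr.gInv e α) := by
  refine ⟨AdelicGr.exists_basedPoint he hprim, fun b => b.iotaTilde_mem he, ?_⟩
  -- ι is defined through an arbitrary based point over each normalized function. Independence of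
  -- the choice is one direction of `BasedPoint.normFun_eq_iff`, injectivity the other.
  choose rep hrep using fun Φ : AdelicGr.GrAd e => Φ.2
  set ι : AdelicGr.GrAd e → AdelicGr.GrRat R := fun Φ => ⟨(rep Φ).iotaTilde, (rep Φ).iotaTilde_mem he⟩
  have hι : ∀ b : AdelicGr.BasedPoint e,
      (ι b.norm : Submodule R (AdelicGr.RatR R)) = b.iotaTilde := fun b =>
    (AdelicGr.BasedPoint.normFun_eq_iff he _ _).mp (hrep b.norm)
  refine ⟨ι, hι, fun Φ Ψ h => ?_, fun M => ⟨?_, ?_⟩⟩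
  · refine Subtype.ext ?_
    rw [← hrep Φ, ← hrep Ψ]
    exact (AdelicGr.BasedPoint.normFun_eq_iff he _ _).mpr (congrArg Subtype.val h)
  · rintro ⟨Φ, rfl⟩
    exact ⟨_, _, _, (rep Φ).isNondegenerate he, (rep Φ).iotaTilde_eq⟩
  · rintro ⟨l, p, α, hnd, hM⟩
    obtain ⟨P, hP, h1, h2⟩ := hnd.exists_basedPoint he
    let b : AdelicGr.BasedPoint e := ⟨l, P, p, α, hP, h1, h2⟩
    exact ⟨b.norm, Subtype.ext ((hι b).trans (b.iotaTilde_eq.trans hM.symm))⟩
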